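/- Let $n\ge 2$ and $m\ge 1$, let $B=B^n$ be the open unit ball of $\mathbf R^n$, $S=S^{n-1}$ its boundary, $\sigma$ the normalized rotation invariant Borel measure on $S$, $N=(0,\dots,0,1)$, and let $P(x,\zeta)=\frac{1-|x|^2}{|x-\zeta|^n}$ ($\zeta\in S$) be the Poisson kernel, with $P_r(\eta)=P(rN,\eta)=\frac{1-r^2}{(1+r^2-2r\eta_n)^{n/2}}$. For $1\le p\le\infty$ let $q\in[1,\infty]$ be the conjugate exponent, $1/p+1/q=1$, and put $$g_p(r)=\inf_{a\in[0,\infty)}\|P_r-a\|_{L^q(S,\sigma)},\qquad 0\le r<1 .$$ Let $\mathcal H^p=\mathcal H^p(B^n,\mathbf R^m)$ be the class of harmonic mappings $f:B^n\to\mathbf R^m$ with $\|f\|_p:=\sup_{0\le r<1}\big(\int_S|f(r\eta)|^p\,d\sigma(\eta)\big)^{1/p}<\infty$ (for $p=\infty$: $\|f\|_\infty=\sup_{B}|f|$), and let $U(x)=\int_S P(x,\zeta)\,(\chi_{S^+}-\chi_{S^-})(\zeta)\,d\sigma(\zeta)$, where $S^{\pm}=\{\zeta\in S:\pm\zeta_n\ge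 0\}$. Finally put $$C_p=n\left(\frac{\Gamma(\frac n2)\,\Gamma(\frac{1+q}2)}{\sqrt\pi\,\Gamma(\frac{n+q}2)}\right)^{1/q}\quad(1<p\le\infty),\qquad C_1=n,$$ the value $C_1$ being the limit of the expression as $q\to\infty$. Then: 1. For $1\le p<\infty$, $g_p$ is a $C^\infty$ increasing diffeomorphism of $[0,1)$ onto $[0,\infty)$ (with $C^\infty$ inverse), and $g_p(0)=0$. 2. For $1\le p\le\infty$ and every $f\in\mathcal H^p$ with $f(0)=0$, $$|f(x)|\le g_p(|x|)\,\|f\|_p\quad(x\in B),\qquad \|Df(0)\|\le C_p\,\|f\|_p ,$$ where $\|Df(0)\|=\sup_{|h|=1}|Df(0)h|$. 3. Both inequalities are sharp: for every $1\le p\le\infty$ and every $x\in B$ there is $f\in\mathcal H^p$ with $f(0)=0$, $\|f\|_p>0$ and $|f(x)|=g_p(|x|)\|f\|_p$; and for every $1\le p\le\infty$ there is $f\in\mathcal H^p$ with $f(0)=0$, $\|f\|_p>0$ and $\|Df(0)\|=C_p\|f\|_p$. 4. For $p=\infty$, $g_\infty(r)=U(rN)$ for $0\le r<1$, so that the first inequality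 of part 2 is the classical Schwarz lemma $|f(x)|\le U(|x|N)\|f\|_\infty$ for harmonic mappings; and $g_\infty$, extended by its boundary value $g_\infty(1)=1$, is a $C^\infty$ increasing diffeomorphism of $[0,1]$ onto itself. -/

import Mathlib

open MeasureTheory Set
open scoped ENNReal NNReal

noncomputable section

namespace HarmonicSchwarz

/-- The unit sphere `S = S^{n-1}` of `ℝⁿ`. -/
abbrev Sph (n : ℕ) : Type := Metric.sphere (0 : EuclideanSpace ℝ (Fin n)) 1

/-- The normalized rotation invariant Borel measure `σ` on `S^{n-1}`: the surface measure
of the sphere divided by its total mass. -/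
def sigma (n : ℕ) : Measure (Sph n) :=
  ((volume : Measure (EuclideanSpace ℝ (Fin n))).toSphere univ)⁻¹ •
    (volume : Measure (EuclideanSpace ℝ (Fin n))).toSphere

/-- The north pole `N = (0, …, 0, 1)` of `S^{n-1}`. -/
def north (n : ℕ) : EuclideanSpace ℝ (Fin n) :=
  WithLp.toLp 2 fun i => if (i : ℕ) + 1 = n then 1 else 0

/-- The Poisson kernel `P(x, ζ) = (1 - |x|²) / |x - ζ|ⁿ` of the unit ball, `ζ ∈ S`. -/
def poissonKernel (n : ℕ) (x : EuclideanSpace ℝ (Fin n)) (ζ : Sph n) : ℝ :=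
  (1 - ‖x‖ ^ 2) / ‖x - (ζ : EuclideanSpace ℝ (Fin n))‖ ^ n

/-- `P_r(η) = P(rN, η)`. -/
def poissonRadial (n : ℕ) (r : ℝ) (η : Sph n) : ℝ :=
  poissonKernel n (r • north n) η

/-- The Poisson integral `𝓟[φ](x) = ∫_S P(x, ζ) φ(ζ) dσ(ζ)`. -/
def poissonIntegral (n : ℕ) (φ : Sph n → ℝ) (x : EuclideanSpace ℝ (Fin n)) : ℝ :=
  ∫ ζ, poissonKernel n x ζ * φ ζ ∂(sigma n)

/-- `S⁺ = {ζ ∈ S : ζ_n ≥ 0}`, where `ζ_n = ⟨N, ζ⟩` is the last coordinate. -/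
def upperHalf (n : ℕ) : Set (Sph n) :=
  {ζ | 0 ≤ inner ℝ (north n) (ζ : EuclideanSpace ℝ (Fin n))}

/-- `S⁻ = {ζ ∈ S : ζ_n ≤ 0}`. -/
def lowerHalf (n : ℕ) : Set (Sph n) :=
  {ζ | inner ℝ (north n) (ζ : EuclideanSpace ℝ (Fin n)) ≤ 0}

/-- `U = 𝓟[χ_{S⁺} - χ_{S⁻}]`. -/
def U (n : ℕ) : EuclideanSpace ℝ (Fin n) → ℝ :=
  poissonIntegral n fun ζ =>
    (upperHalf n).indicator (fun _ => (1 : ℝ)) ζ - (lowerHalf n).indicator (fun _ => (1 : ℝ)) ζ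

/-- `g_p(r) = inf_{a ≥ 0} ‖P_r - a‖_{L^q(S)}`, where `q` is the conjugate exponent of `p`
(so `q = ∞` for `p = 1` and `q = 1` for `p = ∞`). -/
def g (n : ℕ) (p : ℝ≥0∞) (r : ℝ) : ℝ :=
  (⨅ a : ℝ≥0, eLpNorm (fun η => poissonRadial n r η - (a : ℝ)) p.conjExponent (sigma n)).toReal

/-- `sup_{0 ≤ r < 1} (∫_S |f(rη)|^p dσ(η))^{1/p}` as an element of `[0, ∞]`; for `p = ∞` the
inner expression is the essential supremum of `|f(rη)|` over `η ∈ S`. -/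
def hardyENorm {n m : ℕ} (p : ℝ≥0∞)
    (f : EuclideanSpace ℝ (Fin n) → EuclideanSpace ℝ (Fin m)) : ℝ≥0∞ :=
  ⨆ r ∈ Ico (0 : ℝ) 1,
    eLpNorm (fun η : Sph n => f (r • (η : EuclideanSpace ℝ (Fin n)))) p (sigma n)

/-- The Hardy norm `‖f‖_p` (meaningful when `hardyENorm p f < ∞`). -/
def hardyNorm {n m : ℕ} (p : ℝ≥0∞)
    (f : EuclideanSpace ℝ (Fin n) → EuclideanSpace ℝ (Fin m)) : ℝ :=
  (hardyENorm p f).toReal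

/-- `f ∈ 𝓗^p(Bⁿ, ℝᵐ)`: `f` is harmonic in the unit ball and `‖f‖_p < ∞`. Only the values of
`f` in the open unit ball matter. -/
structure MemHardy {n m : ℕ} (p : ℝ≥0∞)
    (f : EuclideanSpace ℝ (Fin n) → EuclideanSpace ℝ (Fin m)) : Prop where
  harmonic : InnerProductSpace.HarmonicOnNhd f (Metric.ball 0 1)
  finite : hardyENorm p f < ⊤

/-- The constant `n (Γ(n/2) Γ((1+q)/2) / (√π Γ((n+q)/2)))^{1/q}`, where `q` is the conjugate
exponent of `p`. For `p = 1`, that is `q = ∞`, it is the limit as `q → ∞`, which is `n`. -/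
def gradConst (n : ℕ) (p : ℝ≥0∞) : ℝ :=
  if p = 1 then n
  else
    n * (Real.Gamma ((n : ℝ) / 2) * Real.Gamma ((1 + p.conjExponent.toReal) / 2) /
      (√Real.pi * Real.Gamma (((n : ℝ) + p.conjExponent.toReal) / 2))) ^
        (1 / p.conjExponent.toReal)

/-- `φ` restricts to an increasing `C^∞` diffeomorphism of `s` onto `t`: a strictly increasing
smooth bijection from `s` onto `t` whose inverse `ψ : t → s` is smooth (one-sided derivatives
at the end points that belong to the intervals). -/
def IsIncreasingDiffeo (φ : ℝ → ℝ) (s t : Set ℝ) : Prop :=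
  BijOn φ s t ∧ StrictMonoOn φ s ∧ ContDiffOn ℝ (⊤ : ℕ∞) φ s ∧
    ∃ ψ : ℝ → ℝ, LeftInvOn ψ φ s ∧ ContDiffOn ℝ (⊤ : ℕ∞) ψ t

end HarmonicSchwarz

end

/-! Since f(0) = 0, the Poisson formula for the dilates f(R·), R < 1, gives f(Rx) = ∫ (P(x,ζ) − a)
f(Rζ) dσ(ζ) for every constant a. Hölder's inequality, the infimum over a ≥ 0 and R → 1 give |f(x)|
≤ g_p(|x|) ‖f‖_p. For p > 1 the optimal level a is the balanced one, for which φ = sgn(P − a)|P −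
a|^{q−1} has mean zero. The Poisson integral of φ then vanishes at 0 and φ gives equality in
Hölder's inequality, which shows at once that a realizes the infimum (`g_eq_of_balanced`) and that
the bound is sharp. For p = 1 the level is the midpoint of the range of P_r, and the difference of
two Poisson kernels with antipodal poles is extremal.

Smoothness of g_p, 1 < p < ∞. The level is written as the value of P_r at a height s, and P_r(t) −
P_r(s) = r(t − s)D(r,s,t) with D smooth and positive for r in (−1,1). The powers occurring in the
integrals are singular at t = s. The Möbius change of height t = (u + s)/(1 + su) moves this zero to
the fixed height u = 0, where a power of u splits off and leaves a smooth positive factor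
(`contDiffOn_integral_homogeneous`). The implicit function theorem makes the balanced height s(r)
smooth, and g_p(r) = r E(r, s(r))^{1/q}, with E the mean of |(t − s)D|^q, extends smoothly to
(−1,1). Its derivative at 0 is n times the L^q norm of ζ_n, which is C_p by a Gaussian moment
computation. The gradient bound is the first inequality differentiated at 0, and the Poisson
integral of sgn(ζ_n)|ζ_n|^{q−1} attains it.

Monotonicity is an envelope argument (`deriv_pos_of_balanced`). The extremal φ at radius r is a
competitor at every radius ρ, so g_p(ρ)‖φ‖_p − ∫ φ P_ρ has a minimum at ρ = r and g_p′(r)‖φ‖_p = ∫ φ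
∂_r P_r. The factor ∂_r P_r has mean zero and changes sign once as the height grows, while φ is
increasing in the height; hence the integral is positive. For finite p, small polar caps show that
g_p is unbounded.

For p = ∞ the sign of P_r(t) − P_r(0) is the sign of t, so the equator is balanced for every r and
g_∞(r) = U(rN). Writing this as 1 minus an integral over the lower hemisphere continues it smoothly
past r = 1. -/

namespace HarmonicSchwarz

open Filter Topology

/-! ### Smooth dependence of integrals on parameters -/

section ParametricIntegral

variable {X : Type} [TopologicalSpace X] [SecondCountableTopology X] [MeasurableSpace X]
  [BorelSpace X] {μ : Measure X}
  {E U : Type} [NormedAddCommGroup E] [NormedSpace ℝ E] [ProperSpace E]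
  [NormedAddCommGroup U] [NormedSpace ℝ U]
  {O : Set E} {K : Set U} {ι : X → U} {φ : X → ℝ}

omit [NormedSpace ℝ U] in
theorem integrable_smul_comp_of_continuousOn {G : Type} [NormedAddCommGroup G] [NormedSpace ℝ G]
    (hK : IsCompact K) (hι : Continuous ι) (hιK : ∀ x, ι x ∈ K)
    (hφ : Integrable φ μ) {h : U → G} (hh : ContinuousOn h K) :
    Integrable (fun x => φ x • h (ι x)) μ := by
  obtain ⟨C, hC⟩ := hK.exists_bound_of_continuousOn hh
  exact hφ.smul_bdd (C := C) (hh.comp_continuous hι hιK).aestronglyMeasurable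
    (Eventually.of_forall fun x => hC _ (hιK x))

/-- The parameter enters only through the jointly smooth factor `H`; the weight `φ` need only be
integrable, so it may later be a sign or a power of the height. On a closed ball around `z₀` times
`K` the partial derivative of `H` has a bound `C`, and `|φ| * C` dominates. -/
theorem hasFDerivAt_integral_smul {G : Type} [NormedAddCommGroup G] [NormedSpace ℝ G]
    (hO : IsOpen O) (hK : IsCompact K) (hι : Continuous ι) (hιK : ∀ x, ι x ∈ K)
    (hφ : Integrable φ μ) {H : E × U → G}
    (hH : ∀ z ∈ O, ∀ u ∈ K, ContDiffAt ℝ 1 H (z, u)) {z₀ : E} (hz₀ : z₀ ∈ O) :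
    HasFDerivAt (fun z => ∫ x, φ x • H (z, ι x) ∂μ)
      (∫ x, φ x • (fderiv ℝ H (z₀, ι x)).comp (ContinuousLinearMap.inl ℝ E U) ∂μ) z₀ := by
  obtain ⟨ε, hε, hεO⟩ := Metric.nhds_basis_closedBall.mem_iff.1 (hO.mem_nhds hz₀)
  have hcont : ContinuousOn
      (fun p : E × U => (fderiv ℝ H p).comp (ContinuousLinearMap.inl ℝ E U)) (O ×ˢ K) := by
    intro p hp
    have h1 : ContinuousAt (fderiv ℝ H) p :=
      ((hH p.1 hp.1 p.2 hp.2).fderiv_right (m := 0) le_rfl).continuousAt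
    exact ((ContinuousLinearMap.continuous
      ((ContinuousLinearMap.compL ℝ E (E × U) G).flip
        (ContinuousLinearMap.inl ℝ E U))).continuousAt.comp h1).continuousWithinAt
  have hcomp : IsCompact (Metric.closedBall z₀ ε ×ˢ K) :=
    (isCompact_closedBall z₀ ε).prod hK
  obtain ⟨C, hC⟩ := hcomp.exists_bound_of_continuousOn
    (hcont.mono (prod_mono hεO Subset.rfl))
  have hsec : ∀ z ∈ O, ContinuousOn (fun u => H (z, u)) K := fun z hz u hu =>
    ((hH z hz u hu).continuousAt.comp (f := fun u => (z, u))
      (by fun_prop)).continuousWithinAt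
  refine hasFDerivAt_integral_of_dominated_of_fderiv_le (s := Metric.closedBall z₀ ε)
    (F' := fun z x => φ x • (fderiv ℝ H (z, ι x)).comp (ContinuousLinearMap.inl ℝ E U))
    (bound := fun x => |φ x| * C) (Metric.closedBall_mem_nhds z₀ hε) ?_ ?_ ?_ ?_ ?_ ?_
  · filter_upwards [hO.mem_nhds hz₀] with z hz
    exact (integrable_smul_comp_of_continuousOn hK hι hιK hφ (hsec z hz)).1
  · exact integrable_smul_comp_of_continuousOn hK hι hιK hφ (hsec z₀ hz₀)
  · refine (integrable_smul_comp_of_continuousOn (h := fun u =>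
      (fderiv ℝ H (z₀, u)).comp (ContinuousLinearMap.inl ℝ E U)) hK hι hιK hφ ?_).1
    exact hcont.comp (Continuous.continuousOn (by fun_prop)) fun u hu => ⟨hz₀, hu⟩
  · refine Eventually.of_forall fun x z hz => ?_
    rw [norm_smul, Real.norm_eq_abs]
    exact mul_le_mul_of_nonneg_left (hC (z, ι x) ⟨hz, hιK x⟩) (abs_nonneg _)
  · exact hφ.abs.mul_const C
  · refine Eventually.of_forall fun x z hz => ?_
    have h1 := ((hH z (hεO hz) (ι x) (hιK x)).differentiableAt one_ne_zero).hasFDerivAt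
    exact (h1.comp z (hasFDerivAt_prodMk_left z (ι x))).const_smul (φ x)

/-- The derivative is an integral of the same shape whose `H` takes values in `E →L[ℝ] G`; hence the
target space has to vary in the induction. -/
theorem contDiffOn_nat_integral_smul (hO : IsOpen O) (hK : IsCompact K) (hι : Continuous ι)
    (hιK : ∀ x, ι x ∈ K) (hφ : Integrable φ μ) (n : ℕ) :
    ∀ {G : Type} [NormedAddCommGroup G] [NormedSpace ℝ G] {H : E × U → G},
    (∀ z ∈ O, ∀ u ∈ K, ContDiffAt ℝ (⊤ : ℕ∞) H (z, u)) →
      ContDiffOn ℝ n (fun z => ∫ x, φ x • H (z, ι x) ∂μ) O := by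
  induction n with
  | zero =>
    intro G _ _ H hH
    exact contDiffOn_zero.2 fun z hz => (hasFDerivAt_integral_smul hO hK hι hιK hφ
      (fun z hz u hu => (hH z hz u hu).of_le (by exact_mod_cast le_top))
        hz).continuousAt.continuousWithinAt
  | succ n ih =>
    intro G _ _ H hH
    have hd := fun z hz => hasFDerivAt_integral_smul (z₀ := z) hO hK hι hιK hφ
      (fun z hz u hu => (hH z hz u hu).of_le (by exact_mod_cast le_top)) hz
    push_cast
    rw [contDiffOn_succ_iff_fderiv_of_isOpen hO]
    refine ⟨fun z hz => (hd z hz).differentiableAt.differentiableWithinAt, by simp, ?_⟩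
    refine (ih (H := fun p => (fderiv ℝ H p).comp (ContinuousLinearMap.inl ℝ E U)) ?_).congr
      fun z hz => (hd z hz).fderiv
    intro z hz u hu
    have h1 : ContDiffAt ℝ (⊤ : ℕ∞) (fderiv ℝ H) (z, u) :=
      (hH z hz u hu).fderiv_right (by exact_mod_cast le_top)
    exact h1.clm_comp contDiffAt_const

theorem contDiffOn_integral_smul {G : Type} [NormedAddCommGroup G] [NormedSpace ℝ G]
    (hO : IsOpen O) (hK : IsCompact K) (hι : Continuous ι)
    (hιK : ∀ x, ι x ∈ K) (hφ : Integrable φ μ) {H : E × U → G}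
    (hH : ∀ z ∈ O, ∀ u ∈ K, ContDiffAt ℝ (⊤ : ℕ∞) H (z, u)) :
    ContDiffOn ℝ (⊤ : ℕ∞) (fun z => ∫ x, φ x • H (z, ι x) ∂μ) O :=
  contDiffOn_infty.2 fun n => contDiffOn_nat_integral_smul hO hK hι hιK hφ n hH

end ParametricIntegral

/-- An extension `G` to an open interval takes care of the end points of `s`. The inverse is smooth
because near each point it coincides with the local inverse of the inverse function theorem. -/
theorem isIncreasingDiffeo_of_deriv_pos {G φ : ℝ → ℝ} {a b : ℝ} {s t : Set ℝ}
    (hG : ContDiffOn ℝ (⊤ : ℕ∞) G (Ioo a b)) (hpos : ∀ x ∈ Ioo a b, 0 < deriv G x)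
    (hs : s ⊆ Ioo a b) (hφ : EqOn φ G s) (hst : G '' s = t) : IsIncreasingDiffeo φ s t := by
  have hmono : StrictMonoOn G (Ioo a b) :=
    strictMonoOn_of_deriv_pos (convex_Ioo a b) hG.continuousOn (by simpa using hpos)
  have hinv : LeftInvOn (Function.invFunOn G (Ioo a b)) G (Ioo a b) :=
    hmono.injOn.leftInvOn_invFunOn
  refine ⟨?_, (hmono.mono hs).congr hφ.symm, (hG.mono hs).congr hφ,
    Function.invFunOn G (Ioo a b), fun x hx => ?_, ?_⟩
  · rw [hφ.bijOn_iff, ← hst]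
    exact (hmono.injOn.mono hs).bijOn_image
  · rw [hφ hx]
    exact hinv (hs hx)
  · rw [← hst]
    rintro _ ⟨x, hx, rfl⟩
    have hx' := hs hx
    have hc : ContDiffAt ℝ (⊤ : ℕ∞) G x := hG.contDiffAt (Ioo_mem_nhds hx'.1 hx'.2)
    have h0 := (hpos x hx').ne'
    have hd := (hc.differentiableAt (by simp)).hasDerivAt.hasFDerivAt_equiv h0
    have hli := hc.to_localInverse hd (by simp)
    refine (hli.congr_of_eventuallyEq ?_).contDiffWithinAt
    refine (hc.hasStrictFDerivAt' hd (by simp)).localInverse_unique ?_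
    filter_upwards [Ioo_mem_nhds hx'.1 hx'.2] with y hy using hinv hy

end HarmonicSchwarz

namespace HarmonicSchwarz

open Filter Topology
open scoped Pointwise

/-! ### The normalized surface measure and its rotation invariance -/

section SphereMeasure

theorem inner_north (k : ℕ) (x : EuclideanSpace ℝ (Fin (k + 1))) :
    inner ℝ (north (k + 1)) x = x (Fin.last k) := by
  have h : north (k + 1) = EuclideanSpace.single (Fin.last k) 1 := by
    ext i
    simp [north, Fin.ext_iff]
  rw [h, EuclideanSpace.inner_single_left]
  simp

variable {n : ℕ} [hn : Fact (2 ≤ n)]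

instance : Nontrivial (EuclideanSpace ℝ (Fin n)) := by
  have : Nonempty (Fin n) := ⟨⟨0, by have := hn.out; omega⟩⟩
  infer_instance

theorem norm_north : ‖north n‖ = 1 := by
  obtain ⟨k, rfl⟩ : ∃ k, n = k + 1 := ⟨n - 1, by have := hn.out; omega⟩
  have h : north (k + 1) = EuclideanSpace.single (Fin.last k) 1 := by
    ext i
    simp [north, Fin.ext_iff]
  simp [h]

variable (n) in
/-- The north pole as a point of the sphere. -/
noncomputable def pole : Sph n := ⟨north n, by simp [norm_north]⟩

instance : IsProbabilityMeasure (sigma n) := by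
  refine ⟨?_⟩
  rw [sigma, Measure.smul_apply, smul_eq_mul]
  refine ENNReal.inv_mul_cancel ?_ (measure_ne_top _ _)
  exact (Measure.measure_univ_ne_zero).2 (Measure.toSphere_ne_zero _)

instance : (sigma n).IsOpenPosMeasure := by
  refine ⟨fun V hV hne => ?_⟩
  rw [sigma, Measure.smul_apply, smul_eq_mul]
  exact mul_ne_zero (ENNReal.inv_ne_zero.2 (measure_ne_top _ _)) (hV.measure_ne_zero _ hne)

omit hn in
theorem sigma_apply {s : Set (Sph n)} (hs : MeasurableSet s) :
    sigma n s = ((volume : Measure (EuclideanSpace ℝ (Fin n))).toSphere univ)⁻¹ *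
      (n * volume (Ioo (0 : ℝ) 1 • ((↑) '' s : Set (EuclideanSpace ℝ (Fin n))))) := by
  rw [sigma, Measure.smul_apply, smul_eq_mul, Measure.toSphere_apply' _ hs, finrank_euclideanSpace,
    Fintype.card_fin]

/-- The action of a linear isometry on the sphere. -/
noncomputable def rotate (A : EuclideanSpace ℝ (Fin n) ≃ₗᵢ[ℝ] EuclideanSpace ℝ (Fin n))
    (ζ : Sph n) : Sph n :=
  ⟨A ζ, by simp⟩

omit hn in
@[simp]
theorem coe_rotate (A : EuclideanSpace ℝ (Fin n) ≃ₗᵢ[ℝ] EuclideanSpace ℝ (Fin n)) (ζ : Sph n) :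
    (rotate A ζ : EuclideanSpace ℝ (Fin n)) = A ζ := rfl

omit hn in
theorem continuous_rotate (A : EuclideanSpace ℝ (Fin n) ≃ₗᵢ[ℝ] EuclideanSpace ℝ (Fin n)) :
    Continuous (rotate A) :=
  (A.continuous.comp continuous_subtype_val).subtype_mk _

omit hn in
-- The surface measure of a set is a multiple of the volume of the cone over it, and linear
-- isometries commute with forming cones and preserve volume.
theorem measurePreserving_rotate
    (A : EuclideanSpace ℝ (Fin n) ≃ₗᵢ[ℝ] EuclideanSpace ℝ (Fin n)) :
    MeasurePreserving (rotate A) (sigma n) (sigma n) := by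
  refine ⟨(continuous_rotate A).measurable, ?_⟩
  ext s hs
  have hs' : MeasurableSet (rotate A ⁻¹' s) := (continuous_rotate A).measurable hs
  rw [Measure.map_apply (continuous_rotate A).measurable hs, sigma_apply hs', sigma_apply hs]
  congr 2
  have h : Ioo (0 : ℝ) 1 • ((↑) '' (rotate A ⁻¹' s) : Set (EuclideanSpace ℝ (Fin n))) =
      A ⁻¹' (Ioo (0 : ℝ) 1 • ((↑) '' s : Set (EuclideanSpace ℝ (Fin n)))) := by
    ext x
    simp only [Set.mem_smul, mem_image, mem_preimage]
    constructor
    · rintro ⟨c, hc, _, ⟨ζ, hζ, rfl⟩, rfl⟩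
      exact ⟨c, hc, _, ⟨_, hζ, rfl⟩, by simp⟩
    · rintro ⟨c, hc, _, ⟨ζ, hζ, rfl⟩, h⟩
      refine ⟨c, hc, _, ⟨rotate A.symm ζ, ?_, rfl⟩, ?_⟩
      · have h1 : rotate A (rotate A.symm ζ) = ζ := by
          ext1
          simp
        rw [h1]
        exact hζ
      · apply A.injective
        simp [h]
  rw [h]
  exact (LinearIsometryEquiv.measurePreserving A).measure_preimage_equiv
    (f := A.toHomeomorph.toMeasurableEquiv) _

/-- The last coordinate `ζ_n` of a point of the sphere. -/
noncomputable def height (ζ : Sph n) : ℝ := inner ℝ (north n) (ζ : EuclideanSpace ℝ (Fin n))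

omit hn in
theorem continuous_height : Continuous (height (n := n)) := by
  unfold height; fun_prop

theorem height_mem (ζ : Sph n) : height ζ ∈ Icc (-1 : ℝ) 1 := by
  have := abs_real_inner_le_norm (north n) (ζ : EuclideanSpace ℝ (Fin n))
  rw [norm_north, norm_eq_of_mem_sphere, mul_one] at this
  exact abs_le.1 this

theorem height_pole : height (pole n) = 1 := by
  simp [height, pole, norm_north]

theorem height_neg_pole : height (-pole n) = -1 := by
  simp [height, pole, norm_north]

end SphereMeasure

/-! ### The distribution of the last coordinate -/

section Law

/-- The density of the last coordinate, after the substitution `ζ_n = tanh v`. -/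
noncomputable def sechPow (k : ℕ) (v : ℝ) : ℝ≥0∞ := ENNReal.ofReal ((Real.cosh v)⁻¹ ^ k)

/-- Scaling by `cosh v` in dimension `k` divides the integral by `cosh v ^ k`. This is the integral
over the first `k` coordinates in the computation of cone volumes. -/
theorem lintegral_indicator_cosh_smul (k : ℕ) :
    ∃ C : ℝ≥0∞, ∀ v : ℝ, ∫⁻ y : EuclideanSpace ℝ (Fin k),
      (Metric.ball 0 1).indicator (fun y => ENNReal.ofReal ‖y‖) (Real.cosh v • y) =
        C * sechPow k v := by
  refine ⟨∫⁻ y : EuclideanSpace ℝ (Fin k),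
    (Metric.ball 0 1).indicator (fun y => ENNReal.ofReal ‖y‖) y, fun v => ?_⟩
  have hm : Measurable fun y : EuclideanSpace ℝ (Fin k) =>
      (Metric.ball 0 1).indicator (fun y => ENNReal.ofReal ‖y‖) y :=
    Measurable.indicator (by fun_prop) measurableSet_ball
  have hc := Real.cosh_pos v
  rw [← lintegral_map (f := fun y : EuclideanSpace ℝ (Fin k) =>
      (Metric.ball 0 1).indicator (fun y => ENNReal.ofReal ‖y‖) y)
      (g := fun y : EuclideanSpace ℝ (Fin k) => Real.cosh v • y) hm (by fun_prop),
    Measure.map_addHaar_smul _ hc.ne', lintegral_smul_measure, finrank_euclideanSpace,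
    Fintype.card_fin, smul_eq_mul, mul_comm, sechPow, abs_of_pos (by positivity), inv_pow]

theorem continuous_tanh : Continuous Real.tanh := by
  rw [funext Real.tanh_eq_sinh_div_cosh]
  exact Real.continuous_sinh.div Real.continuous_cosh fun x => (Real.cosh_pos x).ne'

theorem lintegral_comp_mul_sinh (c : ℝ) (hc : 0 < c) (F : ℝ → ℝ≥0∞) :
    ∫⁻ z, F z = ∫⁻ v, ENNReal.ofReal (c * Real.cosh v) * F (c * Real.sinh v) := by
  have himg : (fun v => c * Real.sinh v) '' univ = univ := by
    rw [image_univ, Set.range_eq_univ]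
    exact fun z => ⟨Real.arsinh (z / c), by simp [mul_div_cancel₀ _ hc.ne']⟩
  have := lintegral_image_eq_lintegral_abs_deriv_mul (s := univ)
    (f := fun v => c * Real.sinh v) (f' := fun v => c * Real.cosh v) MeasurableSet.univ
    (fun v _ => ((Real.hasDerivAt_sinh v).const_mul c).hasDerivWithinAt)
    (fun v _ w _ h => Real.sinh_injective (mul_left_cancel₀ hc.ne' h)) F
  rw [himg] at this
  simp only [Measure.restrict_univ] at this
  rw [this]
  refine lintegral_congr fun v => ?_
  rw [abs_of_pos (mul_pos hc (Real.cosh_pos v))]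

/-- Split x = (z, y) with z the last coordinate and put z = ‖y‖ sinh v. Then ‖x‖ = ‖y‖ cosh v and z
/ ‖x‖ = tanh v, so the condition on the height depends on v alone. -/
theorem exists_volume_cone (k : ℕ) (hk : 1 ≤ k) : ∃ C : ℝ≥0∞, ∀ A : Set ℝ, MeasurableSet A →
    volume {x : EuclideanSpace ℝ (Fin (k + 1)) | (0 < ‖x‖ ∧ ‖x‖ < 1) ∧
      x (Fin.last k) / ‖x‖ ∈ A} = C * ∫⁻ v, A.indicator 1 (Real.tanh v) * sechPow k v := by
  obtain ⟨C, hC⟩ := lintegral_indicator_cosh_smul k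
  refine ⟨C, fun A hA => ?_⟩
  have hk0 : Nonempty (Fin k) := ⟨⟨0, hk⟩⟩
  let e : EuclideanSpace ℝ (Fin (k + 1)) → ℝ × EuclideanSpace ℝ (Fin k) :=
    (Prod.map id (WithLp.toLp 2)) ∘
      (MeasurableEquiv.piFinSuccAbove (fun _ => ℝ) (Fin.last k)) ∘ WithLp.ofLp
  have he : MeasurePreserving e volume volume :=
    ((MeasurePreserving.id _).prod (PiLp.volume_preserving_toLp (Fin k))).comp
      ((volume_preserving_piFinSuccAbove (fun _ => ℝ) (Fin.last k)).comp
        (PiLp.volume_preserving_ofLp (Fin (k + 1))))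
  have h1 : ∀ x, (e x).1 = x (Fin.last k) := fun x => rfl
  have h2 : ∀ x, ‖x‖ = √((e x).1 ^ 2 + ‖(e x).2‖ ^ 2) := by
    intro x
    rw [EuclideanSpace.norm_eq, EuclideanSpace.norm_eq, Real.sq_sqrt (by positivity),
      Fin.sum_univ_castSucc, add_comm]
    simp [e, Fin.init]
  let B : Set (ℝ × EuclideanSpace ℝ (Fin k)) :=
    {p | (0 < √(p.1 ^ 2 + ‖p.2‖ ^ 2) ∧ √(p.1 ^ 2 + ‖p.2‖ ^ 2) < 1) ∧
      p.1 / √(p.1 ^ 2 + ‖p.2‖ ^ 2) ∈ A}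
  let r : ℝ × EuclideanSpace ℝ (Fin k) → ℝ := fun p => √(p.1 ^ 2 + ‖p.2‖ ^ 2)
  have hr : Measurable r := by fun_prop
  have hB : MeasurableSet B := by
    refine MeasurableSet.inter (MeasurableSet.inter ?_ ?_) ?_
    · exact measurableSet_lt measurable_const (hr : Measurable r)
    · exact measurableSet_lt (hr : Measurable r) measurable_const
    · exact (by fun_prop : Measurable fun p : ℝ × EuclideanSpace ℝ (Fin k) =>
        p.1 / √(p.1 ^ 2 + ‖p.2‖ ^ 2)) hA
  have hpre : {x : EuclideanSpace ℝ (Fin (k + 1)) | (0 < ‖x‖ ∧ ‖x‖ < 1) ∧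
      x (Fin.last k) / ‖x‖ ∈ A} = e ⁻¹' B := by
    ext x
    simp only [mem_ofPred_eq, mem_preimage, B, ← h2 x, ← h1 x]
  rw [hpre, he.measure_preimage hB.nullMeasurableSet, Measure.volume_eq_prod,
    Measure.prod_apply_symm hB]
  -- The Jacobian ‖y‖ cosh v of the substitution equals ‖cosh v • y‖, which is also ‖x‖; so both the
  -- ball condition and the Jacobian are functions of `cosh v • y`.
  have hsub : ∀ y : EuclideanSpace ℝ (Fin k), y ≠ 0 →
      volume ((fun z => (z, y)) ⁻¹' B) = ∫⁻ v, A.indicator 1 (Real.tanh v) *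
        (Metric.ball 0 1).indicator (fun y => ENNReal.ofReal ‖y‖) (Real.cosh v • y) := by
    intro y hy
    have hy' := norm_pos_iff.2 hy
    rw [← lintegral_indicator_one (measurable_prodMk_right hB),
      lintegral_comp_mul_sinh ‖y‖ hy']
    refine lintegral_congr fun v => ?_
    have hcv := Real.cosh_pos v
    have hs : √((‖y‖ * Real.sinh v) ^ 2 + ‖y‖ ^ 2) = ‖y‖ * Real.cosh v := by
      rw [Real.sqrt_eq_iff_mul_self_eq (by positivity) (by positivity)]
      linear_combination (-‖y‖ ^ 2) * Real.cosh_sq v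
    have ht : ‖y‖ * Real.sinh v / (‖y‖ * Real.cosh v) = Real.tanh v := by
      rw [mul_div_mul_left _ _ hy'.ne', Real.tanh_eq_sinh_div_cosh]
    have hnorm : ‖Real.cosh v • y‖ = ‖y‖ * Real.cosh v := by
      rw [norm_smul, Real.norm_of_nonneg hcv.le, mul_comm]
    have hpos : 0 < ‖y‖ * Real.cosh v := by positivity
    by_cases hA' : Real.tanh v ∈ A <;> by_cases hb : ‖y‖ * Real.cosh v < 1 <;>
      simp only [indicator, B, mem_ofPred_eq, mem_preimage, hs, ht, hA', hb, hpos, mem_ball_zero_iff,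
        hnorm, true_and, and_true, and_false, if_true, if_false, Pi.one_apply, mul_one, one_mul,
        mul_zero, zero_mul]
  have hae : ∀ᵐ y : EuclideanSpace ℝ (Fin k), y ≠ 0 := by
    simp [ae_iff]
  rw [lintegral_congr_ae (hae.mono hsub), lintegral_lintegral_swap, ← lintegral_const_mul]
  · refine lintegral_congr fun v => ?_
    rw [lintegral_const_mul, hC]
    · ring
    · exact (Measurable.indicator (by fun_prop) measurableSet_ball).comp (by fun_prop)
  · refine Measurable.mul ((measurable_one.indicator hA).comp ?_) (by unfold sechPow; fun_prop)
    exact continuous_tanh.measurable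
  · refine (Measurable.mul ((measurable_one.indicator hA).comp ?_) ?_).aemeasurable
    · exact continuous_tanh.measurable.comp measurable_snd
    · exact (Measurable.indicator (f := fun y : EuclideanSpace ℝ (Fin k) => ENNReal.ofReal ‖y‖)
        (by fun_prop) measurableSet_ball).comp
        (by fun_prop : Measurable fun p : EuclideanSpace ℝ (Fin k) × ℝ => Real.cosh p.2 • p.1)

variable {n : ℕ} [hn : Fact (2 ≤ n)]

/-- The constant can stay unknown: the Möbius formula has it on both sides, and the moments are
computed separately from Gaussian integrals. -/
theorem exists_map_height : ∃ C : ℝ≥0∞, (sigma n).map height =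
    C • ((volume.withDensity (sechPow (n - 1))).map Real.tanh) := by
  obtain ⟨k, rfl⟩ : ∃ k, n = k + 1 := ⟨n - 1, by have := hn.out; omega⟩
  obtain ⟨C, hC⟩ := exists_volume_cone k (by have := hn.out; omega)
  refine ⟨((volume : Measure (EuclideanSpace ℝ (Fin (k + 1)))).toSphere univ)⁻¹ *
    ((k + 1 : ℕ) * C), ?_⟩
  ext A hA
  have hh := (continuous_height (n := k + 1)).measurable
  rw [Measure.map_apply hh hA, sigma_apply (hh hA), Measure.smul_apply,
    Measure.map_apply continuous_tanh.measurable hA,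
    withDensity_apply _ (continuous_tanh.measurable hA), smul_eq_mul, mul_assoc, mul_assoc,
    ← lintegral_indicator (continuous_tanh.measurable hA)]
  congr 2
  convert hC A hA using 2
  · ext x
    simp only [Set.mem_smul, mem_image, mem_preimage, mem_ofPred_eq, height, inner_north]
    constructor
    · rintro ⟨c, hc, _, ⟨ζ, hζ, rfl⟩, rfl⟩
      have : ‖c • (ζ : EuclideanSpace ℝ (Fin (k + 1)))‖ = c := by
        rw [norm_smul, norm_eq_of_mem_sphere, mul_one, Real.norm_of_nonneg hc.1.le]
      rw [this]
      exact ⟨hc, by simpa [hc.1.ne'] using hζ⟩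
    · rintro ⟨⟨h0, h1⟩, h⟩
      refine ⟨‖x‖, ⟨h0, h1⟩, ‖x‖⁻¹ • x, ⟨⟨‖x‖⁻¹ • x, ?_⟩, ?_, rfl⟩, ?_⟩
      · simp [norm_smul, h0.ne']
      · simpa [div_eq_inv_mul] using h
      · simp [smul_smul, h0.ne']
  · refine lintegral_congr fun v => ?_
    by_cases hv : Real.tanh v ∈ A <;> simp [indicator, hv]

theorem exists_lintegral_height : ∃ C : ℝ≥0∞, ∀ f : ℝ → ℝ≥0∞, Measurable f →
    ∫⁻ ζ, f (height ζ) ∂(sigma n) =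
      C * ∫⁻ v, f (Real.tanh v) * sechPow (n - 1) v := by
  obtain ⟨C, hC⟩ := exists_map_height (n := n)
  have hs : Measurable (sechPow (n - 1)) := by unfold sechPow; fun_prop
  have ht := continuous_tanh.measurable
  refine ⟨C, fun f hf => ?_⟩
  rw [← lintegral_map hf continuous_height.measurable, hC, lintegral_smul_measure,
    lintegral_map hf ht, smul_eq_mul]
  congr 1
  refine (lintegral_withDensity_eq_lintegral_mul _ hs (hf.comp ht)).trans ?_
  simp [mul_comm]

theorem sigma_height_eq (c : ℝ) : sigma n {ζ | height ζ = c} = 0 := by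
  obtain ⟨C, hC⟩ := exists_lintegral_height (n := n)
  have h := hC (({c} : Set ℝ).indicator 1) (measurable_one.indicator (measurableSet_singleton c))
  have h1 : ∫⁻ ζ : Sph n, ({c} : Set ℝ).indicator 1 (height ζ) ∂(sigma n) =
      sigma n {ζ | height ζ = c} := by
    have hm : MeasurableSet {ζ : Sph n | height ζ = c} :=
      continuous_height.measurable (measurableSet_singleton c)
    rw [← lintegral_indicator_one hm]
    rfl
  have h2 : ∫⁻ v, ({c} : Set ℝ).indicator (1 : ℝ → ℝ≥0∞) (Real.tanh v) * sechPow (n - 1) v = 0 := by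
    rw [lintegral_eq_zero_iff']
    · have hsub : {v : ℝ | Real.tanh v = c}.Subsingleton := fun v hv w hw =>
        Real.tanh_injective (hv.trans hw.symm)
      have : ∀ᵐ v : ℝ, v ∉ {v : ℝ | Real.tanh v = c} := by
        rw [ae_iff]
        simpa using hsub.measure_zero volume
      filter_upwards [this] with v hv
      have hv' : Real.tanh v ≠ c := hv
      simp [indicator, hv']
    · exact ((measurable_one.indicator (measurableSet_singleton c)).comp
        continuous_tanh.measurable).mul (by unfold sechPow; fun_prop) |>.aemeasurable
  rw [← h1, h, h2, mul_zero]

end Law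

end HarmonicSchwarz

namespace HarmonicSchwarz

open Filter Topology

/-! ### Möbius change of variable in the height -/

section Moebius

variable {n : ℕ} [hn : Fact (2 ≤ n)]

variable (n) in
/-- The density of the Möbius transformation of the sphere which moves heights by
`t ↦ (t + s) / (1 + s t)`. -/
noncomputable def moebiusDensity (s t : ℝ) : ℝ := (√(1 - s ^ 2) / (1 + s * t)) ^ (n - 1)

/-- With height = tanh v this is translation invariance of Lebesgue measure under v ↦ v + artanh s:
the addition formula for tanh is the Möbius map, and `moebiusDensity` is the ratio of the two powers
of sech. -/
theorem lintegral_height_moebius {s : ℝ} (hs : s ∈ Ioo (-1 : ℝ) 1) {f : ℝ → ℝ≥0∞}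
    (hf : Measurable f) :
    ∫⁻ ζ, f (height ζ) ∂(sigma n) =
      ∫⁻ ζ, ENNReal.ofReal (moebiusDensity n s (height ζ)) *
        f ((height ζ + s) / (1 + s * height ζ)) ∂(sigma n) := by
  obtain ⟨C, hC⟩ := exists_lintegral_height (n := n)
  set c := Real.artanh s
  have hsc : s = Real.tanh c := (Real.tanh_artanh hs).symm
  rw [hC f hf, hC (fun t => ENNReal.ofReal (moebiusDensity n s t) * f ((t + s) / (1 + s * t)))
    (by unfold moebiusDensity; fun_prop),
    ← lintegral_add_right_eq_self (fun v => f (Real.tanh v) * sechPow (n - 1) v) c]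
  congr 1
  refine lintegral_congr fun v => ?_
  have hcv := Real.cosh_pos v
  have hcc := Real.cosh_pos c
  have hcvc := Real.cosh_pos (v + c)
  have h1 : 1 + s * Real.tanh v = Real.cosh (v + c) / (Real.cosh v * Real.cosh c) := by
    rw [hsc, Real.tanh_eq_sinh_div_cosh, Real.tanh_eq_sinh_div_cosh, Real.cosh_add]
    field_simp
  have h2 : (Real.tanh v + s) / (1 + s * Real.tanh v) = Real.tanh (v + c) := by
    rw [h1, hsc, Real.tanh_eq_sinh_div_cosh, Real.tanh_eq_sinh_div_cosh,
      Real.tanh_eq_sinh_div_cosh, Real.sinh_add]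
    field_simp
  have h3 : √(1 - s ^ 2) = (Real.cosh c)⁻¹ := by
    rw [Real.cosh_artanh hs, one_div, inv_inv]
  have h4 : √(1 - s ^ 2) / (1 + s * Real.tanh v) * (Real.cosh v)⁻¹ = (Real.cosh (v + c))⁻¹ := by
    rw [h1, h3]
    field_simp
  have h5 : 0 ≤ √(1 - s ^ 2) / (1 + s * Real.tanh v) := by
    rw [h1]; positivity
  rw [h2, sechPow, sechPow, moebiusDensity, ← h4, mul_pow, ENNReal.ofReal_mul (by positivity)]
  ring

theorem one_add_mul_pos {s t : ℝ} (hs : s ∈ Ioo (-1 : ℝ) 1) (ht : t ∈ Icc (-1 : ℝ) 1) :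
    0 < 1 + s * t := by
  have h1 : |s * t| < 1 := by
    rw [abs_mul]
    exact mul_lt_one_of_nonneg_of_lt_one_left (abs_nonneg s) (abs_lt.2 hs) (abs_le.2 ht)
  linarith [(abs_lt.1 h1).1]

omit hn in
theorem moebiusDensity_nonneg {s t : ℝ} (hs : s ∈ Ioo (-1 : ℝ) 1) (ht : t ∈ Icc (-1 : ℝ) 1) :
    0 ≤ moebiusDensity n s t := by
  have := one_add_mul_pos hs ht
  unfold moebiusDensity
  positivity

theorem integral_height_moebius {s : ℝ} (hs : s ∈ Ioo (-1 : ℝ) 1) {f : ℝ → ℝ}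
    (hf : Measurable f) :
    ∫ ζ, f (height ζ) ∂(sigma n) =
      ∫ ζ, moebiusDensity n s (height ζ) *
        f ((height ζ + s) / (1 + s * height ζ)) ∂(sigma n) := by
  have hh := (continuous_height (n := n)).measurable
  have hd : Measurable fun ζ : Sph n => (moebiusDensity n s (height ζ)).toNNReal := by
    unfold moebiusDensity; fun_prop
  have hg : Measurable fun ζ : Sph n => (height ζ + s) / (1 + s * height ζ) := by fun_prop
  -- The formula for all nonnegative functions identifies two pushforward measures; real integrals
  -- are then compared through these measures.
  have hmap : (sigma n).map height =
      ((sigma n).withDensity fun ζ => ((moebiusDensity n s (height ζ)).toNNReal : ℝ≥0∞)).map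
        fun ζ => (height ζ + s) / (1 + s * height ζ) := by
    refine Measure.ext_of_lintegral _ fun F hF => ?_
    rw [lintegral_map hF hh, lintegral_map hF hg, lintegral_height_moebius hs hF]
    exact (lintegral_withDensity_eq_lintegral_mul _ hd.coe_nnreal_ennreal (hF.comp hg)).symm
  rw [← integral_map hh.aemeasurable hf.aestronglyMeasurable, hmap,
    integral_map hg.aemeasurable hf.aestronglyMeasurable,
    integral_withDensity_eq_integral_smul hd]
  refine integral_congr_ae (Eventually.of_forall fun ζ => ?_)
  simp only [NNReal.smul_def, Real.coe_toNNReal _ (moebiusDensity_nonneg hs (height_mem ζ)),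
    smul_eq_mul]

omit hn in
theorem height_neg (ζ : Sph n) : height (-ζ) = -height ζ := by
  simp [height]

omit hn in
theorem measurePreserving_neg_sphere : MeasurePreserving (fun ζ : Sph n => -ζ) (sigma n) (sigma n) := by
  convert measurePreserving_rotate (LinearIsometryEquiv.neg ℝ (E := EuclideanSpace ℝ (Fin n))) using 1
  ext ζ
  simp

omit hn in
theorem integral_neg_sphere (F : Sph n → ℝ) : ∫ ζ, F (-ζ) ∂(sigma n) = ∫ ζ, F ζ ∂(sigma n) :=
  measurePreserving_neg_sphere.integral_comp
    (Homeomorph.neg (Sph n)).measurableEmbedding F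

theorem integral_eq_zero_of_odd {F : Sph n → ℝ} (hF : ∀ ζ, F (-ζ) = -F ζ) :
    ∫ ζ, F ζ ∂(sigma n) = 0 := by
  have h := integral_neg_sphere F
  simp only [hF, integral_neg] at h
  linarith

end Moebius

/-! ### Absolute moments of the last coordinate -/

section Moments

theorem integral_abs_rpow_mul_exp {q : ℝ} (hq : 0 ≤ q) :
    ∫ x : ℝ, |x| ^ q * Real.exp (-x ^ 2) = Real.Gamma ((q + 1) / 2) := by
  have h := integral_comp_abs (f := fun x : ℝ => x ^ q * Real.exp (-x ^ 2))
  simp only [sq_abs] at h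
  rw [h]
  have h2 := integral_rpow_mul_exp_neg_rpow (p := 2) (q := q) (by norm_num) (by linarith)
  simp only [Real.rpow_two] at h2
  rw [h2]
  ring

theorem integral_gaussian_moment (k : ℕ) {q : ℝ} (hq : 0 ≤ q) :
    ∫ x : EuclideanSpace ℝ (Fin (k + 1)), |x (Fin.last k)| ^ q * Real.exp (-‖x‖ ^ 2) =
      Real.Gamma ((q + 1) / 2) * √Real.pi ^ k := by
  let f : Fin (k + 1) → ℝ → ℝ := fun i x =>
    if i = Fin.last k then |x| ^ q * Real.exp (-x ^ 2) else Real.exp (-x ^ 2)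
  have h1 : ∀ x : EuclideanSpace ℝ (Fin (k + 1)),
      |x (Fin.last k)| ^ q * Real.exp (-‖x‖ ^ 2) = ∏ i, f i (WithLp.ofLp x i) := by
    intro x
    rw [EuclideanSpace.norm_sq_eq, Fin.prod_univ_castSucc, Fin.sum_univ_castSucc]
    simp only [f, Fin.castSucc_ne_last, if_false, if_true, Real.norm_eq_abs, sq_abs]
    rw [← Real.exp_sum, mul_left_comm, ← Real.exp_add]
    simp [Finset.sum_neg_distrib]
    left
    ring
  simp_rw [h1]
  rw [(PiLp.volume_preserving_ofLp (Fin (k + 1))).integral_comp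
    (MeasurableEquiv.toLp 2 (Fin (k + 1) → ℝ)).symm.measurableEmbedding
    (fun y : Fin (k + 1) → ℝ => ∏ i, f i (y i)), integral_fintype_prod_volume_eq_prod,
    Fin.prod_univ_castSucc]
  have h2 : ∫ x : ℝ, Real.exp (-x ^ 2) = √Real.pi := by
    simpa using integral_gaussian 1
  simp only [f, Fin.castSucc_ne_last, if_false, if_true, integral_abs_rpow_mul_exp hq, h2,
    Finset.prod_const, Finset.card_univ, Fintype.card_fin]
  ring

variable {n : ℕ} [hn : Fact (2 ≤ n)]

theorem integral_volumeIoiPow_gaussian (k : ℕ) {q : ℝ} (hq : 0 ≤ q) :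
    ∫ ρ : Ioi (0 : ℝ), (ρ : ℝ) ^ q * Real.exp (-(ρ : ℝ) ^ 2) ∂(Measure.volumeIoiPow k) =
      Real.Gamma ((k + 1 + q) / 2) / 2 := by
  simp only [Measure.volumeIoiPow, ENNReal.ofReal]
  rw [integral_withDensity_eq_integral_smul
    ((measurable_subtype_coe.pow_const _).real_toNNReal),
    integral_subtype_comap measurableSet_Ioi
      fun a : ℝ => Real.toNNReal (a ^ k) • (a ^ q * Real.exp (-a ^ 2))]
  have h2 := integral_rpow_mul_exp_neg_rpow (p := 2) (q := k + q) (by norm_num)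
    (by have := k.cast_nonneg (α := ℝ); linarith)
  simp only [Real.rpow_two] at h2
  rw [show (k + 1 + q) / 2 = (k + q + 1) / 2 by ring, div_eq_inv_mul, ← one_div, ← h2]
  refine setIntegral_congr_fun measurableSet_Ioi fun x hx => ?_
  have hx' : (0 : ℝ) < x := hx
  simp only [NNReal.smul_def, Real.coe_toNNReal _ (pow_nonneg hx'.le _), smul_eq_mul]
  rw [Real.rpow_add hx', Real.rpow_natCast]
  ring

theorem integral_eq_integral_comap_compl_zero {E : Type*} [NormedAddCommGroup E]
    [MeasurableSpace E] [BorelSpace E] (μ : Measure E) [NullSingletonClass μ] (G : E → ℝ) :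
    ∫ x, G x ∂μ = ∫ x : ({0}ᶜ : Set E), G x ∂μ.comap (↑) := by
  rw [integral_subtype_comap (measurableSet_singleton _).compl G, restrict_compl_singleton]

/-- Polar coordinates split the Gaussian moment of the last coordinate into a spherical factor and a
radial Gamma integral; the product structure of the Gaussian evaluates the same moment. -/
theorem integral_toSphere_abs_height_rpow {q : ℝ} (hq : 0 ≤ q) :
    (∫ ζ : Sph n, |height ζ| ^ q ∂(volume : Measure (EuclideanSpace ℝ (Fin n))).toSphere) *
      (Real.Gamma ((n + q) / 2) / 2) = Real.Gamma ((q + 1) / 2) * √Real.pi ^ (n - 1) := by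
  obtain ⟨k, rfl⟩ : ∃ k, n = k + 1 := ⟨n - 1, by have := hn.out; omega⟩
  rw [Nat.add_sub_cancel, ← integral_gaussian_moment k hq]
  have hfr : Module.finrank ℝ (EuclideanSpace ℝ (Fin (k + 1))) - 1 = k := by simp
  have h0 := integral_volumeIoiPow_gaussian k hq
  push_cast
  rw [← h0, ← integral_prod_mul]
  have hmp := (volume : Measure (EuclideanSpace ℝ (Fin (k + 1)))).measurePreserving_homeomorphUnitSphereProd
  rw [hfr] at hmp
  have h := hmp.integral_comp (Homeomorph.measurableEmbedding _)
    (fun z : Sph (k + 1) × Ioi (0 : ℝ) =>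
      |height z.1| ^ q * ((z.2 : ℝ) ^ q * Real.exp (-(z.2 : ℝ) ^ 2)))
  rw [← h, integral_eq_integral_comap_compl_zero (volume : Measure (EuclideanSpace ℝ (Fin (k + 1))))]
  refine integral_congr_ae (Eventually.of_forall fun x => ?_)
  have hx : 0 < ‖(x : EuclideanSpace ℝ (Fin (k + 1)))‖ := norm_pos_iff.2 x.2
  simp only [height, inner_north, homeomorphUnitSphereProd_apply_snd_coe,
    homeomorphUnitSphereProd_apply_fst_coe, PiLp.smul_apply, smul_eq_mul, abs_mul, abs_inv,
    abs_norm]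
  rw [Real.mul_rpow (by positivity) (by positivity), Real.inv_rpow hx.le]
  have := (Real.rpow_pos_of_pos hx q).ne'
  field_simp

/-- Divide the identity for `q` by the identity for exponent 0, which gives the total mass of the
sphere; the powers of π cancel up to one factor √π. -/
theorem integral_abs_height_rpow {q : ℝ} (hq : 0 ≤ q) :
    ∫ ζ : Sph n, |height ζ| ^ q ∂(sigma n) =
      Real.Gamma ((n : ℝ) / 2) * Real.Gamma ((1 + q) / 2) /
        (√Real.pi * Real.Gamma ((n + q) / 2)) := by
  have h0 := integral_toSphere_abs_height_rpow (n := n) le_rfl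
  have h1 := integral_toSphere_abs_height_rpow (n := n) hq
  have hn0 : (0 : ℝ) < n := by have := hn.out; exact_mod_cast (by omega : 0 < n)
  simp only [Real.rpow_zero, integral_const, smul_eq_mul, mul_one, add_zero, zero_add,
    Real.Gamma_one_half_eq] at h0
  have hG0 : 0 < Real.Gamma ((n : ℝ) / 2) := Real.Gamma_pos_of_pos (by positivity)
  have hG1 : 0 < Real.Gamma ((n + q) / 2) := Real.Gamma_pos_of_pos (by positivity)
  have hpi : 0 < √Real.pi := Real.sqrt_pos.2 Real.pi_pos
  have hT : 0 < (volume : Measure (EuclideanSpace ℝ (Fin n))).toSphere.real univ := by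
    by_contra hneg
    have h00 : (volume : Measure (EuclideanSpace ℝ (Fin n))).toSphere.real univ = 0 :=
      le_antisymm (not_lt.1 hneg) measureReal_nonneg
    rw [h00] at h0
    have : 0 < √Real.pi * √Real.pi ^ (n - 1) := by positivity
    linarith
  rw [sigma, integral_smul_measure, ENNReal.toReal_inv, smul_eq_mul]
  change ((volume : Measure (EuclideanSpace ℝ (Fin n))).toSphere.real univ)⁻¹ * _ = _
  rw [add_comm 1 q, inv_mul_eq_div, div_eq_div_iff hT.ne' (by positivity)]
  have hpk : 0 < √Real.pi ^ (n - 1) := by positivity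
  refine mul_right_cancel₀ hpk.ne' ?_
  linear_combination (2 * √Real.pi ^ (n - 1) * √Real.pi) * h1 -
    (2 * √Real.pi ^ (n - 1) * Real.Gamma ((q + 1) / 2)) * h0

end Moments

end HarmonicSchwarz

namespace HarmonicSchwarz

open Filter Topology InnerProductSpace Laplacian

set_option maxSynthPendingDepth 3

/-! ### Laplacians along lines and the maximum principle -/

section SecondDerivatives

variable {E F : Type} [NormedAddCommGroup E] [InnerProductSpace ℝ E] [FiniteDimensional ℝ E]
  [NormedAddCommGroup F] [NormedSpace ℝ F]

omit [FiniteDimensional ℝ E] in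
theorem iteratedFDeriv_two_eq_deriv_deriv {f : E → F} {x : E} (hf : ContDiffAt ℝ 2 f x) (e : E) :
    iteratedFDeriv ℝ 2 f x ![e, e] = deriv (deriv fun t : ℝ => f (x + t • e)) 0 := by
  have hline : ∀ t : ℝ, HasDerivAt (fun t : ℝ => x + t • e) e t := fun t => by
    simpa using ((hasDerivAt_id t).smul_const e).const_add x
  have hev : ∀ᶠ t in 𝓝 (0 : ℝ), deriv (fun t : ℝ => f (x + t • e)) t = fderiv ℝ f (x + t • e) e := by
    have h1 : ∀ᶠ y in 𝓝 x, DifferentiableAt ℝ f y :=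
      (hf.eventually (by simp)).mono fun y hy => hy.differentiableAt (by simp)
    have h2 : Tendsto (fun t : ℝ => x + t • e) (𝓝 0) (𝓝 x) := by
      have := (hline 0).continuousAt.tendsto
      simpa using this
    filter_upwards [h2.eventually h1] with t ht
    exact (ht.hasFDerivAt.comp_hasDerivAt t (hline t)).deriv
  have hd : HasFDerivAt (fderiv ℝ f) (fderiv ℝ (fderiv ℝ f) x) (x + (0 : ℝ) • e) := by
    rw [zero_smul, add_zero]
    exact ((hf.fderiv_right (m := 1) (by norm_num)).differentiableAt (by simp)).hasFDerivAt
  have h2 : HasDerivAt (fun t : ℝ => fderiv ℝ f (x + t • e)) (fderiv ℝ (fderiv ℝ f) x e) 0 :=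
    HasFDerivAt.comp_hasDerivAt (f := fun t : ℝ => x + t • e) 0 hd (hline 0)
  have h3 : HasDerivAt (fun t : ℝ => fderiv ℝ f (x + t • e) e) (fderiv ℝ (fderiv ℝ f) x e e) 0 :=
    (ContinuousLinearMap.apply ℝ F e).hasFDerivAt.comp_hasDerivAt (0 : ℝ) h2
  rw [Filter.EventuallyEq.deriv_eq hev, h3.deriv, iteratedFDeriv_two_apply]
  rfl

/-- Reduces the computation of Laplacians to one-variable calculus; the harmonicity of the Poisson
kernel, dilations and the maximum principle all use it. -/
theorem laplacian_eq_sum_deriv_deriv {ι : Type} [Fintype ι] (b : OrthonormalBasis ι ℝ E)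
    {f : E → F} {x : E} (hf : ContDiffAt ℝ 2 f x) :
    Δ f x = ∑ i, deriv (deriv fun t : ℝ => f (x + t • b i)) 0 := by
  rw [laplacian_eq_iteratedFDeriv_orthonormalBasis f b]
  exact Finset.sum_congr rfl fun i _ => iteratedFDeriv_two_eq_deriv_deriv hf (b i)

theorem laplacian_norm_sq (x : E) : Δ (fun y : E => ‖y‖ ^ 2) x = 2 * Module.finrank ℝ E := by
  rw [laplacian_eq_sum_deriv_deriv (stdOrthonormalBasis ℝ E) (contDiff_norm_sq ℝ).contDiffAt]
  have h : ∀ i, deriv (deriv fun t : ℝ => ‖x + t • stdOrthonormalBasis ℝ E i‖ ^ 2) 0 = 2 := by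
    intro i
    set e := stdOrthonormalBasis ℝ E i
    have he : ‖e‖ = 1 := (stdOrthonormalBasis ℝ E).norm_eq_one i
    have h1 : (fun t : ℝ => ‖x + t • e‖ ^ 2) =
        fun t => ‖x‖ ^ 2 + 2 * inner ℝ x e * t + t ^ 2 := by
      ext t
      rw [norm_add_sq_real, inner_smul_right, norm_smul, he, mul_pow, Real.norm_eq_abs, sq_abs]
      ring
    have h2 : deriv (fun t : ℝ => ‖x‖ ^ 2 + 2 * inner ℝ x e * t + t ^ 2) =
        fun t => 2 * inner ℝ x e + 2 * t := by
      ext t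
      have : HasDerivAt (fun t : ℝ => ‖x‖ ^ 2 + 2 * inner ℝ x e * t + t ^ 2) _ t :=
        (((hasDerivAt_id t).const_mul (2 * inner ℝ x e)).const_add (‖x‖ ^ 2)).add
        (hasDerivAt_pow 2 t)
      rw [HasDerivAt.deriv this]
      simp
    have h3 : HasDerivAt (fun t : ℝ => 2 * inner ℝ x e + 2 * t) 2 0 := by
      simpa using ((hasDerivAt_id (0 : ℝ)).const_mul 2).const_add (2 * inner ℝ x e)
    rw [h1, h2, h3.deriv]
  simp only [h, Finset.sum_const, Finset.card_univ, Fintype.card_fin, nsmul_eq_mul]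
  ring

/-- At a local maximum a positive second derivative would also give a local minimum, so `φ` would be
locally constant and its second derivative zero. -/
theorem not_isLocalMax_of_deriv_deriv_pos {φ : ℝ → ℝ} {t : ℝ} (hc : ContinuousAt φ t)
    (h : 0 < deriv (deriv φ) t) : ¬ IsLocalMax φ t := by
  intro hmax
  have hmin := isLocalMin_of_deriv_deriv_pos h hmax.deriv_eq_zero hc
  have hconst : φ =ᶠ[𝓝 t] fun _ => φ t := by
    filter_upwards [hmax, hmin] with s h1 h2 using le_antisymm h1 h2
  have h1 : deriv φ =ᶠ[𝓝 t] fun _ => 0 := by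
    have := hconst.deriv
    simpa using this
  rw [h1.deriv_eq] at h
  simp at h

/-- Adding ε‖x‖² makes the Laplacian strictly positive, so some second directional derivative is
positive and no maximum is interior. Then ε → 0. -/
theorem le_of_harmonic_of_le_sphere {h : E → ℝ} {r M : ℝ} [Nontrivial E]
    (hh : HarmonicOnNhd h (Metric.ball 0 r)) (hc : ContinuousOn h (Metric.closedBall 0 r))
    (hM : ∀ x ∈ Metric.sphere (0 : E) r, h x ≤ M) {x : E} (hx : x ∈ Metric.closedBall (0 : E) r) :
    h x ≤ M := by
  have key : ∀ ε > 0, h x ≤ M + ε * r ^ 2 := by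
    intro ε hε
    obtain ⟨x₀, hx₀, hmax⟩ := (isCompact_closedBall (0 : E) r).exists_isMaxOn ⟨x, hx⟩
      (hc.add (by fun_prop : ContinuousOn (fun y : E => ε • ‖y‖ ^ 2) _))
    have hx₀r : ‖x₀‖ = r := by
      by_contra hne
      have hx₀b : x₀ ∈ Metric.ball (0 : E) r := by
        rw [mem_ball_zero_iff]
        exact lt_of_le_of_ne (mem_closedBall_zero_iff.1 hx₀) hne
      have hloc : IsLocalMax (h + fun y : E => ε • ‖y‖ ^ 2) x₀ :=
        hmax.isLocalMax (mem_of_superset (Metric.isOpen_ball.mem_nhds hx₀b)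
          Metric.ball_subset_closedBall)
      have hn : ContDiffAt ℝ 2 (fun y : E => ε • ‖y‖ ^ 2) x₀ :=
        ((contDiff_norm_sq ℝ).const_smul ε).contDiffAt
      have hcd : ContDiffAt ℝ 2 (h + fun y : E => ε • ‖y‖ ^ 2) x₀ := (hh x₀ hx₀b).1.add hn
      have hlap : 0 < Δ (h + fun y : E => ε • ‖y‖ ^ 2) x₀ := by
        rw [(hh x₀ hx₀b).1.laplacian_add hn, (hh x₀ hx₀b).2.self_of_nhds]
        have h1 : Δ (fun y : E => ε • ‖y‖ ^ 2) x₀ = ε • Δ (fun y : E => ‖y‖ ^ 2) x₀ :=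
          laplacian_smul ε (contDiff_norm_sq ℝ).contDiffAt
        rw [h1, laplacian_norm_sq]
        have : (0 : ℝ) < Module.finrank ℝ E := by exact_mod_cast Module.finrank_pos
        simp only [Pi.zero_apply, zero_add, smul_eq_mul]
        positivity
      rw [laplacian_eq_sum_deriv_deriv (stdOrthonormalBasis ℝ E) hcd] at hlap
      obtain ⟨i, -, hi⟩ := Finset.exists_lt_of_sum_lt
        (f := fun _ => (0 : ℝ)) (by simpa using hlap)
      have hline : ContinuousAt (fun t : ℝ => x₀ + t • stdOrthonormalBasis ℝ E i) 0 := by fun_prop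
      have h0 : x₀ + (0 : ℝ) • stdOrthonormalBasis ℝ E i = x₀ := by simp
      refine not_isLocalMax_of_deriv_deriv_pos ?_ hi ?_
      · exact ContinuousAt.comp (by rw [h0]; exact hcd.continuousAt) hline
      · have := hline.tendsto.eventually (by rw [h0]; exact hloc)
        rw [IsLocalMax, IsMaxFilter, h0]
        exact this
    have h1 := hmax hx
    have h2 := hM x₀ (by simpa using hx₀r)
    simp only [Pi.add_apply, smul_eq_mul, mem_ofPred_eq, hx₀r] at h1
    have : 0 ≤ ε * ‖x‖ ^ 2 := by positivity
    linarith
  have hlim : Tendsto (fun ε : ℝ => M + ε * r ^ 2) (𝓝[>] 0) (𝓝 (M + 0 * r ^ 2)) :=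
    (Continuous.tendsto (by fun_prop) 0).mono_left nhdsWithin_le_nhds
  rw [zero_mul, add_zero] at hlim
  exact ge_of_tendsto hlim (eventually_mem_nhdsWithin.mono key)

theorem harmonicOnNhd_comp_smul {f : E → F} {R : ℝ} (hR0 : 0 < R)
    (hf : HarmonicOnNhd f (Metric.ball 0 1)) :
    HarmonicOnNhd (fun x => f (R • x)) (Metric.ball 0 R⁻¹) := by
  have hmem : ∀ x ∈ Metric.ball (0 : E) R⁻¹, R • x ∈ Metric.ball (0 : E) 1 := by
    intro x hx
    rw [mem_ball_zero_iff] at hx ⊢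
    rw [norm_smul, Real.norm_of_nonneg hR0.le]
    calc R * ‖x‖ < R * R⁻¹ := by gcongr
      _ = 1 := mul_inv_cancel₀ hR0.ne'
  have hcd : ∀ x ∈ Metric.ball (0 : E) R⁻¹, ContDiffAt ℝ 2 (fun x => f (R • x)) x := fun x hx =>
    (hf _ (hmem x hx)).1.comp x (by fun_prop)
  intro x hx
  refine ⟨hcd x hx, ?_⟩
  filter_upwards [Metric.isOpen_ball.mem_nhds hx] with y hy
  have h0 := (hf _ (hmem y hy)).2.self_of_nhds
  rw [laplacian_eq_sum_deriv_deriv (stdOrthonormalBasis ℝ E) (hf _ (hmem y hy)).1] at h0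
  rw [laplacian_eq_sum_deriv_deriv (stdOrthonormalBasis ℝ E) (hcd y hy)]
  have h1 : ∀ i, deriv (deriv fun t : ℝ => f (R • (y + t • stdOrthonormalBasis ℝ E i))) 0 =
      R ^ 2 • deriv (deriv fun t : ℝ => f (R • y + t • stdOrthonormalBasis ℝ E i)) 0 := by
    intro i
    set g := fun t : ℝ => f (R • y + t • stdOrthonormalBasis ℝ E i) with hg
    have h2 : (fun t : ℝ => f (R • (y + t • stdOrthonormalBasis ℝ E i))) = fun t => g (R * t) := by
      ext t
      simp [hg, smul_add, smul_smul]
    have h3 : deriv (fun t => g (R * t)) = fun t => R • deriv g (R * t) := by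
      ext t
      exact deriv_comp_mul_left R g t
    rw [h2, h3]
    have h4 : deriv (fun t => R • deriv g (R * t)) 0 = R • deriv (fun t => deriv g (R * t)) 0 :=
      deriv_fun_const_smul_field R _
    rw [h4, deriv_comp_mul_left R (deriv g) 0, mul_zero, smul_smul, sq]
  simp_rw [h1]
  rw [← Finset.smul_sum, h0]
  simp

end SecondDerivatives

/-! ### Harmonicity of integrals of harmonic functions -/

section ParametricLaplacian

variable {X : Type} [TopologicalSpace X] [SecondCountableTopology X] [MeasurableSpace X]
  [BorelSpace X] {μ : Measure X}
  {E U : Type} [NormedAddCommGroup E] [InnerProductSpace ℝ E] [FiniteDimensional ℝ E]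
  [NormedAddCommGroup U] [NormedSpace ℝ U]
  {O : Set E} {K : Set U} {ι : X → U} {φ : X → ℝ}

/-- Two differentiations under the integral sign move the Laplacian onto the functions `H (·, u)`.
-/
theorem harmonicOnNhd_integral_smul (hO : IsOpen O) (hK : IsCompact K) (hι : Continuous ι)
    (hιK : ∀ x, ι x ∈ K) (hφ : Integrable φ μ) {H : E × U → ℝ}
    (hH : ∀ z ∈ O, ∀ u ∈ K, ContDiffAt ℝ (⊤ : ℕ∞) H (z, u))
    (hΔ : ∀ z ∈ O, ∀ u ∈ K, Δ (fun y => H (y, u)) z = 0) :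
    HarmonicOnNhd (fun z => ∫ x, φ x • H (z, ι x) ∂μ) O := by
  have hcd := contDiffOn_integral_smul hO hK hι hιK hφ hH
  intro z hz
  refine ⟨(hcd.contDiffAt (hO.mem_nhds hz)).of_le
    (WithTop.coe_le_coe.2 (le_top : (2 : ℕ∞) ≤ ⊤)), ?_⟩
  filter_upwards [hO.mem_nhds hz] with y hy
  set H₁ : E × U → (E →L[ℝ] ℝ) := fun p => (fderiv ℝ H p).comp (ContinuousLinearMap.inl ℝ E U)
  have hH₁ : ∀ z ∈ O, ∀ u ∈ K, ContDiffAt ℝ (⊤ : ℕ∞) H₁ (z, u) := fun z hz u hu => by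
    have h1 : ContDiffAt ℝ (⊤ : ℕ∞) (fderiv ℝ H) (z, u) :=
      (hH z hz u hu).fderiv_right (by exact_mod_cast le_top)
    exact h1.clm_comp contDiffAt_const
  have hd1 : ∀ z ∈ O, fderiv ℝ (fun z => ∫ x, φ x • H (z, ι x) ∂μ) z =
      ∫ x, φ x • H₁ (z, ι x) ∂μ := fun z hz =>
    (hasFDerivAt_integral_smul hO hK hι hιK hφ
      (fun z hz u hu => (hH z hz u hu).of_le (by exact_mod_cast le_top)) hz).fderiv
  have hd2 := (hasFDerivAt_integral_smul hO hK hι hιK hφ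
      (fun z hz u hu => (hH₁ z hz u hu).of_le (by exact_mod_cast le_top)) hy).fderiv
  set H₂ : U → (E →L[ℝ] E →L[ℝ] ℝ) := fun u =>
    (fderiv ℝ H₁ (y, u)).comp (ContinuousLinearMap.inl ℝ E U)
  have hH₂ : ContinuousOn H₂ K := fun u hu => by
    have h1 : ContinuousAt (fderiv ℝ H₁) (y, u) :=
      ((hH₁ y hy u hu).fderiv_right (m := 0) (by exact_mod_cast le_top)).continuousAt
    have h2 : ContinuousAt (fun u => fderiv ℝ H₁ (y, u)) u :=
      h1.comp (f := fun u => (y, u)) (by fun_prop)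
    exact (h2.clm_comp continuousAt_const).continuousWithinAt
  have hint : Integrable (fun x => φ x • H₂ (ι x)) μ :=
    integrable_smul_comp_of_continuousOn hK hι hιK hφ hH₂
  have hH₂' : ∀ u ∈ K, ∀ e, H₂ u e e = iteratedFDeriv ℝ 2 (fun y => H (y, u)) y ![e, e] := by
    intro u hu e
    rw [iteratedFDeriv_two_apply]
    have h1 : fderiv ℝ (fun y => H (y, u)) =ᶠ[𝓝 y] fun y => H₁ (y, u) := by
      filter_upwards [hO.mem_nhds hy] with w hw
      exact (((hH w hw u hu).differentiableAt (by simp)).hasFDerivAt.comp w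
        (hasFDerivAt_prodMk_left w u)).fderiv
    have h2 : HasFDerivAt (fun y => H₁ (y, u)) (H₂ u) y :=
      HasFDerivAt.comp (f := fun y => (y, u)) y
        ((hH₁ y hy u hu).differentiableAt (by simp)).hasFDerivAt (hasFDerivAt_prodMk_left y u)
    rw [h1.fderiv_eq, h2.fderiv]
    rfl
  rw [laplacian_eq_iteratedFDeriv_stdOrthonormalBasis]
  have h2 : ∀ e, iteratedFDeriv ℝ 2 (fun z => ∫ x, φ x • H (z, ι x) ∂μ) y ![e, e] =
      ∫ x, φ x • H₂ (ι x) e e ∂μ := by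
    intro e
    rw [iteratedFDeriv_two_apply]
    have h3 : fderiv ℝ (fun z => ∫ x, φ x • H (z, ι x) ∂μ) =ᶠ[𝓝 y]
        fun z => ∫ x, φ x • H₁ (z, ι x) ∂μ := by
      filter_upwards [hO.mem_nhds hy] with w hw using hd1 w hw
    rw [h3.fderiv_eq, hd2]
    have h4 : (∫ x, φ x • H₂ (ι x) ∂μ) e e = ∫ x, (φ x • H₂ (ι x)) e e ∂μ := by
      rw [ContinuousLinearMap.integral_apply hint,
        ContinuousLinearMap.integral_apply (hint.apply_continuousLinearMap e)]
    simpa using h4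
  simp only [h2]
  rw [← integral_finsetSum]
  · refine integral_eq_zero_of_ae (Eventually.of_forall fun x => ?_)
    have h5 := hΔ y hy (ι x) (hιK x)
    rw [laplacian_eq_iteratedFDeriv_stdOrthonormalBasis] at h5
    simp only [← hH₂' _ (hιK x)] at h5
    simp only [← Finset.smul_sum, h5, smul_zero, Pi.zero_apply]
  · intro i _
    exact (hint.apply_continuousLinearMap _).apply_continuousLinearMap _

end ParametricLaplacian

end HarmonicSchwarz

namespace HarmonicSchwarz

open Filter Topology InnerProductSpace Laplacian

/-! ### The Poisson kernel and the Poisson formula -/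

section KernelHarmonic

variable {n : ℕ}

theorem contDiffAt_poissonKernel {x ζ : EuclideanSpace ℝ (Fin n)} (h : x ≠ ζ) :
    ContDiffAt ℝ (⊤ : ℕ∞) (fun p : EuclideanSpace ℝ (Fin n) × EuclideanSpace ℝ (Fin n) =>
      (1 - ‖p.1‖ ^ 2) / ‖p.1 - p.2‖ ^ n) (x, ζ) := by
  have h1 : ContDiffAt ℝ (⊤ : ℕ∞)
      (fun p : EuclideanSpace ℝ (Fin n) × EuclideanSpace ℝ (Fin n) => p.1 - p.2) (x, ζ) := by
    fun_prop
  have h2 : x - ζ ≠ 0 := sub_ne_zero.2 h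
  refine ContDiffAt.div ?_ ((h1.norm ℝ h2).pow n) (pow_ne_zero _ (norm_ne_zero_iff.2 h2))
  exact contDiffAt_const.sub (contDiffAt_fst.norm_sq ℝ)

/-- Along a line x + te with |e| = 1, both 1 − |x|² and |x − ζ|² are quadratic in t; with c = n/2
this is the second derivative of the Poisson kernel in the direction e. -/
theorem deriv_deriv_mul_rpow_quadratic {a₀ a₁ q₀ q₁ : ℝ} (ha : 0 < a₀) (c : ℝ) :
    deriv (deriv fun t : ℝ => (q₀ - 2 * q₁ * t - t ^ 2) * (a₀ + 2 * a₁ * t + t ^ 2) ^ (-c)) 0 =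
      -2 * a₀ ^ (-c) + 8 * c * q₁ * a₁ * a₀ ^ (-c - 1) - 2 * c * q₀ * a₀ ^ (-c - 1) +
        4 * c * (c + 1) * q₀ * a₁ ^ 2 * a₀ ^ (-c - 2) := by
  have hQ : ∀ t : ℝ, HasDerivAt (fun t : ℝ => q₀ - 2 * q₁ * t - t ^ 2) (-2 * q₁ - 2 * t) t := by
    intro t
    have : HasDerivAt (fun t : ℝ => q₀ - 2 * q₁ * t - t ^ 2) _ t :=
      (((hasDerivAt_id t).const_mul (2 * q₁)).const_sub q₀).sub (hasDerivAt_pow 2 t)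
    refine this.congr_deriv ?_
    simp
  have hA : ∀ t : ℝ, HasDerivAt (fun t : ℝ => a₀ + 2 * a₁ * t + t ^ 2) (2 * a₁ + 2 * t) t := by
    intro t
    have : HasDerivAt (fun t : ℝ => a₀ + 2 * a₁ * t + t ^ 2) _ t :=
      (((hasDerivAt_id t).const_mul (2 * a₁)).const_add a₀).add (hasDerivAt_pow 2 t)
    refine this.congr_deriv ?_
    simp
  have hAr : ∀ (c t : ℝ), 0 < a₀ + 2 * a₁ * t + t ^ 2 →
      HasDerivAt (fun t : ℝ => (a₀ + 2 * a₁ * t + t ^ 2) ^ (-c))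
        (-c * (2 * a₁ + 2 * t) * (a₀ + 2 * a₁ * t + t ^ 2) ^ (-c - 1)) t := by
    intro c t ht
    refine ((hA t).rpow_const (p := -c) (Or.inl ht.ne')).congr_deriv ?_
    ring
  have hpos : ∀ᶠ t in 𝓝 (0 : ℝ), 0 < a₀ + 2 * a₁ * t + t ^ 2 := by
    have : ContinuousAt (fun t : ℝ => a₀ + 2 * a₁ * t + t ^ 2) 0 := by fun_prop
    exact this.eventually (lt_mem_nhds (by simpa using ha))
  have h1 : deriv (fun t : ℝ => (q₀ - 2 * q₁ * t - t ^ 2) * (a₀ + 2 * a₁ * t + t ^ 2) ^ (-c))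
      =ᶠ[𝓝 0] fun t => (-2 * q₁ - 2 * t) * (a₀ + 2 * a₁ * t + t ^ 2) ^ (-c) +
        (q₀ - 2 * q₁ * t - t ^ 2) *
          ((-c * (2 * a₁ + 2 * t)) * (a₀ + 2 * a₁ * t + t ^ 2) ^ (-(c + 1))) := by
    filter_upwards [hpos] with t ht
    have := ((hQ t).fun_mul (hAr c t ht)).deriv
    rw [this, neg_add']
  have hl1 : HasDerivAt (fun t : ℝ => -2 * q₁ - 2 * t) (-2) 0 := by
    simpa using ((hasDerivAt_id (0 : ℝ)).const_mul 2).const_sub (-2 * q₁)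
  have hl2 : HasDerivAt (fun t : ℝ => -c * (2 * a₁ + 2 * t)) (-c * 2) 0 := by
    simpa using (((hasDerivAt_id (0 : ℝ)).const_mul 2).const_add (2 * a₁)).const_mul (-c)
  have hp0 : 0 < a₀ + 2 * a₁ * 0 + (0 : ℝ) ^ 2 := by simpa using ha
  have h2 := (hl1.fun_mul (hAr c 0 hp0)).fun_add
    ((hQ 0).fun_mul (hl2.fun_mul (hAr (c + 1) 0 hp0)))
  rw [h1.deriv_eq, h2.deriv, show -(c + 1) - 1 = -c - 2 by ring, show -(c + 1) = -c - 1 by ring]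
  simp only [mul_zero, add_zero, sub_zero, ne_eq, OfNat.ofNat_ne_zero, not_false_eq_true, zero_pow]
  ring

/-- Summed over an orthonormal basis, every term is a multiple of A^(−n/2−1) with A = |x − ζ|². The
coefficients cancel because |ζ| = 1 gives A = |x|² − 2⟨x, ζ⟩ + 1. -/
theorem laplacian_poissonKernel {x ζ : EuclideanSpace ℝ (Fin n)} (hζ : ‖ζ‖ = 1) (h : x ≠ ζ) :
    Δ (fun y => (1 - ‖y‖ ^ 2) / ‖y - ζ‖ ^ n : EuclideanSpace ℝ (Fin n) → ℝ) x = 0 := by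
  have hcd : ContDiffAt ℝ 2
      (fun y : EuclideanSpace ℝ (Fin n) => (1 - ‖y‖ ^ 2) / ‖y - ζ‖ ^ n) x :=
    ((contDiffAt_poissonKernel h).of_le (WithTop.coe_le_coe.2 (le_top : (2 : ℕ∞) ≤ ⊤))).comp
      (f := fun y => (y, ζ)) x (by fun_prop)
  set b := EuclideanSpace.basisFun (Fin n) ℝ
  rw [laplacian_eq_sum_deriv_deriv b hcd]
  have hA : 0 < ‖x - ζ‖ ^ 2 := by
    have := norm_pos_iff.2 (sub_ne_zero.2 h)
    positivity
  set A := ‖x - ζ‖ ^ 2 with hAdef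
  have h1 : ∀ i, deriv (deriv fun t : ℝ => (1 - ‖x + t • b i‖ ^ 2) / ‖x + t • b i - ζ‖ ^ n) 0 =
      -2 * A ^ (-((n : ℝ) / 2)) + 8 * ((n : ℝ) / 2) * inner ℝ x (b i) * inner ℝ (x - ζ) (b i) *
        A ^ (-((n : ℝ) / 2) - 1) - 2 * ((n : ℝ) / 2) * (1 - ‖x‖ ^ 2) * A ^ (-((n : ℝ) / 2) - 1) +
        4 * ((n : ℝ) / 2) * ((n : ℝ) / 2 + 1) * (1 - ‖x‖ ^ 2) * inner ℝ (x - ζ) (b i) ^ 2 *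
          A ^ (-((n : ℝ) / 2) - 2) := by
    intro i
    rw [← deriv_deriv_mul_rpow_quadratic hA]
    congr 2
    ext t
    have hb : ‖b i‖ = 1 := b.norm_eq_one i
    have hsq : ∀ y : EuclideanSpace ℝ (Fin n),
        ‖y + t • b i‖ ^ 2 = ‖y‖ ^ 2 + 2 * inner ℝ y (b i) * t + t ^ 2 := by
      intro y
      rw [norm_add_sq_real, inner_smul_right, norm_smul, hb, mul_pow, Real.norm_eq_abs, sq_abs]
      ring
    have h2 : x + t • b i - ζ = x - ζ + t • b i := by abel
    have h3 : ∀ z : ℝ, 0 ≤ z → z ^ n = (z ^ 2) ^ ((n : ℝ) / 2) := by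
      intro z hz
      rw [← Real.rpow_natCast z 2, ← Real.rpow_mul hz, ← Real.rpow_natCast]
      congr 1
      push_cast
      ring
    rw [h2, h3 _ (norm_nonneg _), hsq x, hsq (x - ζ), div_eq_mul_inv, ← Real.rpow_neg]
    · congr 1
      ring
    · rw [← hsq]; positivity
  have hs1 : ∑ i, inner ℝ x (b i) * inner ℝ (x - ζ) (b i) = inner ℝ x (x - ζ) := by
    rw [← b.sum_inner_mul_inner x (x - ζ)]
    exact Finset.sum_congr rfl fun i _ => by rw [real_inner_comm (b i) (x - ζ)]
  have hs2 : ∑ i, inner ℝ (x - ζ) (b i) ^ 2 = A := by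
    rw [hAdef, ← real_inner_self_eq_norm_sq, ← b.sum_inner_mul_inner (x - ζ) (x - ζ)]
    exact Finset.sum_congr rfl fun i _ => by rw [real_inner_comm (b i) (x - ζ), sq]
  have hexp : A = ‖x‖ ^ 2 - 2 * inner ℝ x ζ + 1 := by
    rw [hAdef, norm_sub_sq_real, hζ]
    ring
  have hin : inner ℝ x (x - ζ) = ‖x‖ ^ 2 - inner ℝ x ζ := by
    rw [inner_sub_right, real_inner_self_eq_norm_sq]
  have hr1 : A ^ (-((n : ℝ) / 2)) = A ^ (-((n : ℝ) / 2) - 1) * A := by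
    rw [← Real.rpow_add_one hA.ne']
    congr 1
    ring
  have hr2 : A ^ (-((n : ℝ) / 2) - 1) = A ^ (-((n : ℝ) / 2) - 2) * A := by
    rw [← Real.rpow_add_one hA.ne']
    congr 1
    ring
  set R := A ^ (-((n : ℝ) / 2) - 1)
  set R' := A ^ (-((n : ℝ) / 2) - 2)
  rw [Finset.sum_congr rfl fun i _ => h1 i]
  have h4 : ∀ i, -2 * A ^ (-((n : ℝ) / 2)) + 8 * ((n : ℝ) / 2) * inner ℝ x (b i) *
        inner ℝ (x - ζ) (b i) * R - 2 * ((n : ℝ) / 2) * (1 - ‖x‖ ^ 2) * R +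
        4 * ((n : ℝ) / 2) * ((n : ℝ) / 2 + 1) * (1 - ‖x‖ ^ 2) * inner ℝ (x - ζ) (b i) ^ 2 * R' =
      (-2 * A ^ (-((n : ℝ) / 2)) - 2 * ((n : ℝ) / 2) * (1 - ‖x‖ ^ 2) * R) +
      (4 * n * R) * (inner ℝ x (b i) * inner ℝ (x - ζ) (b i)) +
      (4 * ((n : ℝ) / 2) * ((n : ℝ) / 2 + 1) * (1 - ‖x‖ ^ 2) * R') * inner ℝ (x - ζ) (b i) ^ 2 := by
    intro i
    ring
  simp only [h4, Finset.sum_add_distrib, ← Finset.mul_sum, hs1, hs2, Finset.sum_const,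
    Finset.card_univ, Fintype.card_fin, nsmul_eq_mul]
  rw [hin, hr1, show (4 * ((n : ℝ) / 2) * ((n : ℝ) / 2 + 1) * (1 - ‖x‖ ^ 2) * R') * A =
    4 * ((n : ℝ) / 2) * ((n : ℝ) / 2 + 1) * (1 - ‖x‖ ^ 2) * (R' * A) by ring, ← hr2, hexp]
  ring

theorem ne_of_mem_ball_of_mem_sphere {E : Type*} [NormedAddCommGroup E] {x ζ : E}
    (hx : x ∈ Metric.ball (0 : E) 1) (hζ : ζ ∈ Metric.sphere (0 : E) 1) : x ≠ ζ := by
  rintro rfl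
  rw [mem_ball_zero_iff] at hx
  rw [mem_sphere_zero_iff_norm] at hζ
  exact hx.ne hζ

variable [hn : Fact (2 ≤ n)]

omit hn in
theorem poissonIntegral_eq (φ : Sph n → ℝ) : poissonIntegral n φ = fun x => ∫ ζ, φ ζ •
    (fun p : EuclideanSpace ℝ (Fin n) × EuclideanSpace ℝ (Fin n) =>
      (1 - ‖p.1‖ ^ 2) / ‖p.1 - p.2‖ ^ n) (x, ζ) ∂(sigma n) := by
  ext x
  simp only [poissonIntegral, poissonKernel, smul_eq_mul, mul_comm]

omit hn in
theorem harmonicOnNhd_poissonIntegral {φ : Sph n → ℝ} (hφ : Integrable φ (sigma n)) :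
    HarmonicOnNhd (poissonIntegral n φ) (Metric.ball 0 1) := by
  rw [poissonIntegral_eq]
  refine harmonicOnNhd_integral_smul Metric.isOpen_ball (isCompact_sphere 0 1)
    continuous_subtype_val (fun ζ => ζ.2) hφ
    (fun z hz u hu => contDiffAt_poissonKernel (ne_of_mem_ball_of_mem_sphere hz hu)) ?_
  intro z hz u hu
  exact laplacian_poissonKernel (by simpa using hu) (ne_of_mem_ball_of_mem_sphere hz hu)

omit hn in
theorem harmonicOnNhd_poissonKernel (ζ : Sph n) :
    HarmonicOnNhd (fun x => poissonKernel n x ζ) (Metric.ball 0 1) := by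
  intro x hx
  have hne := ne_of_mem_ball_of_mem_sphere hx ζ.2
  refine ⟨((contDiffAt_poissonKernel hne).of_le
    (WithTop.coe_le_coe.2 (le_top : (2 : ℕ∞) ≤ ⊤))).comp
      (f := fun y => (y, (ζ : EuclideanSpace ℝ (Fin n)))) x (by fun_prop), ?_⟩
  filter_upwards [Metric.isOpen_ball.mem_nhds hx] with y hy
  exact laplacian_poissonKernel (norm_eq_of_mem_sphere ζ) (ne_of_mem_ball_of_mem_sphere hy ζ.2)

omit hn in
theorem continuous_poissonKernel {x : EuclideanSpace ℝ (Fin n)}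
    (hx : x ∈ Metric.ball (0 : EuclideanSpace ℝ (Fin n)) 1) :
    Continuous (poissonKernel n x) := by
  unfold poissonKernel
  refine Continuous.div (by fun_prop) (by fun_prop) fun ζ => pow_ne_zero _ ?_
  exact norm_ne_zero_iff.2 (sub_ne_zero.2 (ne_of_mem_ball_of_mem_sphere hx ζ.2))

omit hn in
theorem poissonKernel_pos {x : EuclideanSpace ℝ (Fin n)}
    (hx : x ∈ Metric.ball (0 : EuclideanSpace ℝ (Fin n)) 1) (ζ : Sph n) :
    0 < poissonKernel n x ζ := by
  have h1 : 0 < ‖x - ζ‖ := norm_pos_iff.2 (sub_ne_zero.2 (ne_of_mem_ball_of_mem_sphere hx ζ.2))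
  have h2 : ‖x‖ ^ 2 < 1 := by
    rw [mem_ball_zero_iff] at hx
    nlinarith [norm_nonneg x]
  unfold poissonKernel
  have : 0 < 1 - ‖x‖ ^ 2 := by linarith
  positivity

omit hn in
theorem poissonKernel_rotate (A : EuclideanSpace ℝ (Fin n) ≃ₗᵢ[ℝ] EuclideanSpace ℝ (Fin n))
    (x : EuclideanSpace ℝ (Fin n)) (ζ : Sph n) :
    poissonKernel n (A x) (rotate A ζ) = poissonKernel n x ζ := by
  simp [poissonKernel, ← map_sub]

/-- The rotation of the sphere as a homeomorphism. -/
noncomputable def rotateHomeomorph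
    (A : EuclideanSpace ℝ (Fin n) ≃ₗᵢ[ℝ] EuclideanSpace ℝ (Fin n)) : Sph n ≃ₜ Sph n where
  toFun := rotate A
  invFun := rotate A.symm
  left_inv ζ := by ext1; simp
  right_inv ζ := by ext1; simp
  continuous_toFun := continuous_rotate A
  continuous_invFun := continuous_rotate A.symm

omit hn in
theorem integral_rotate (A : EuclideanSpace ℝ (Fin n) ≃ₗᵢ[ℝ] EuclideanSpace ℝ (Fin n))
    (F : Sph n → ℝ) : ∫ ζ, F (rotate A ζ) ∂(sigma n) = ∫ ζ, F ζ ∂(sigma n) :=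
  (measurePreserving_rotate A).integral_comp (rotateHomeomorph A).measurableEmbedding F

theorem exists_isometry_of_norm_eq {E : Type*} [NormedAddCommGroup E] [InnerProductSpace ℝ E]
    [CompleteSpace E] {x y : E} (h : ‖x‖ = ‖y‖) : ∃ A : E ≃ₗᵢ[ℝ] E, A x = y :=
  ⟨(ℝ ∙ (x - y))ᗮ.reflection, Submodule.reflection_sub h⟩

theorem integrable_poissonKernel {x : EuclideanSpace ℝ (Fin n)}
    (hx : x ∈ Metric.ball (0 : EuclideanSpace ℝ (Fin n)) 1) :
    Integrable (poissonKernel n x) (sigma n) :=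
  (continuous_poissonKernel hx).integrable_of_hasCompactSupport
    (HasCompactSupport.of_compactSpace _)

/-- As a function of x the integral is harmonic and, by rotation invariance, radial. The maximum
principle on the ball of radius ‖x‖, for it and for its negative, compares its value at x with the
value 1 at the origin. -/
theorem integral_poissonKernel {x : EuclideanSpace ℝ (Fin n)}
    (hx : x ∈ Metric.ball (0 : EuclideanSpace ℝ (Fin n)) 1) :
    ∫ ζ, poissonKernel n x ζ ∂(sigma n) = 1 := by
  set u := poissonIntegral n fun _ => (1 : ℝ) with hu
  have hu' : ∀ x, u x = ∫ ζ, poissonKernel n x ζ ∂(sigma n) := fun x => by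
    simp [hu, poissonIntegral]
  have hharm : HarmonicOnNhd u (Metric.ball 0 1) :=
    harmonicOnNhd_poissonIntegral (integrable_const 1)
  have hrad : ∀ x y, ‖x‖ = ‖y‖ → u x = u y := by
    intro x y hxy
    obtain ⟨A, rfl⟩ := exists_isometry_of_norm_eq hxy
    rw [hu', hu', ← integral_rotate A (poissonKernel n (A x))]
    simp only [poissonKernel_rotate]
  have h0 : u 0 = 1 := by
    rw [hu']
    simp [poissonKernel]
  have hx1 : ‖x‖ < 1 := mem_ball_zero_iff.1 hx
  have hball : Metric.closedBall (0 : EuclideanSpace ℝ (Fin n)) ‖x‖ ⊆ Metric.ball 0 1 :=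
    Metric.closedBall_subset_ball hx1
  have hcont : ContinuousOn u (Metric.closedBall 0 ‖x‖) := hharm.contDiffOn.continuousOn.mono hball
  have hh := hharm.mono (Metric.ball_subset_closedBall.trans hball)
  have h1 : u 0 ≤ u x := le_of_harmonic_of_le_sphere hh hcont
    (fun y hy => (hrad y x (mem_sphere_zero_iff_norm.1 hy)).le) (by simp)
  have h2 : (-u) 0 ≤ -u x := le_of_harmonic_of_le_sphere hh.neg hcont.neg
    (fun y hy => (neg_le_neg (hrad x y (mem_sphere_zero_iff_norm.1 hy).symm).le)) (by simp)
  simp only [Pi.neg_apply] at h2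
  rw [← hu', ← h0]
  linarith

/-- The approximate identity in quantitative form: within distance δ of `y` the oscillation of `v`
is at most ε, and farther away the kernel is at most (1 − ‖y‖²)/δⁿ. -/
theorem abs_sub_poissonIntegral_le {v : EuclideanSpace ℝ (Fin n) → ℝ} {ε δ M : ℝ} (hδ : 0 < δ)
    (hv : Continuous fun ζ : Sph n => v ζ)
    (hε0 : 0 ≤ ε) (hM0 : 0 ≤ M) {y : EuclideanSpace ℝ (Fin n)}
    (hy : y ∈ Metric.ball (0 : EuclideanSpace ℝ (Fin n)) 1)
    (hε : ∀ ζ : Sph n, ‖y - ζ‖ < δ → |v y - v ζ| ≤ ε) (hM : ∀ ζ : Sph n, |v y - v ζ| ≤ M) :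
    |v y - poissonIntegral n (fun ζ => v ζ) y| ≤ ε + (1 - ‖y‖ ^ 2) / δ ^ n * M := by
  have hP := integrable_poissonKernel hy
  have hPc := continuous_poissonKernel hy
  have hint : Integrable (fun ζ : Sph n => poissonKernel n y ζ * v ζ) (sigma n) :=
    (hPc.mul hv).integrable_of_hasCompactSupport (HasCompactSupport.of_compactSpace _)
  have hy1 : 0 ≤ 1 - ‖y‖ ^ 2 := by
    rw [mem_ball_zero_iff] at hy
    nlinarith [norm_nonneg y]
  have h1 : v y - poissonIntegral n (fun ζ => v ζ) y =
      ∫ ζ, poissonKernel n y ζ * (v y - v ζ) ∂(sigma n) := by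
    simp only [mul_sub]
    rw [integral_sub (hP.mul_const _) hint, integral_mul_const, integral_poissonKernel hy, one_mul]
    rfl
  rw [h1, ← Real.norm_eq_abs]
  have h2 : ∀ ζ : Sph n, ‖poissonKernel n y ζ * (v y - v ζ)‖ ≤
      poissonKernel n y ζ * ε + (1 - ‖y‖ ^ 2) / δ ^ n * M := by
    intro ζ
    have hp := poissonKernel_pos hy ζ
    rw [norm_mul, Real.norm_of_nonneg hp.le, Real.norm_eq_abs]
    by_cases hζ : ‖y - ζ‖ < δ
    · have := mul_le_mul_of_nonneg_left (hε ζ hζ) hp.le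
      have h3 : 0 ≤ (1 - ‖y‖ ^ 2) / δ ^ n * M := by positivity
      linarith
    · have h3 : poissonKernel n y ζ ≤ (1 - ‖y‖ ^ 2) / δ ^ n := by
        unfold poissonKernel
        gcongr
        exact not_lt.1 hζ
      have h4 := mul_le_mul h3 (hM ζ) (abs_nonneg _) (by positivity)
      have h5 : 0 ≤ poissonKernel n y ζ * ε := by positivity
      linarith
  refine (norm_integral_le_of_norm_le ((hP.mul_const ε).add (integrable_const _))
    (Eventually.of_forall h2)).trans_eq ?_
  simp only [Pi.add_apply]
  rw [integral_add (hP.mul_const ε) (integrable_const _), integral_mul_const,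
    integral_poissonKernel hy]
  simp

/-- The difference of `v` and its Poisson integral is uniformly small on spheres of radius close to
1, hence small inside them by the maximum principle. No boundary values of the Poisson integral are
needed. -/
theorem eq_poissonIntegral_of_harmonic {v : EuclideanSpace ℝ (Fin n) → ℝ}
    (hv : HarmonicOnNhd v (Metric.ball 0 1)) (hvc : ContinuousOn v (Metric.closedBall 0 1))
    {x : EuclideanSpace ℝ (Fin n)} (hx : x ∈ Metric.ball (0 : EuclideanSpace ℝ (Fin n)) 1) :
    v x = poissonIntegral n (fun ζ => v ζ) x := by
  have hvS : Continuous fun ζ : Sph n => v ζ :=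
    hvc.comp_continuous continuous_subtype_val fun ζ => Metric.sphere_subset_closedBall ζ.2
  have hvi : Integrable (fun ζ : Sph n => v ζ) (sigma n) :=
    hvS.integrable_of_hasCompactSupport (HasCompactSupport.of_compactSpace _)
  set h := v - poissonIntegral n (fun ζ => v ζ) with hh
  have hharm : HarmonicOnNhd h (Metric.ball 0 1) := hv.sub (harmonicOnNhd_poissonIntegral hvi)
  have hcb := isCompact_closedBall (0 : EuclideanSpace ℝ (Fin n)) 1
  obtain ⟨C, hC⟩ := hcb.exists_bound_of_continuousOn hvc
  have hC0 : 0 ≤ C := (norm_nonneg _).trans (hC 0 (by simp))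
  have huc := hcb.uniformContinuousOn_of_continuous hvc
  have key : ∀ η > 0, |h x| ≤ η := by
    intro η hη
    obtain ⟨δ, hδ, hδ'⟩ := Metric.uniformContinuousOn_iff.1 huc (η / 2) (by positivity)
    have hlim : Tendsto (fun r : ℝ => (1 - r ^ 2) / δ ^ n * (2 * C)) (𝓝[<] 1)
        (𝓝 ((1 - 1 ^ 2) / δ ^ n * (2 * C))) :=
      (Continuous.tendsto (by fun_prop) 1).mono_left nhdsWithin_le_nhds
    rw [show (1 - (1 : ℝ) ^ 2) / δ ^ n * (2 * C) = 0 by simp] at hlim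
    have hx1 : ‖x‖ < 1 := mem_ball_zero_iff.1 hx
    -- The radius is so close to 1 that the far part of the estimate is below η/2, and it exceeds
    -- ‖x‖ so that the maximum principle reaches `x`.
    obtain ⟨r, hr1, hr2, hr3⟩ := ((hlim.eventually (gt_mem_nhds (half_pos hη))).and
      (Ioo_mem_nhdsLT hx1)).exists
    have hball : Metric.closedBall (0 : EuclideanSpace ℝ (Fin n)) r ⊆ Metric.ball 0 1 :=
      Metric.closedBall_subset_ball hr3
    have hsph : ∀ y ∈ Metric.sphere (0 : EuclideanSpace ℝ (Fin n)) r, |h y| ≤ η := by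
      intro y hy
      have hyb : y ∈ Metric.ball (0 : EuclideanSpace ℝ (Fin n)) 1 :=
        hball (Metric.sphere_subset_closedBall hy)
      have hyc := Metric.ball_subset_closedBall hyb
      have h1 := abs_sub_poissonIntegral_le (v := v) (ε := η / 2) (M := 2 * C) hδ hvS
        (by positivity) (by positivity) hyb
        (fun ζ hζ => (hδ' y hyc ζ (Metric.sphere_subset_closedBall ζ.2)
          (by rwa [dist_eq_norm])).le)
        (fun ζ => by
          have h3 := hC y hyc
          have h4 := hC ζ (Metric.sphere_subset_closedBall ζ.2)
          have h5 := norm_sub_le (v y) (v ζ)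
          rw [← Real.norm_eq_abs]
          linarith)
      rw [mem_sphere_zero_iff_norm.1 hy] at h1
      simp only [hh, Pi.sub_apply]
      linarith
    have hcont : ContinuousOn h (Metric.closedBall 0 r) :=
      hharm.contDiffOn.continuousOn.mono hball
    have hhr := hharm.mono (Metric.ball_subset_closedBall.trans hball)
    have hxr : x ∈ Metric.closedBall (0 : EuclideanSpace ℝ (Fin n)) r :=
      mem_closedBall_zero_iff.2 hr2.le
    rw [abs_le']
    exact ⟨le_of_harmonic_of_le_sphere hhr hcont (fun y hy => (abs_le'.1 (hsph y hy)).1) hxr,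
      le_of_harmonic_of_le_sphere hhr.neg hcont.neg (fun y hy => (abs_le'.1 (hsph y hy)).2) hxr⟩
  have h0 : h x = 0 := by
    have := le_of_forall_gt_imp_ge_of_dense fun η hη => key η hη
    exact abs_nonpos_iff.1 this
  exact sub_eq_zero.1 h0

/-- The Poisson formula on the ball of radius `R`. -/
theorem harmonic_eq_poissonIntegral {u : EuclideanSpace ℝ (Fin n) → ℝ}
    (hu : HarmonicOnNhd u (Metric.ball 0 1)) {R : ℝ} (hR0 : 0 < R) (hR1 : R < 1)
    {x : EuclideanSpace ℝ (Fin n)} (hx : x ∈ Metric.ball (0 : EuclideanSpace ℝ (Fin n)) 1) :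
    u (R • x) = ∫ ζ : Sph n, poissonKernel n x ζ * u (R • (ζ : EuclideanSpace ℝ (Fin n))) ∂(sigma n) := by
  have h := harmonicOnNhd_comp_smul hR0 hu
  have h1 : 1 < R⁻¹ := (one_lt_inv₀ hR0).2 hR1
  exact eq_poissonIntegral_of_harmonic (v := fun x => u (R • x))
    (h.mono (Metric.ball_subset_ball h1.le))
    (h.contDiffOn.continuousOn.mono (Metric.closedBall_subset_ball h1)) hx

end KernelHarmonic

/-! ### The Poisson integral as a contraction from L^p into the Hardy class -/

section HardyNorm

variable {n m : ℕ} [hn : Fact (2 ≤ n)]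

omit hn in
theorem poissonKernel_symm {r : ℝ} (ζ η : Sph n) :
    poissonKernel n (r • (ζ : EuclideanSpace ℝ (Fin n))) η =
      poissonKernel n (r • (η : EuclideanSpace ℝ (Fin n))) ζ := by
  have h : ‖r • (ζ : EuclideanSpace ℝ (Fin n)) - η‖ ^ 2 = ‖r • (η : EuclideanSpace ℝ (Fin n)) - ζ‖ ^ 2 := by
    rw [norm_sub_sq_real, norm_sub_sq_real, norm_smul, norm_smul, inner_smul_left, inner_smul_left,
      real_inner_comm]
    simp
  have h' := (sq_eq_sq₀ (norm_nonneg _) (norm_nonneg _)).1 h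
  simp only [poissonKernel, h', norm_smul, norm_eq_of_mem_sphere]

omit hn in
theorem smul_mem_ball {r : ℝ} (hr : r ∈ Ico (0 : ℝ) 1) (ζ : Sph n) :
    r • (ζ : EuclideanSpace ℝ (Fin n)) ∈ Metric.ball (0 : EuclideanSpace ℝ (Fin n)) 1 := by
  rw [mem_ball_zero_iff, norm_smul, norm_eq_of_mem_sphere, mul_one, Real.norm_of_nonneg hr.1]
  exact hr.2

theorem lintegral_poissonKernel {x : EuclideanSpace ℝ (Fin n)}
    (hx : x ∈ Metric.ball (0 : EuclideanSpace ℝ (Fin n)) 1) :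
    ∫⁻ ζ, ENNReal.ofReal (poissonKernel n x ζ) ∂(sigma n) = 1 := by
  rw [← ofReal_integral_eq_lintegral_ofReal (integrable_poissonKernel hx)
    (Eventually.of_forall fun ζ => (poissonKernel_pos hx ζ).le), integral_poissonKernel hx,
    ENNReal.ofReal_one]

/-- P(x, ·)σ is a probability measure, and on such a measure the L¹ norm is at most the L^p norm. -/
theorem enorm_poissonIntegral_le {φ : Sph n → ℝ} (hφ : Measurable φ) {p : ℝ≥0∞} (hp : 1 ≤ p)
    {x : EuclideanSpace ℝ (Fin n)} (hx : x ∈ Metric.ball (0 : EuclideanSpace ℝ (Fin n)) 1) :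
    ‖poissonIntegral n φ x‖ₑ ≤
      eLpNorm φ p ((sigma n).withDensity fun ζ => ENNReal.ofReal (poissonKernel n x ζ)) := by
  have hPm : Measurable fun ζ => ENNReal.ofReal (poissonKernel n x ζ) :=
    (continuous_poissonKernel hx).measurable.ennreal_ofReal
  set μ := (sigma n).withDensity fun ζ => ENNReal.ofReal (poissonKernel n x ζ)
  have hμ : IsProbabilityMeasure μ := ⟨by
    rw [withDensity_apply _ MeasurableSet.univ, Measure.restrict_univ, lintegral_poissonKernel hx]⟩
  refine le_trans ?_ (eLpNorm_le_eLpNorm_of_exponent_le hp hφ.aestronglyMeasurable)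
  rw [eLpNorm_one_eq_lintegral_enorm,
    lintegral_withDensity_eq_lintegral_mul _ hPm hφ.enorm]
  refine (enorm_integral_le_lintegral_enorm _).trans_eq (lintegral_congr fun ζ => ?_)
  rw [enorm_mul, Real.enorm_of_nonneg (poissonKernel_pos hx ζ).le]
  rfl

/-- For finite `p`, integrate the pointwise bound over η and exchange the integrals; the symmetry
P(rη, ζ) = P(rζ, η) makes the integral over η equal to 1. -/
theorem eLpNorm_poissonIntegral_le {φ : Sph n → ℝ} (hφ : Measurable φ) {p : ℝ≥0∞} (hp : 1 ≤ p)
    {r : ℝ} (hr : r ∈ Ico (0 : ℝ) 1) :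
    eLpNorm (fun η : Sph n => poissonIntegral n φ (r • (η : EuclideanSpace ℝ (Fin n)))) p (sigma n) ≤
      eLpNorm φ p (sigma n) := by
  rcases eq_or_ne p ⊤ with rfl | hp'
  · rw [eLpNorm_exponent_top]
    refine essSup_le_of_ae_le _ (Eventually.of_forall fun η => ?_)
    refine (enorm_poissonIntegral_le hφ le_top (smul_mem_ball hr η)).trans ?_
    rw [eLpNorm_exponent_top, eLpNorm_exponent_top]
    exact eLpNormEssSup_mono_measure _ (withDensity_absolutelyContinuous _ _)
  · have hp0 : p ≠ 0 := (zero_lt_one.trans_le hp).ne'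
    have hpr : 0 < p.toReal := ENNReal.toReal_pos hp0 hp'
    rw [eLpNorm_eq_lintegral_rpow_enorm_toReal hp0 hp', eLpNorm_eq_lintegral_rpow_enorm_toReal hp0 hp']
    refine ENNReal.rpow_le_rpow ?_ (by positivity)
    have hmeas : Measurable fun z : Sph n × Sph n =>
        ENNReal.ofReal (poissonKernel n (r • (z.1 : EuclideanSpace ℝ (Fin n))) z.2) := by
      unfold poissonKernel
      fun_prop
    have hφp : Measurable fun ζ => ‖φ ζ‖ₑ ^ p.toReal := by fun_prop
    have h1 : ∀ η : Sph n, ‖poissonIntegral n φ (r • (η : EuclideanSpace ℝ (Fin n)))‖ₑ ^ p.toReal ≤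
        ∫⁻ ζ, ENNReal.ofReal (poissonKernel n (r • (η : EuclideanSpace ℝ (Fin n))) ζ) *
          ‖φ ζ‖ₑ ^ p.toReal ∂(sigma n) := by
      intro η
      have hx := smul_mem_ball hr η
      have h2 := enorm_poissonIntegral_le hφ hp hx
      rw [eLpNorm_eq_lintegral_rpow_enorm_toReal hp0 hp',
        lintegral_withDensity_eq_lintegral_mul _
          (continuous_poissonKernel hx).measurable.ennreal_ofReal hφp] at h2
      calc _ ≤ _ := ENNReal.rpow_le_rpow h2 hpr.le
        _ = _ := by
          rw [← ENNReal.rpow_mul, one_div, inv_mul_cancel₀ hpr.ne', ENNReal.rpow_one]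
          rfl
    refine (lintegral_mono h1).trans_eq ?_
    rw [lintegral_lintegral_swap (hmeas.mul (hφp.comp measurable_snd)).aemeasurable]
    refine lintegral_congr fun ζ => ?_
    simp only [poissonKernel_symm _ ζ]
    rw [lintegral_mul_const _
      (continuous_poissonKernel (smul_mem_ball hr ζ)).measurable.ennreal_ofReal]
    rw [lintegral_poissonKernel (smul_mem_ball hr ζ), one_mul]

theorem hardyENorm_poissonIntegral_smul_le {φ : Sph n → ℝ} (hφ : Measurable φ) {p : ℝ≥0∞}
    (hp : 1 ≤ p) {e : EuclideanSpace ℝ (Fin m)} (he : ‖e‖ = 1) :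
    hardyENorm p (fun x => poissonIntegral n φ x • e) ≤ eLpNorm φ p (sigma n) := by
  refine iSup₂_le fun r hr => le_trans (le_of_eq ?_) (eLpNorm_poissonIntegral_le hφ hp hr)
  refine eLpNorm_congr_norm_ae (Eventually.of_forall fun η => ?_)
  rw [norm_smul, he, mul_one]

end HardyNorm

end HarmonicSchwarz

namespace HarmonicSchwarz

open Filter Topology InnerProductSpace Laplacian

/-! ### Odd powers -/

section SignPow

/-- The odd power function `y ↦ sign(y) |y|^c`. -/
noncomputable def signPow (c y : ℝ) : ℝ := Real.sign y * |y| ^ c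

theorem measurable_signPow (c : ℝ) : Measurable (signPow c) := by
  have h : Measurable Real.sign := by
    unfold Real.sign
    exact Measurable.ite measurableSet_Iio measurable_const
      (Measurable.ite measurableSet_Ioi measurable_const measurable_const)
  unfold signPow
  fun_prop

theorem signPow_of_pos {c y : ℝ} (hy : 0 < y) : signPow c y = y ^ c := by
  rw [signPow, Real.sign_of_pos hy, abs_of_pos hy, one_mul]

theorem signPow_of_neg {c y : ℝ} (hy : y < 0) : signPow c y = -(-y) ^ c := by
  rw [signPow, Real.sign_of_neg hy, abs_of_neg hy, neg_one_mul]

theorem signPow_zero (c : ℝ) : signPow c 0 = 0 := by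
  rw [signPow, Real.sign_zero, zero_mul]

theorem signPow_neg (c y : ℝ) : signPow c (-y) = -signPow c y := by
  rw [signPow, signPow, Real.sign_neg, abs_neg, neg_mul]

theorem signPow_pos {c y : ℝ} (hy : 0 < y) : 0 < signPow c y := by
  rw [signPow_of_pos hy]
  positivity

theorem signPow_neg_of_neg {c y : ℝ} (hy : y < 0) : signPow c y < 0 := by
  have : 0 < -y := by linarith
  rw [signPow_of_neg hy]
  have : 0 < (-y) ^ c := by positivity
  linarith

theorem abs_signPow_le (c y : ℝ) : |signPow c y| ≤ |y| ^ c := by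
  rw [signPow, abs_mul, abs_of_nonneg (Real.rpow_nonneg (abs_nonneg y) c)]
  refine mul_le_of_le_one_left (by positivity) ?_
  rcases Real.sign_apply_eq y with h | h | h <;> simp [h]

theorem mul_signPow {c : ℝ} (hc : 0 ≤ c) (y : ℝ) : y * signPow c y = |y| ^ (c + 1) := by
  rcases lt_trichotomy y 0 with h | rfl | h
  · have h' : 0 < -y := by linarith
    rw [signPow_of_neg h, abs_of_neg h, Real.rpow_add_one h'.ne']
    ring
  · rw [signPow_zero, abs_zero, Real.zero_rpow (by linarith), mul_zero]
  · rw [signPow_of_pos h, abs_of_pos h, Real.rpow_add_one h.ne']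
    ring

theorem signPow_mul {c a : ℝ} (ha : 0 < a) (y : ℝ) :
    signPow c (a * y) = a ^ c * signPow c y := by
  rcases lt_trichotomy y 0 with h | rfl | h
  · rw [signPow_of_neg h, signPow_of_neg (mul_neg_of_pos_of_neg ha h), ← mul_neg,
      Real.mul_rpow ha.le (by linarith), mul_neg]
  · simp [signPow_zero]
  · rw [signPow_of_pos h, signPow_of_pos (mul_pos ha h), Real.mul_rpow ha.le h.le]

theorem monotone_signPow {c : ℝ} (hc : 0 ≤ c) : Monotone (signPow c) := by
  intro x y hxy
  rcases lt_trichotomy x 0 with h | rfl | h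
  · rcases lt_trichotomy y 0 with h' | rfl | h'
    · rw [signPow_of_neg h, signPow_of_neg h']
      exact neg_le_neg (Real.rpow_le_rpow (by linarith) (by linarith) hc)
    · rw [signPow_zero]
      exact (signPow_neg_of_neg h).le
    · exact (signPow_neg_of_neg h).le.trans (signPow_pos h').le
  · rcases hxy.eq_or_lt with rfl | h'
    · rfl
    · rw [signPow_zero]
      exact (signPow_pos h').le
  · rw [signPow_of_pos h, signPow_of_pos (h.trans_le hxy)]
    exact Real.rpow_le_rpow h.le hxy hc

theorem continuous_signPow {c : ℝ} (hc : 0 < c) : Continuous (signPow c) := by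
  have h : signPow c = fun y => max y 0 ^ c - max (-y) 0 ^ c := by
    ext y
    rcases lt_trichotomy y 0 with h | rfl | h
    · rw [signPow_of_neg h, max_eq_right h.le, max_eq_left (by linarith), Real.zero_rpow hc.ne',
        zero_sub]
    · simp [signPow_zero]
    · rw [signPow_of_pos h, max_eq_left h.le, max_eq_right (by linarith), Real.zero_rpow hc.ne',
        sub_zero]
  rw [h]
  have := hc.le
  exact ((continuous_id.max continuous_const).rpow_const fun _ => Or.inr this).sub
    ((continuous_neg.max continuous_const).rpow_const fun _ => Or.inr this)

end SignPow

/-! ### Conjugate exponents -/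

section Exponents

theorem conjExponent_top : (⊤ : ℝ≥0∞).conjExponent = 1 := by
  simp [ENNReal.conjExponent]

theorem conjExponent_one : (1 : ℝ≥0∞).conjExponent = ⊤ := by
  simp [ENNReal.conjExponent]

theorem conjExponent_ne_top {p : ℝ≥0∞} (hp : 1 ≤ p) (hp1 : p ≠ 1) : p.conjExponent ≠ ⊤ := by
  have h : p - 1 ≠ 0 := (tsub_pos_of_lt (lt_of_le_of_ne hp hp1.symm)).ne'
  simp [ENNReal.conjExponent, h]

theorem one_le_conjExponent (p : ℝ≥0∞) : 1 ≤ p.conjExponent := by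
  simp [ENNReal.conjExponent]

theorem one_le_toReal_conjExponent {p : ℝ≥0∞} (hp : 1 ≤ p) (hp1 : p ≠ 1) :
    1 ≤ p.conjExponent.toReal := by
  rw [← ENNReal.toReal_one]
  exact (ENNReal.toReal_le_toReal ENNReal.one_ne_top (conjExponent_ne_top hp hp1)).2
    (one_le_conjExponent p)

theorem one_lt_toReal_conjExponent {p : ℝ≥0∞} (hp : 1 ≤ p) (hp1 : p ≠ 1) (hpt : p ≠ ⊤) :
    1 < p.conjExponent.toReal := by
  rw [← ENNReal.toReal_one]
  refine (ENNReal.toReal_lt_toReal ENNReal.one_ne_top (conjExponent_ne_top hp hp1)).2 ?_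
  rw [ENNReal.conjExponent]
  refine ENNReal.lt_add_right ENNReal.one_ne_top ?_
  simp [hpt]

theorem holderConjugate_toReal {p : ℝ≥0∞} (hp : 1 ≤ p) (hp1 : p ≠ 1) (hpt : p ≠ ⊤) :
    p.toReal.HolderConjugate p.conjExponent.toReal := by
  have := ENNReal.HolderConjugate.conjExponent hp
  exact ENNReal.HolderConjugate.toReal_of_ne_top hpt (conjExponent_ne_top hp hp1)

end Exponents

/-! ### The equality case of Hölder's inequality -/

section BoundedFunctions

variable {X : Type} [MeasurableSpace X] {μ : Measure X} [IsProbabilityMeasure μ]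

theorem toReal_eLpNorm_of_bounded {ψ : X → ℝ} (hψ : Measurable ψ) {C : ℝ} (hC : ∀ x, |ψ x| ≤ C)
    {q : ℝ≥0∞} (hq1 : 1 ≤ q) (hq : q ≠ ⊤) :
    (eLpNorm ψ q μ).toReal = (∫ x, |ψ x| ^ q.toReal ∂μ) ^ (q.toReal)⁻¹ := by
  have hm : MemLp ψ q μ := MemLp.of_bound hψ.aestronglyMeasurable C (Eventually.of_forall hC)
  rw [hm.eLpNorm_eq_integral_rpow_norm (zero_lt_one.trans_le hq1).ne' hq,
    ENNReal.toReal_ofReal (by positivity)]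
  rfl

theorem abs_signPow_le_of_abs_le {c y C : ℝ} (hc : 0 ≤ c) (hy : |y| ≤ C) :
    |signPow c y| ≤ C ^ c :=
  (abs_signPow_le c y).trans (Real.rpow_le_rpow (abs_nonneg y) hy hc)

/-- Because (q − 1)p = q, the p-norm of the odd power of order q − 1 is at most ‖ψ‖_q^(q−1).
Hölder's inequality supplies the reverse bound when it is needed. -/
theorem toReal_eLpNorm_signPow_mul_le {ψ : X → ℝ} (hψ : Measurable ψ) {C : ℝ}
    (hC : ∀ x, |ψ x| ≤ C) {p : ℝ≥0∞} (hp : 1 ≤ p) (hp1 : p ≠ 1) :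
    (eLpNorm (fun x => signPow (p.conjExponent.toReal - 1) (ψ x)) p μ).toReal *
      (eLpNorm ψ p.conjExponent μ).toReal ≤ ∫ x, |ψ x| ^ p.conjExponent.toReal ∂μ := by
  have hI : 0 ≤ ∫ x, |ψ x| ^ p.conjExponent.toReal ∂μ :=
    integral_nonneg fun x => by positivity
  rw [toReal_eLpNorm_of_bounded hψ hC (one_le_conjExponent p) (conjExponent_ne_top hp hp1)]
  -- For p = ∞ the power is of order 0, that is, the sign function, whose sup norm is at most 1.
  rcases eq_or_ne p ⊤ with rfl | hpt
  · rw [conjExponent_top, ENNReal.toReal_one] at hI ⊢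
    rw [inv_one, Real.rpow_one]
    refine mul_le_of_le_one_left hI ?_
    refine ENNReal.toReal_le_of_le_ofReal zero_le_one ?_
    rw [eLpNorm_exponent_top]
    refine eLpNormEssSup_le_of_ae_bound (Eventually.of_forall fun x => ?_)
    simpa using abs_signPow_le (1 - 1) (ψ x)
  · have hq := one_le_toReal_conjExponent hp hp1
    have hpq := holderConjugate_toReal hp hp1 hpt
    set q := p.conjExponent.toReal
    rw [toReal_eLpNorm_of_bounded (ψ := fun x => signPow (q - 1) (ψ x))
      ((measurable_signPow _).comp hψ) (fun x => abs_signPow_le_of_abs_le (by linarith) (hC x)) hp hpt]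
    have h1 : ∫ x, |signPow (q - 1) (ψ x)| ^ p.toReal ∂μ ≤ ∫ x, |ψ x| ^ q ∂μ := by
      refine integral_mono_of_nonneg (Eventually.of_forall fun x => by positivity) ?_
        (Eventually.of_forall fun x => ?_)
      · refine Integrable.of_bound (hψ.abs.pow_const q).aestronglyMeasurable (C ^ q) (Eventually.of_forall fun x => ?_)
        rw [Real.norm_of_nonneg (by positivity)]
        exact Real.rpow_le_rpow (abs_nonneg _) (hC x) (by linarith)
      · refine (Real.rpow_le_rpow (abs_nonneg _) (abs_signPow_le _ _) hpq.nonneg).trans_eq ?_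
        rw [← Real.rpow_mul (abs_nonneg _), hpq.symm.sub_one_mul_conj]
    calc _ ≤ (∫ x, |ψ x| ^ q ∂μ) ^ p.toReal⁻¹ * (∫ x, |ψ x| ^ q ∂μ) ^ q⁻¹ := by
          gcongr
      _ = _ := by
          rw [← Real.rpow_add_of_nonneg hI (inv_nonneg.2 hpq.nonneg) (inv_nonneg.2 (by linarith)),
            hpq.inv_add_inv_eq_one, Real.rpow_one]

end BoundedFunctions

/-! ### The sharp pointwise inequality by duality -/

section Duality

variable {n m : ℕ} [hn : Fact (2 ≤ n)]

/-- The profile of the Poisson kernel: `P(rN, ζ) = radial n r ζ_n`. -/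
noncomputable def radial (n : ℕ) (r t : ℝ) : ℝ := (1 - r ^ 2) / √(1 + r ^ 2 - 2 * r * t) ^ n

theorem poissonRadial_eq (r : ℝ) (η : Sph n) : poissonRadial n r η = radial n r (height η) := by
  have h : ‖r • north n - (η : EuclideanSpace ℝ (Fin n))‖ = √(1 + r ^ 2 - 2 * r * height η) := by
    rw [← Real.sqrt_sq (norm_nonneg _), norm_sub_sq_real, norm_smul, norm_north,
      norm_eq_of_mem_sphere, inner_smul_left, height]
    congr 1
    simp only [Real.norm_eq_abs, mul_one, sq_abs, conj_trivial]
    ring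
  rw [poissonRadial, poissonKernel, h, norm_smul, norm_north, mul_one, Real.norm_eq_abs, sq_abs,
    radial]

theorem smul_north_mem_ball {r : ℝ} (hr : r ∈ Ioo (-1 : ℝ) 1) :
    r • north n ∈ Metric.ball (0 : EuclideanSpace ℝ (Fin n)) 1 := by
  rw [mem_ball_zero_iff, norm_smul, norm_north, mul_one, Real.norm_eq_abs, abs_lt]
  exact hr

omit hn in
theorem exists_bound_poissonKernel {x : EuclideanSpace ℝ (Fin n)}
    (hx : x ∈ Metric.ball (0 : EuclideanSpace ℝ (Fin n)) 1) :
    ∃ C, ∀ ζ, |poissonKernel n x ζ| ≤ C := by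
  obtain ⟨C, hC⟩ := isCompact_univ.exists_bound_of_continuousOn
    (continuous_poissonKernel hx).continuousOn
  exact ⟨C, fun ζ => hC ζ (mem_univ ζ)⟩

theorem memLp_poissonKernel_sub {x : EuclideanSpace ℝ (Fin n)}
    (hx : x ∈ Metric.ball (0 : EuclideanSpace ℝ (Fin n)) 1) (a : ℝ) (q : ℝ≥0∞) :
    MemLp (fun ζ => poissonKernel n x ζ - a) q (sigma n) := by
  obtain ⟨C, hC⟩ := exists_bound_poissonKernel hx
  have h := (continuous_poissonKernel hx).measurable
  refine MemLp.of_bound (h.sub_const a).aestronglyMeasurable (C + |a|)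
    (Eventually.of_forall fun ζ => ?_)
  exact (norm_sub_le _ _).trans (add_le_add_left (hC ζ) _)

theorem eLpNorm_poissonKernel_sub_eq {x : EuclideanSpace ℝ (Fin n)}
    (hx : x ∈ Metric.ball (0 : EuclideanSpace ℝ (Fin n)) 1) (a : ℝ) (q : ℝ≥0∞) :
    eLpNorm (fun ζ => poissonKernel n x ζ - a) q (sigma n) =
      eLpNorm (fun ζ => poissonRadial n ‖x‖ ζ - a) q (sigma n) := by
  obtain ⟨A, hA⟩ : ∃ A : EuclideanSpace ℝ (Fin n) ≃ₗᵢ[ℝ] EuclideanSpace ℝ (Fin n),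
      A x = ‖x‖ • north n := exists_isometry_of_norm_eq (by simp [norm_smul, norm_north])
  have hx' : ‖x‖ • north n ∈ Metric.ball (0 : EuclideanSpace ℝ (Fin n)) 1 := by
    rw [← hA]
    simpa using hx
  refine (Eq.trans ?_ (eLpNorm_comp_measurePreserving
    (memLp_poissonKernel_sub hx' a q).1 (measurePreserving_rotate A)))
  congr 1
  ext ζ
  simp only [Function.comp_apply, poissonRadial, ← hA, poissonKernel_rotate]

theorem g_eq_toReal {p : ℝ≥0∞} {x : EuclideanSpace ℝ (Fin n)}
    (hx : x ∈ Metric.ball (0 : EuclideanSpace ℝ (Fin n)) 1) :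
    g n p ‖x‖ = (⨅ a : ℝ≥0, eLpNorm (fun ζ => poissonKernel n x ζ - (a : ℝ)) p.conjExponent
      (sigma n)).toReal := by
  simp only [g, eLpNorm_poissonKernel_sub_eq hx]

theorem iInf_eLpNorm_ne_top {p : ℝ≥0∞} {x : EuclideanSpace ℝ (Fin n)}
    (hx : x ∈ Metric.ball (0 : EuclideanSpace ℝ (Fin n)) 1) :
    (⨅ a : ℝ≥0, eLpNorm (fun ζ => poissonKernel n x ζ - (a : ℝ)) p.conjExponent
      (sigma n)) ≠ ⊤ :=
  ne_top_of_le_ne_top (memLp_poissonKernel_sub hx ((0 : ℝ≥0) : ℝ) _).eLpNorm_ne_top (iInf_le _ 0)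

omit hn in
theorem g_nonneg (p : ℝ≥0∞) (r : ℝ) : 0 ≤ g n p r := ENNReal.toReal_nonneg

theorem g_le {p : ℝ≥0∞} {x : EuclideanSpace ℝ (Fin n)}
    (hx : x ∈ Metric.ball (0 : EuclideanSpace ℝ (Fin n)) 1) {a : ℝ} (ha : 0 ≤ a) :
    g n p ‖x‖ ≤ (eLpNorm (fun ζ => poissonKernel n x ζ - a) p.conjExponent (sigma n)).toReal := by
  rw [g_eq_toReal hx]
  refine ENNReal.toReal_mono (memLp_poissonKernel_sub hx a _).eLpNorm_ne_top ?_
  exact iInf_le (fun a : ℝ≥0 => eLpNorm (fun ζ => poissonKernel n x ζ - (a : ℝ)) p.conjExponent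
      (sigma n)) ⟨a, ha⟩

/-- As `φ` has mean zero, the kernel may be replaced by P − a for every a before Hölder's inequality
is applied. -/
theorem norm_integral_poissonKernel_smul_le {F : Type} [NormedAddCommGroup F] [NormedSpace ℝ F]
    {p : ℝ≥0∞} (hp : 1 ≤ p) {x : EuclideanSpace ℝ (Fin n)}
    (hx : x ∈ Metric.ball (0 : EuclideanSpace ℝ (Fin n)) 1) {φ : Sph n → F}
    (hφ : MemLp φ p (sigma n)) (hφ0 : ∫ ζ, φ ζ ∂(sigma n) = 0) :
    ‖∫ ζ, poissonKernel n x ζ • φ ζ ∂(sigma n)‖ ≤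
      g n p ‖x‖ * (eLpNorm φ p (sigma n)).toReal := by
  have hconj := (ENNReal.HolderConjugate.conjExponent hp).symm
  have hφi : Integrable φ (sigma n) := hφ.integrable hp
  obtain ⟨C, hC⟩ := exists_bound_poissonKernel hx
  have hPm := (continuous_poissonKernel hx).measurable
  have hPi : Integrable (fun ζ => poissonKernel n x ζ • φ ζ) (sigma n) :=
    hφi.bdd_smul C hPm.aestronglyMeasurable (Eventually.of_forall hC)
  have key : ∀ a : ℝ≥0, ‖∫ ζ, poissonKernel n x ζ • φ ζ ∂(sigma n)‖ₑ ≤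
      eLpNorm (fun ζ => poissonKernel n x ζ - (a : ℝ)) p.conjExponent (sigma n) *
        eLpNorm φ p (sigma n) := by
    intro a
    have h1 : ∫ ζ, poissonKernel n x ζ • φ ζ ∂(sigma n) =
        ∫ ζ, (poissonKernel n x ζ - (a : ℝ)) • φ ζ ∂(sigma n) := by
      have hai : Integrable (fun ζ => (a : ℝ) • φ ζ) (sigma n) := hφi.smul (a : ℝ)
      simp only [sub_smul]
      rw [integral_sub hPi hai, integral_smul, hφ0, smul_zero, sub_zero]
    rw [h1]
    refine (enorm_integral_le_lintegral_enorm _).trans ?_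
    rw [← eLpNorm_one_eq_lintegral_enorm]
    exact eLpNorm_smul_le_mul_eLpNorm hφ.1 (hPm.sub_const _).aestronglyMeasurable
  have h2 : ‖∫ ζ, poissonKernel n x ζ • φ ζ ∂(sigma n)‖ₑ ≤
      (⨅ a : ℝ≥0, eLpNorm (fun ζ => poissonKernel n x ζ - (a : ℝ)) p.conjExponent (sigma n)) *
        eLpNorm φ p (sigma n) := by
    rw [ENNReal.iInf_mul fun h => absurd h hφ.eLpNorm_ne_top]
    exact le_iInf key
  rw [g_eq_toReal hx, ← ENNReal.toReal_mul, ← toReal_enorm]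
  exact ENNReal.toReal_mono
    (ENNReal.mul_ne_top (iInf_eLpNorm_ne_top hx) hφ.eLpNorm_ne_top) h2

omit hn in
theorem hardyENorm_ge {p : ℝ≥0∞} (f : EuclideanSpace ℝ (Fin n) → EuclideanSpace ℝ (Fin m))
    {R : ℝ} (hR : R ∈ Ico (0 : ℝ) 1) :
    eLpNorm (fun η : Sph n => f (R • (η : EuclideanSpace ℝ (Fin n)))) p (sigma n) ≤
      hardyENorm p f :=
  le_iSup₂ (f := fun (r : ℝ) (_ : r ∈ Ico (0 : ℝ) 1) =>
    eLpNorm (fun η : Sph n => f (r • (η : EuclideanSpace ℝ (Fin n)))) p (sigma n)) R hR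

theorem harmonic_eq_integral_smul
    {f : EuclideanSpace ℝ (Fin n) → EuclideanSpace ℝ (Fin m)}
    (hf : HarmonicOnNhd f (Metric.ball 0 1)) {R : ℝ} (hR0 : 0 < R) (hR1 : R < 1)
    {x : EuclideanSpace ℝ (Fin n)} (hx : x ∈ Metric.ball (0 : EuclideanSpace ℝ (Fin n)) 1) :
    Continuous (fun ζ : Sph n => f (R • (ζ : EuclideanSpace ℝ (Fin n)))) ∧
    f (R • x) = ∫ ζ : Sph n, poissonKernel n x ζ • f (R • (ζ : EuclideanSpace ℝ (Fin n)))
      ∂(sigma n) := by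
  have hc : Continuous (fun ζ : Sph n => f (R • (ζ : EuclideanSpace ℝ (Fin n)))) :=
    hf.contDiffOn.continuousOn.comp_continuous (by fun_prop)
      fun ζ => smul_mem_ball ⟨hR0.le, hR1⟩ ζ
  refine ⟨hc, ?_⟩
  have hint : Integrable (fun ζ : Sph n => poissonKernel n x ζ •
      f (R • (ζ : EuclideanSpace ℝ (Fin n)))) (sigma n) :=
    ((continuous_poissonKernel hx).smul hc).integrable_of_hasCompactSupport
      (HasCompactSupport.of_compactSpace _)
  ext i
  have h1 := harmonic_eq_poissonIntegral
    (hf.comp_CLM (EuclideanSpace.proj i : EuclideanSpace ℝ (Fin m) →L[ℝ] ℝ)) hR0 hR1 hx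
  have h2 := (EuclideanSpace.proj i : EuclideanSpace ℝ (Fin m) →L[ℝ] ℝ).integral_comp_comm hint
  refine h1.trans (Eq.trans ?_ h2)
  simp

/-- No boundary values of `f` are available, so the duality bound is applied to the dilates f(R·)
and R tends to 1 at the end. -/
theorem norm_le_g_mul_hardyNorm {p : ℝ≥0∞} (hp : 1 ≤ p)
    {f : EuclideanSpace ℝ (Fin n) → EuclideanSpace ℝ (Fin m)} (hf : MemHardy p f) (hf0 : f 0 = 0)
    {x : EuclideanSpace ℝ (Fin n)} (hx : x ∈ Metric.ball (0 : EuclideanSpace ℝ (Fin n)) 1) :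
    ‖f x‖ ≤ g n p ‖x‖ * hardyNorm p f := by
  have key : ∀ R ∈ Ioo (0 : ℝ) 1, ‖f (R • x)‖ ≤ g n p ‖x‖ * hardyNorm p f := by
    intro R hR
    obtain ⟨hc, h1⟩ := harmonic_eq_integral_smul hf.harmonic hR.1 hR.2 hx
    obtain ⟨-, h2⟩ := harmonic_eq_integral_smul hf.harmonic hR.1 hR.2
      (Metric.mem_ball_self one_pos)
    have h3 : ∫ ζ : Sph n, f (R • (ζ : EuclideanSpace ℝ (Fin n))) ∂(sigma n) = 0 := by
      simpa [poissonKernel, hf0] using h2.symm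
    have h4 := hardyENorm_ge (p := p) f ⟨hR.1.le, hR.2⟩
    have hm : MemLp (fun ζ : Sph n => f (R • (ζ : EuclideanSpace ℝ (Fin n)))) p (sigma n) :=
      ⟨hc.aestronglyMeasurable, h4.trans_lt hf.finite⟩
    rw [h1]
    refine (norm_integral_poissonKernel_smul_le hp hx hm h3).trans ?_
    exact mul_le_mul_of_nonneg_left (ENNReal.toReal_mono hf.finite.ne h4) (g_nonneg _ _)
  have hcont : ContinuousAt (fun R : ℝ => f (R • x)) 1 := by
    have h1 := (hf.harmonic x hx).1.continuousAt
    exact ContinuousAt.comp (by simpa using h1) (by fun_prop)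
  have hlim := hcont.norm.tendsto.mono_left (nhdsWithin_le_nhds (s := Iio 1))
  simp only [one_smul] at hlim
  exact le_of_tendsto hlim (mem_of_superset (Ioo_mem_nhdsLT zero_lt_one) key)

omit hn in
theorem poissonIntegral_zero (φ : Sph n → ℝ) : poissonIntegral n φ 0 = ∫ ζ, φ ζ ∂(sigma n) := by
  simp [poissonIntegral, poissonKernel]

theorem memHardy_poissonIntegral_smul {φ : Sph n → ℝ} (hφ : Measurable φ) {p : ℝ≥0∞} (hp : 1 ≤ p)
    (hφp : MemLp φ p (sigma n)) {e : EuclideanSpace ℝ (Fin m)} (he : ‖e‖ = 1) :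
    MemHardy p (fun x => poissonIntegral n φ x • e) := by
  refine ⟨?_, (hardyENorm_poissonIntegral_smul_le hφ hp he).trans_lt hφp.2⟩
  exact (harmonicOnNhd_poissonIntegral (hφp.integrable hp)).comp_CLM
    (ContinuousLinearMap.toSpanSingleton ℝ e)

/-- A boundary function attaining the bound yields an extremal harmonic mapping. -/
theorem exists_extremal_of_integral_eq {φ : Sph n → ℝ} (hφ : Measurable φ) {p : ℝ≥0∞} (hp : 1 ≤ p)
    (hφp : MemLp φ p (sigma n)) (hφ0 : ∫ ζ, φ ζ ∂(sigma n) = 0)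
    {e : EuclideanSpace ℝ (Fin m)} (he : ‖e‖ = 1) {x : EuclideanSpace ℝ (Fin n)}
    (hx : x ∈ Metric.ball (0 : EuclideanSpace ℝ (Fin n)) 1)
    (h : poissonIntegral n φ x = g n p ‖x‖ * (eLpNorm φ p (sigma n)).toReal)
    (hpos : 0 < poissonIntegral n φ x) :
    ∃ f : EuclideanSpace ℝ (Fin n) → EuclideanSpace ℝ (Fin m),
      MemHardy p f ∧ f 0 = 0 ∧ 0 < hardyNorm p f ∧ ‖f x‖ = g n p ‖x‖ * hardyNorm p f := by
  have hmem := memHardy_poissonIntegral_smul hφ hp hφp he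
  have h0 : (fun x => poissonIntegral n φ x • e) 0 = 0 := by
    simp only [poissonIntegral_zero, hφ0, zero_smul]
  have hle := norm_le_g_mul_hardyNorm hp hmem h0 hx
  have hnorm : ‖poissonIntegral n φ x • e‖ = poissonIntegral n φ x := by
    rw [norm_smul, he, mul_one, Real.norm_of_nonneg hpos.le]
  -- Only this upper bound for the Hardy norm is needed: together with the general inequality it
  -- forces equality.
  have hle2 : hardyNorm p (fun x => poissonIntegral n φ x • e) ≤
      (eLpNorm φ p (sigma n)).toReal :=
    ENNReal.toReal_mono hφp.2.ne (hardyENorm_poissonIntegral_smul_le hφ hp he)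
  simp only [hnorm] at hle
  refine ⟨_, hmem, h0, ?_, ?_⟩
  · by_contra hneg
    have h1 : hardyNorm p (fun x => poissonIntegral n φ x • e) = 0 :=
      le_antisymm (not_lt.1 hneg) ENNReal.toReal_nonneg
    rw [h1, mul_zero] at hle
    linarith
  · simp only [hnorm]
    refine le_antisymm hle ?_
    rw [h]
    exact mul_le_mul_of_nonneg_left hle2 (g_nonneg _ _)

/-- The value of `g` when the balanced level `a` of the Poisson kernel is known. -/
theorem g_eq_of_balanced {p : ℝ≥0∞} (hp : 1 ≤ p) (hp1 : p ≠ 1) {x : EuclideanSpace ℝ (Fin n)}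
    (hx : x ∈ Metric.ball (0 : EuclideanSpace ℝ (Fin n)) 1) {a : ℝ} (ha : 0 ≤ a)
    (hbal : ∫ ζ, signPow (p.conjExponent.toReal - 1) (poissonKernel n x ζ - a) ∂(sigma n) = 0)
    (hne : 0 < ∫ ζ, |poissonKernel n x ζ - a| ^ p.conjExponent.toReal ∂(sigma n)) :
    MemLp (fun ζ => signPow (p.conjExponent.toReal - 1) (poissonKernel n x ζ - a)) p (sigma n) ∧
    g n p ‖x‖ = (∫ ζ, |poissonKernel n x ζ - a| ^ p.conjExponent.toReal ∂(sigma n)) ^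
      (p.conjExponent.toReal)⁻¹ ∧
    poissonIntegral n (fun ζ => signPow (p.conjExponent.toReal - 1) (poissonKernel n x ζ - a)) x =
      ∫ ζ, |poissonKernel n x ζ - a| ^ p.conjExponent.toReal ∂(sigma n) ∧
    poissonIntegral n (fun ζ => signPow (p.conjExponent.toReal - 1) (poissonKernel n x ζ - a)) x =
      g n p ‖x‖ * (eLpNorm (fun ζ => signPow (p.conjExponent.toReal - 1) (poissonKernel n x ζ - a))
        p (sigma n)).toReal := by
  have hq := one_le_toReal_conjExponent hp hp1
  obtain ⟨C, hC⟩ := exists_bound_poissonKernel hx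
  set q := p.conjExponent.toReal with hqdef
  have hPm := (continuous_poissonKernel hx).measurable
  set ψ : Sph n → ℝ := fun ζ => poissonKernel n x ζ - a with hψdef
  have hψm : Measurable ψ := hPm.sub_const a
  have hψC : ∀ ζ, |ψ ζ| ≤ C + |a| := fun ζ =>
    (abs_sub _ _).trans (add_le_add_left (hC ζ) _)
  set φ : Sph n → ℝ := fun ζ => signPow (q - 1) (ψ ζ) with hφdef
  have hφm : Measurable φ := (measurable_signPow _).comp hψm
  have hφC : ∀ ζ, |φ ζ| ≤ (C + |a|) ^ (q - 1) := fun ζ =>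
    abs_signPow_le_of_abs_le (by linarith) (hψC ζ)
  have hφp : MemLp φ p (sigma n) :=
    MemLp.of_bound hφm.aestronglyMeasurable _ (Eventually.of_forall hφC)
  have hφi : Integrable φ (sigma n) := hφp.integrable hp
  have hI : poissonIntegral n φ x = ∫ ζ, |ψ ζ| ^ q ∂(sigma n) := by
    have hPφ : Integrable (fun ζ => poissonKernel n x ζ * φ ζ) (sigma n) :=
      hφi.bdd_mul hPm.aestronglyMeasurable (Eventually.of_forall hC)
    -- Write P = (P − a) + a; the term with a drops out by balance, leaving ∫ |P − a|^q.
    have h1 : ∀ ζ, |ψ ζ| ^ q = poissonKernel n x ζ * φ ζ - a * φ ζ := by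
      intro ζ
      have := mul_signPow (c := q - 1) (by linarith) (ψ ζ)
      rw [sub_add_cancel] at this
      rw [← this]
      simp only [hψdef, hφdef]
      ring
    simp only [h1]
    rw [integral_sub hPφ (hφi.const_mul a), integral_const_mul, hbal, mul_zero, sub_zero]
    rfl
  have hub := g_le (p := p) hx ha
  have h2 := toReal_eLpNorm_signPow_mul_le (μ := sigma n) hψm hψC hp hp1
  have h3 := norm_integral_poissonKernel_smul_le hp hx hφp hbal
  have h4 : ‖∫ ζ, poissonKernel n x ζ • φ ζ ∂(sigma n)‖ = ∫ ζ, |ψ ζ| ^ q ∂(sigma n) := by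
    rw [← hI]
    have : 0 ≤ poissonIntegral n φ x := by rw [hI]; exact hne.le
    exact Real.norm_of_nonneg this
  rw [h4] at h3
  have hval := toReal_eLpNorm_of_bounded (μ := sigma n) hψm hψC (one_le_conjExponent p)
    (conjExponent_ne_top hp hp1)
  have hφpos : 0 < (eLpNorm φ p (sigma n)).toReal := by
    by_contra hneg
    have h5 : (eLpNorm φ p (sigma n)).toReal = 0 :=
      le_antisymm (not_lt.1 hneg) ENNReal.toReal_nonneg
    rw [h5, mul_zero] at h3
    linarith
  -- ‖ψ‖_q ‖φ‖_p ≤ ∫ |ψ|^q ≤ g ‖φ‖_p by the equality case of Hölder and by duality; cancelling ‖φ‖_p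
  -- shows that the level a realizes the infimum.
  have hg : g n p ‖x‖ = (eLpNorm ψ p.conjExponent (sigma n)).toReal := by
    refine le_antisymm hub ?_
    refine le_of_mul_le_mul_right ?_ hφpos
    calc _ = _ := mul_comm _ _
      _ ≤ _ := h2
      _ ≤ _ := h3
  refine ⟨hφp, hg.trans hval, hI, ?_⟩
  rw [hI]
  refine le_antisymm h3 ?_
  rw [hg, mul_comm]
  exact h2

end Duality

end HarmonicSchwarz

namespace HarmonicSchwarz

open Filter Topology InnerProductSpace Laplacian

/-! ### The Poisson kernel as a function of radius and height -/

section RadialAlgebra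

theorem distSq_pos {r t : ℝ} (hr : r ∈ Ioo (-1 : ℝ) 1) (ht : t ∈ Icc (-1 : ℝ) 1) :
    0 < 1 + r ^ 2 - 2 * r * t := by
  rcases le_total 0 r with h | h
  · nlinarith [mul_nonneg h (sub_nonneg.2 ht.2), hr.2, sq_nonneg (1 - r), mul_pos (sub_pos.2 hr.2) (sub_pos.2 hr.2)]
  · nlinarith [mul_nonneg (neg_nonneg.2 h) (by linarith [ht.1] : 0 ≤ 1 + t), hr.1,
      mul_pos (by linarith [hr.1] : 0 < 1 + r) (by linarith [hr.1] : 0 < 1 + r)]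

theorem one_sub_sq_pos {r : ℝ} (hr : r ∈ Ioo (-1 : ℝ) 1) : 0 < 1 - r ^ 2 := by
  nlinarith [hr.1, hr.2]

variable (n : ℕ)

/-- The divided difference of `t ↦ radial n r t`, divided by `r`. -/
noncomputable def diffQuot (r s t : ℝ) : ℝ :=
  2 * (1 - r ^ 2) * (∑ i ∈ Finset.range n,
    √(1 + r ^ 2 - 2 * r * s) ^ i * √(1 + r ^ 2 - 2 * r * t) ^ (n - 1 - i)) /
    (√(1 + r ^ 2 - 2 * r * t) ^ n * √(1 + r ^ 2 - 2 * r * s) ^ n *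
      (√(1 + r ^ 2 - 2 * r * s) + √(1 + r ^ 2 - 2 * r * t)))

/-- The profile `t ↦ (radial n r t - radial n r 0) / r`, extended to `r = 0`. -/
noncomputable def profile (r t : ℝ) : ℝ := t * diffQuot n r 0 t

variable {n}

/-- With x and y the two distances, y^n − x^n is a geometric sum times y − x, and y² − x² = 2r(t −
s) trades y − x for 2r(t − s)/(y + x). The remaining quotient is smooth and positive even at r = 0
and at s = t. -/
theorem radial_sub_radial {r s t : ℝ} (hr : r ∈ Ioo (-1 : ℝ) 1) (hs : s ∈ Icc (-1 : ℝ) 1)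
    (ht : t ∈ Icc (-1 : ℝ) 1) :
    radial n r t - radial n r s = r * ((t - s) * diffQuot n r s t) := by
  have hx := Real.sqrt_pos.2 (distSq_pos hr ht)
  have hy := Real.sqrt_pos.2 (distSq_pos hr hs)
  have hx2 := Real.sq_sqrt (distSq_pos hr ht).le
  have hy2 := Real.sq_sqrt (distSq_pos hr hs).le
  rw [radial, radial, diffQuot]
  set x := √(1 + r ^ 2 - 2 * r * t)
  set y := √(1 + r ^ 2 - 2 * r * s)
  have hgeom := geom_sum₂_mul y x n
  set S := ∑ i ∈ Finset.range n, y ^ i * x ^ (n - 1 - i)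
  have h1 : (1 - r ^ 2) / x ^ n - (1 - r ^ 2) / y ^ n =
      (1 - r ^ 2) * (y ^ n - x ^ n) / (x ^ n * y ^ n) := by
    field_simp
  have h2 : r * (t - s) * 2 = (y - x) * (y + x) := by linear_combination hx2 - hy2
  rw [h1, ← hgeom, show r * ((t - s) * (2 * (1 - r ^ 2) * S / (x ^ n * y ^ n * (y + x)))) =
    (r * (t - s) * 2) * ((1 - r ^ 2) * S / (x ^ n * y ^ n * (y + x))) by ring, h2]
  field_simp

theorem diffQuot_pos (hn : n ≠ 0) {r s t : ℝ} (hr : r ∈ Ioo (-1 : ℝ) 1) (hs : s ∈ Icc (-1 : ℝ) 1)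
    (ht : t ∈ Icc (-1 : ℝ) 1) : 0 < diffQuot n r s t := by
  have hx := Real.sqrt_pos.2 (distSq_pos hr ht)
  have hy := Real.sqrt_pos.2 (distSq_pos hr hs)
  have h1 := one_sub_sq_pos hr
  have h2 : 0 < ∑ i ∈ Finset.range n,
      √(1 + r ^ 2 - 2 * r * s) ^ i * √(1 + r ^ 2 - 2 * r * t) ^ (n - 1 - i) :=
    Finset.sum_pos (fun i _ => by positivity) (by simpa using hn)
  unfold diffQuot
  positivity

theorem diffQuot_zero (s t : ℝ) : diffQuot n 0 s t = n := by
  simp [diffQuot]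
  ring

/-- In this additive form, with a profile independent of the level, continuity and monotonicity in
`s` are visible. The case r = 0 is separate because the factor r cannot be cancelled. -/
theorem mul_diffQuot_eq {r s t : ℝ} (hr : r ∈ Ioo (-1 : ℝ) 1) (hs : s ∈ Icc (-1 : ℝ) 1)
    (ht : t ∈ Icc (-1 : ℝ) 1) :
    (t - s) * diffQuot n r s t = profile n r t - profile n r s := by
  have h0 : (0 : ℝ) ∈ Icc (-1 : ℝ) 1 := by constructor <;> norm_num
  rcases eq_or_ne r 0 with rfl | hne
  · simp only [profile, diffQuot_zero]
    ring
  · refine mul_left_cancel₀ hne ?_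
    rw [← radial_sub_radial hr hs ht, mul_sub, profile, profile]
    have h1 := radial_sub_radial (n := n) hr h0 ht
    have h2 := radial_sub_radial (n := n) hr h0 hs
    rw [sub_zero] at h1 h2
    rw [← h1, ← h2]
    ring

theorem strictMonoOn_profile (hn : n ≠ 0) {r : ℝ} (hr : r ∈ Ioo (-1 : ℝ) 1) :
    StrictMonoOn (profile n r) (Icc (-1) 1) := by
  intro s hs t ht hst
  have h := mul_diffQuot_eq (n := n) hr hs ht
  have := mul_pos (sub_pos.2 hst) (diffQuot_pos hn hr hs ht)
  linarith

theorem strictMonoOn_radial (hn : n ≠ 0) {r : ℝ} (hr : r ∈ Ioo (0 : ℝ) 1) :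
    StrictMonoOn (radial n r) (Icc (-1) 1) := by
  intro s hs t ht hst
  have hr' : r ∈ Ioo (-1 : ℝ) 1 := ⟨by linarith [hr.1], hr.2⟩
  have h := radial_sub_radial (n := n) hr' hs ht
  have := mul_pos hr.1 (mul_pos (sub_pos.2 hst) (diffQuot_pos hn hr' hs ht))
  linarith

theorem radial_pos {r t : ℝ} (hr : r ∈ Ioo (-1 : ℝ) 1) (ht : t ∈ Icc (-1 : ℝ) 1) :
    0 < radial n r t := by
  have hx := Real.sqrt_pos.2 (distSq_pos hr ht)
  have h1 := one_sub_sq_pos hr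
  unfold radial
  positivity

section Smooth

variable {E : Type} [NormedAddCommGroup E] [NormedSpace ℝ E] {f g h : E → ℝ} {z : E}

theorem contDiffAt_sqrt_distSq (hf : ContDiffAt ℝ (⊤ : ℕ∞) f z) (hg : ContDiffAt ℝ (⊤ : ℕ∞) g z)
    (hz : 1 + f z ^ 2 - 2 * f z * g z ≠ 0) :
    ContDiffAt ℝ (⊤ : ℕ∞) (fun z => √(1 + f z ^ 2 - 2 * f z * g z)) z :=
  ContDiffAt.sqrt (by fun_prop) hz

theorem contDiffAt_radial (hf : ContDiffAt ℝ (⊤ : ℕ∞) f z) (hg : ContDiffAt ℝ (⊤ : ℕ∞) g z)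
    (hz : 0 < 1 + f z ^ 2 - 2 * f z * g z) :
    ContDiffAt ℝ (⊤ : ℕ∞) (fun z => radial n (f z) (g z)) z := by
  have h1 := contDiffAt_sqrt_distSq hf hg hz.ne'
  have hx := Real.sqrt_pos.2 hz
  exact ContDiffAt.div (by fun_prop) (h1.pow n) (by positivity)

theorem contDiffAt_diffQuot (hf : ContDiffAt ℝ (⊤ : ℕ∞) f z) (hg : ContDiffAt ℝ (⊤ : ℕ∞) g z)
    (hh : ContDiffAt ℝ (⊤ : ℕ∞) h z) (hfz : f z ∈ Ioo (-1 : ℝ) 1) (hgz : g z ∈ Icc (-1 : ℝ) 1)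
    (hhz : h z ∈ Icc (-1 : ℝ) 1) :
    ContDiffAt ℝ (⊤ : ℕ∞) (fun z => diffQuot n (f z) (g z) (h z)) z := by
  have h1 := contDiffAt_sqrt_distSq hf hg (distSq_pos hfz hgz).ne'
  have h2 := contDiffAt_sqrt_distSq hf hh (distSq_pos hfz hhz).ne'
  have hx := Real.sqrt_pos.2 (distSq_pos hfz hgz)
  have hy := Real.sqrt_pos.2 (distSq_pos hfz hhz)
  unfold diffQuot
  refine ContDiffAt.div ?_ (((h2.pow n).mul (h1.pow n)).mul (h1.add h2)) (by positivity)
  refine ContDiffAt.mul (by fun_prop) ?_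
  exact ContDiffAt.sum fun i _ => (h1.pow i).mul (h2.pow (n - 1 - i))

end Smooth

theorem continuousOn_profile {r : ℝ} (hr : r ∈ Ioo (-1 : ℝ) 1) :
    ContinuousOn (profile n r) (Icc (-1) 1) := by
  intro t ht
  have h := contDiffAt_diffQuot (n := n) (f := fun _ : ℝ => r) (g := fun _ => 0) (h := fun t => t)
    (z := t) contDiffAt_const contDiffAt_const contDiffAt_id hr (by constructor <;> norm_num) ht
  exact (continuousAt_id.mul h.continuousAt).continuousWithinAt

variable (n) in
/-- The derivative of the profile of the Poisson kernel with respect to the radius. -/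
noncomputable def radialDeriv (r t : ℝ) : ℝ :=
  ((4 * r ^ 2 + n * (1 - r ^ 2)) * t - r * (2 * (1 + r ^ 2) + n * (1 - r ^ 2))) /
    √(1 + r ^ 2 - 2 * r * t) ^ (n + 2)

theorem hasDerivAt_radial (hn : n ≠ 0) {r t : ℝ} (h : 0 < 1 + r ^ 2 - 2 * r * t) :
    HasDerivAt (fun ρ => radial n ρ t) (radialDeriv n r t) r := by
  have hA : HasDerivAt (fun ρ : ℝ => 1 + ρ ^ 2 - 2 * ρ * t) (2 * r - 2 * t) r := by
    have : HasDerivAt (fun ρ : ℝ => 1 + ρ ^ 2 - 2 * ρ * t) _ r :=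
      ((hasDerivAt_pow 2 r).const_add 1).sub (((hasDerivAt_id r).const_mul 2).mul_const t)
    refine this.congr_deriv ?_
    simp
  have hs := hA.sqrt h.ne'
  have hx := Real.sqrt_pos.2 h
  have hN : HasDerivAt (fun ρ : ℝ => 1 - ρ ^ 2) (-(2 * r)) r := by
    have := (hasDerivAt_pow 2 r).const_sub 1
    simpa using this
  have h1 := hN.fun_div (hs.fun_pow n) (by positivity)
  refine h1.congr_deriv ?_
  have hx2 := Real.sq_sqrt h.le
  obtain ⟨k, rfl⟩ := Nat.exists_eq_succ_of_ne_zero hn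
  rw [radialDeriv]
  set x := √(1 + r ^ 2 - 2 * r * t)
  simp only [Nat.succ_eq_add_one, Nat.add_sub_cancel]
  have e1 : x ^ (k + 1) = x ^ k * x := pow_succ x k
  have e2 : x ^ (k + 1 + 2) = x ^ k * x ^ 3 := by ring
  have e3 : (x ^ (k + 1)) ^ 2 = x ^ k * x ^ k * x ^ 2 := by ring
  have hxk : 0 < x ^ k := by positivity
  rw [e1, e2, mul_pow]
  push_cast
  field_simp
  linear_combination (-2 * r) * hx2

end RadialAlgebra

/-! ### One-variable differentiation under the integral sign -/

section DerivUnderIntegral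

variable {X : Type} [TopologicalSpace X] [SecondCountableTopology X] [MeasurableSpace X]
  [BorelSpace X] {μ : Measure X} {O K : Set ℝ} {ι : X → ℝ} {φ : X → ℝ}

theorem hasDerivAt_integral_smul (hO : IsOpen O) (hK : IsCompact K) (hι : Continuous ι)
    (hιK : ∀ x, ι x ∈ K) (hφ : Integrable φ μ) {H : ℝ × ℝ → ℝ} {H' : ℝ → ℝ}
    (hH : ∀ z ∈ O, ∀ u ∈ K, ContDiffAt ℝ (⊤ : ℕ∞) H (z, u)) {z₀ : ℝ} (hz₀ : z₀ ∈ O)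
    (hH' : ∀ u ∈ K, HasDerivAt (fun z => H (z, u)) (H' u) z₀) :
    HasDerivAt (fun z => ∫ x, φ x • H (z, ι x) ∂μ) (∫ x, φ x * H' (ι x) ∂μ) z₀ ∧
      Integrable (fun x => φ x * H' (ι x)) μ := by
  have h1 := (hasFDerivAt_integral_smul hO hK hι hιK hφ
    (fun z hz u hu => (hH z hz u hu).of_le (by exact_mod_cast le_top)) hz₀).hasDerivAt
  have hcont : ContinuousOn
      (fun u : ℝ => (fderiv ℝ H (z₀, u)).comp (ContinuousLinearMap.inl ℝ ℝ ℝ)) K := by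
    intro u hu
    have h2 : ContinuousAt (fderiv ℝ H) (z₀, u) :=
      ((hH z₀ hz₀ u hu).fderiv_right (m := 0) (by exact_mod_cast le_top)).continuousAt
    have h3 : ContinuousAt (fun u => fderiv ℝ H (z₀, u)) u :=
      h2.comp (f := fun u => (z₀, u)) (by fun_prop)
    exact (h3.clm_comp continuousAt_const).continuousWithinAt
  have hint := integrable_smul_comp_of_continuousOn hK hι hιK hφ hcont
  have h4 : ∀ x, (φ x • (fderiv ℝ H (z₀, ι x)).comp (ContinuousLinearMap.inl ℝ ℝ ℝ)) 1 =
      φ x * H' (ι x) := by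
    intro x
    have h5 : HasFDerivAt (fun z => H (z, ι x))
        ((fderiv ℝ H (z₀, ι x)).comp (ContinuousLinearMap.inl ℝ ℝ ℝ)) z₀ :=
      HasFDerivAt.comp (f := fun z => (z, ι x)) z₀
        ((hH z₀ hz₀ (ι x) (hιK x)).differentiableAt (by simp)).hasFDerivAt
        (hasFDerivAt_prodMk_left z₀ (ι x))
    rw [← h5.hasDerivAt.unique (hH' (ι x) (hιK x))]
    rfl
  have h6 := hint.apply_continuousLinearMap (1 : ℝ)
  simp only [h4] at h6
  refine ⟨h1.congr_deriv ?_, h6⟩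
  rw [ContinuousLinearMap.integral_apply hint]
  exact integral_congr_ae (Eventually.of_forall h4)

end DerivUnderIntegral

/-! ### Positivity of the radial derivative against increasing functions -/

section RadialDerivative

variable {n : ℕ} [hn : Fact (2 ≤ n)]

theorem ne_zero_of_fact : n ≠ 0 := by
  have := hn.out
  omega

theorem hasDerivAt_integral_radial {φ : Sph n → ℝ} (hφ : Integrable φ (sigma n)) {r : ℝ}
    (hr : r ∈ Ioo (-1 : ℝ) 1) :
    HasDerivAt (fun ρ => ∫ ζ, φ ζ • radial n ρ (height ζ) ∂(sigma n))
      (∫ ζ, φ ζ * radialDeriv n r (height ζ) ∂(sigma n)) r ∧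
      Integrable (fun ζ => φ ζ * radialDeriv n r (height ζ)) (sigma n) :=
  hasDerivAt_integral_smul (H := fun p => radial n p.1 p.2) isOpen_Ioo isCompact_Icc
    continuous_height height_mem hφ
    (fun _ hz _ hu => contDiffAt_radial contDiffAt_fst contDiffAt_snd (distSq_pos hz hu)) hr
    fun _ hu => hasDerivAt_radial ne_zero_of_fact (distSq_pos hr hu)

theorem integral_radial {r : ℝ} (hr : r ∈ Ioo (-1 : ℝ) 1) :
    ∫ ζ : Sph n, radial n r (height ζ) ∂(sigma n) = 1 := by
  refine Eq.trans ?_ (integral_poissonKernel (smul_north_mem_ball (n := n) hr))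
  exact integral_congr_ae (Eventually.of_forall fun ζ => (poissonRadial_eq r ζ).symm)

theorem integral_radialDeriv {r : ℝ} (hr : r ∈ Ioo (-1 : ℝ) 1) :
    ∫ ζ : Sph n, radialDeriv n r (height ζ) ∂(sigma n) = 0 := by
  have h := (hasDerivAt_integral_radial (φ := fun _ : Sph n => 1) (integrable_const 1) hr).1
  simp only [one_smul, one_mul] at h
  have h2 : (fun ρ => ∫ ζ : Sph n, radial n ρ (height ζ) ∂(sigma n)) =ᶠ[𝓝 r] fun _ => 1 := by
    filter_upwards [Ioo_mem_nhds hr.1 hr.2] with ρ hρ using integral_radial hρ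
  exact h.unique ((hasDerivAt_const r (1 : ℝ)).congr_of_eventuallyEq h2)

/-- `radialDeriv` has mean zero and the sign of t − τ, so subtracting χ(τ) from `χ` does not change
the integral and makes the integrand nonnegative everywhere. -/
theorem integral_mono_mul_radialDeriv_pos {r s : ℝ} (hr : r ∈ Ioo (0 : ℝ) 1)
    (hs : s ∈ Ioo (-1 : ℝ) 1) {χ : ℝ → ℝ} (hχ : MonotoneOn χ (Icc (-1) 1))
    (hχpos : ∀ t ∈ Ioc s 1, 0 < χ t) (hχneg : ∀ t ∈ Ico (-1) s, χ t < 0) (hχs : χ s = 0)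
    (hχi : Integrable (fun ζ : Sph n => χ (height ζ)) (sigma n)) :
    0 < ∫ ζ : Sph n, χ (height ζ) * radialDeriv n r (height ζ) ∂(sigma n) := by
  have hr' : r ∈ Ioo (-1 : ℝ) 1 := ⟨by linarith [hr.1], hr.2⟩
  have hn2 : (2 : ℝ) ≤ n := by exact_mod_cast hn.out
  have h1r := one_sub_sq_pos hr'
  set a := 4 * r ^ 2 + n * (1 - r ^ 2) with ha
  set b := r * (2 * (1 + r ^ 2) + n * (1 - r ^ 2)) with hb
  have ha0 : 0 < a := by positivity
  have hb0 : 0 < b := by have := hr.1; positivity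
  have hba : b ≤ a := by
    have h2 : a - b = (1 - r) ^ 2 * (n * (1 + r) - 2 * r) := by rw [ha, hb]; ring
    have h3 : 0 ≤ n * (1 + r) - 2 * r := by nlinarith [hr.1]
    have h4 : 0 ≤ (1 - r) ^ 2 * (n * (1 + r) - 2 * r) := by positivity
    linarith
  -- The zero of the numerator a t − b of `radialDeriv`. It lies in (0, 1] because a − b = (1 −
  -- r)²(n(1 + r) − 2r).
  set τ := b / a with hτ
  have hτ0 : 0 < τ := by positivity
  have hτ1 : τ ≤ 1 := (div_le_one ha0).2 hba
  have hτm : τ ∈ Icc (-1 : ℝ) 1 := ⟨by linarith, hτ1⟩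
  have hsign : ∀ t ∈ Icc (-1 : ℝ) 1, ∃ w, 0 < w ∧ radialDeriv n r t = w * (t - τ) := by
    intro t ht
    have hx := Real.sqrt_pos.2 (distSq_pos hr' ht)
    refine ⟨a / √(1 + r ^ 2 - 2 * r * t) ^ (n + 2), by positivity, ?_⟩
    have h2 : a * τ = b := by rw [hτ]; field_simp
    rw [radialDeriv, ← ha, ← hb, ← h2]
    ring
  have hone := hasDerivAt_integral_radial (φ := fun _ : Sph n => 1) (integrable_const 1) hr'
  have hdi : Integrable (fun ζ : Sph n => radialDeriv n r (height ζ)) (sigma n) := by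
    simpa using hone.2
  have hprod := (hasDerivAt_integral_radial hχi hr').2
  have heq : ∫ ζ : Sph n, χ (height ζ) * radialDeriv n r (height ζ) ∂(sigma n) =
      ∫ ζ : Sph n, (χ (height ζ) - χ τ) * radialDeriv n r (height ζ) ∂(sigma n) := by
    simp only [sub_mul]
    rw [integral_sub hprod (hdi.const_mul _), integral_const_mul, integral_radialDeriv hr',
      mul_zero, sub_zero]
  have hi : Integrable (fun ζ : Sph n => (χ (height ζ) - χ τ) * radialDeriv n r (height ζ))
      (sigma n) := by
    simp only [sub_mul]
    exact hprod.sub (hdi.const_mul _)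
  have hnn : ∀ t ∈ Icc (-1 : ℝ) 1, 0 ≤ (χ t - χ τ) * radialDeriv n r t := by
    intro t ht
    obtain ⟨w, hw, hwt⟩ := hsign t ht
    rw [hwt]
    rcases le_total t τ with h | h
    · have h1 := hχ ht hτm h
      exact mul_nonneg_of_nonpos_of_nonpos (by linarith)
        (mul_nonpos_of_nonneg_of_nonpos hw.le (by linarith))
    · have h1 := hχ hτm ht h
      exact mul_nonneg (by linarith) (mul_nonneg hw.le (by linarith))
  rw [heq, integral_pos_iff_support_of_nonneg (fun ζ => hnn _ (height_mem ζ)) hi]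
  -- `χ` may be only weakly increasing, as for the sign function. The cap on the side of `s` away
  -- from τ is therefore used: there `χ` has a strict sign, which χ(τ) does not share.
  rcases le_or_gt s τ with hsτ | hsτ
  · have hopen : IsOpen {ζ : Sph n | height ζ < s} := isOpen_lt continuous_height continuous_const
    refine (hopen.measure_pos (sigma n) ⟨-pole n, ?_⟩).trans_le (measure_mono fun ζ hζ => ?_)
    · simp only [mem_ofPred_eq, height_neg_pole]
      exact hs.1
    · have hζ' : height ζ < s := hζ
      obtain ⟨w, hw, hwt⟩ := hsign _ (height_mem ζ)
      have h1 := hχneg _ ⟨(height_mem ζ).1, hζ'⟩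
      have h2 : 0 ≤ χ τ := by
        rw [← hχs]
        exact hχ ⟨hs.1.le, hs.2.le⟩ hτm hsτ
      rw [Function.mem_support, hwt]
      refine mul_ne_zero (by linarith) (mul_ne_zero hw.ne' (by linarith))
  · have hopen : IsOpen {ζ : Sph n | s < height ζ} := isOpen_lt continuous_const continuous_height
    refine (hopen.measure_pos (sigma n) ⟨pole n, ?_⟩).trans_le (measure_mono fun ζ hζ => ?_)
    · simp only [mem_ofPred_eq, height_pole]
      exact hs.2
    · have hζ' : s < height ζ := hζ
      obtain ⟨w, hw, hwt⟩ := hsign _ (height_mem ζ)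
      have h1 := hχpos _ ⟨hζ', (height_mem ζ).2⟩
      have h2 : χ τ < 0 := hχneg τ ⟨hτm.1, hsτ⟩
      rw [Function.mem_support, hwt]
      refine mul_ne_zero (by linarith) (mul_ne_zero hw.ne' (by linarith))

end RadialDerivative

end HarmonicSchwarz

namespace HarmonicSchwarz

open Filter Topology InnerProductSpace Laplacian

/-! ### Smoothness of integrals with a moving singularity -/

section Homogeneous

variable {n : ℕ} [hn : Fact (2 ≤ n)]

omit hn in
theorem measurable_diffQuot (r s : ℝ) : Measurable (diffQuot n r s) := by
  unfold diffQuot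
  refine Measurable.div (Measurable.const_mul ?_ _) (by fun_prop)
  exact Finset.measurable_fun_sum _ fun i _ => by fun_prop

theorem moebius_mem {s u : ℝ} (hs : s ∈ Ioo (-1 : ℝ) 1) (hu : u ∈ Icc (-1 : ℝ) 1) :
    (u + s) / (1 + s * u) ∈ Icc (-1 : ℝ) 1 := by
  have h := one_add_mul_pos hs hu
  rw [mem_Icc, le_div_iff₀ h, div_le_iff₀ h]
  constructor
  · nlinarith [mul_nonneg (by linarith [hs.1] : 0 ≤ 1 + s) (by linarith [hu.1] : 0 ≤ 1 + u)]
  · nlinarith [mul_nonneg (by linarith [hs.2] : 0 ≤ 1 - s) (by linarith [hu.2] : 0 ≤ 1 - u)]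

/-- `W` need not be smooth at 0, and its argument vanishes at the moving height z.2. In the Möbius
variable u one has t − s = u(1 − s²)/(1 + su), so homogeneity extracts a smooth positive factor to
the power `c` and leaves the fixed weight W(u). -/
theorem contDiffOn_integral_homogeneous {W : ℝ → ℝ} {c : ℝ} (hW : Measurable W)
    (hhom : ∀ a, 0 < a → ∀ y, W (a * y) = a ^ c * W y)
    (hi : Integrable (fun ζ : Sph n => W (height ζ)) (sigma n)) :
    ContDiffOn ℝ (⊤ : ℕ∞) (fun z : ℝ × ℝ =>
      ∫ ζ : Sph n, W ((height ζ - z.2) * diffQuot n z.1 z.2 (height ζ)) ∂(sigma n))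
      (Ioo (-1) 1 ×ˢ Ioo (-1) 1) := by
  set H : (ℝ × ℝ) × ℝ → ℝ := fun w => moebiusDensity n w.1.2 w.2 *
    ((1 - w.1.2 ^ 2) / (1 + w.1.2 * w.2) *
      diffQuot n w.1.1 w.1.2 ((w.2 + w.1.2) / (1 + w.1.2 * w.2))) ^ c with hH
  have hpos : ∀ z ∈ Ioo (-1 : ℝ) 1 ×ˢ Ioo (-1 : ℝ) 1, ∀ u ∈ Icc (-1 : ℝ) 1,
      0 < (1 - z.2 ^ 2) / (1 + z.2 * u) *
        diffQuot n z.1 z.2 ((u + z.2) / (1 + z.2 * u)) := by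
    intro z hz u hu
    exact mul_pos (div_pos (one_sub_sq_pos hz.2) (one_add_mul_pos hz.2 hu))
      (diffQuot_pos ne_zero_of_fact hz.1 (Ioo_subset_Icc_self hz.2) (moebius_mem hz.2 hu))
  refine (contDiffOn_integral_smul (isOpen_Ioo.prod isOpen_Ioo) isCompact_Icc continuous_height
    height_mem hi (H := H) ?_).congr ?_
  · intro z hz u hu
    have hne : 1 + z.2 * u ≠ 0 := (one_add_mul_pos hz.2 hu).ne'
    have hd : ContDiffAt ℝ (⊤ : ℕ∞) (fun w : (ℝ × ℝ) × ℝ => 1 + w.1.2 * w.2) (z, u) := by fun_prop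
    have hm : ContDiffAt ℝ (⊤ : ℕ∞) (fun w : (ℝ × ℝ) × ℝ => moebiusDensity n w.1.2 w.2) (z, u) := by
      unfold moebiusDensity
      refine (ContDiffAt.div (ContDiffAt.sqrt (by fun_prop) ?_) hd hne).pow _
      exact (one_sub_sq_pos hz.2).ne'
    refine hm.mul (ContDiffAt.rpow_const_of_ne ?_ (hpos z hz u hu).ne')
    refine ContDiffAt.mul (ContDiffAt.div (by fun_prop) hd hne) ?_
    exact contDiffAt_diffQuot (f := fun w : (ℝ × ℝ) × ℝ => w.1.1) (g := fun w => w.1.2)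
      (by fun_prop) (by fun_prop)
      (ContDiffAt.div (by fun_prop) hd hne) hz.1 (Ioo_subset_Icc_self hz.2) (moebius_mem hz.2 hu)
  · intro z hz
    have hmeas : Measurable fun t => W ((t - z.2) * diffQuot n z.1 z.2 t) := by
      have := measurable_diffQuot (n := n) z.1 z.2
      fun_prop
    rw [integral_height_moebius hz.2 hmeas]
    refine integral_congr_ae (Eventually.of_forall fun ζ => ?_)
    have h1 := one_add_mul_pos hz.2 (height_mem ζ)
    have h2 : ((height ζ + z.2) / (1 + z.2 * height ζ) - z.2) *
        diffQuot n z.1 z.2 ((height ζ + z.2) / (1 + z.2 * height ζ)) =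
        ((1 - z.2 ^ 2) / (1 + z.2 * height ζ) *
          diffQuot n z.1 z.2 ((height ζ + z.2) / (1 + z.2 * height ζ))) * height ζ := by
      have : (height ζ + z.2) / (1 + z.2 * height ζ) - z.2 =
          (1 - z.2 ^ 2) / (1 + z.2 * height ζ) * height ζ := by
        rw [div_sub' h1.ne', div_mul_eq_mul_div]
        ring
      rw [this]
      ring
    simp only [h2, hH, hhom _ (hpos z hz _ (height_mem ζ)), smul_eq_mul]
    ring

theorem integrable_comp_height {W : ℝ → ℝ} (hW : Measurable W) {C : ℝ}
    (hC : ∀ t ∈ Icc (-1 : ℝ) 1, |W t| ≤ C) :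
    Integrable (fun ζ : Sph n => W (height ζ)) (sigma n) :=
  Integrable.of_bound (hW.comp continuous_height.measurable).aestronglyMeasurable C
    (Eventually.of_forall fun ζ => hC _ (height_mem ζ))

theorem integrable_signPow_height {c : ℝ} (hc : 0 ≤ c) :
    Integrable (fun ζ : Sph n => signPow c (height ζ)) (sigma n) :=
  integrable_comp_height (measurable_signPow c) (C := 1 ^ c) fun _ ht =>
    abs_signPow_le_of_abs_le hc (abs_le.2 ht)

end Homogeneous

/-! ### The balanced height and its smooth dependence on the radius -/

section Balance

variable {n : ℕ} [hn : Fact (2 ≤ n)]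

/-- The mean of the signed `α`-th power of the divided Poisson kernel relative to the level at
height `s`. -/
noncomputable def balance (n : ℕ) (α : ℝ) (z : ℝ × ℝ) : ℝ :=
  ∫ ζ : Sph n, signPow α ((height ζ - z.2) * diffQuot n z.1 z.2 (height ζ)) ∂(sigma n)

/-- The mean of the `q`-th power of the divided Poisson kernel relative to the level at
height `s`. -/
noncomputable def energy (n : ℕ) (q : ℝ) (z : ℝ × ℝ) : ℝ :=
  ∫ ζ : Sph n, |(height ζ - z.2) * diffQuot n z.1 z.2 (height ζ)| ^ q ∂(sigma n)

theorem contDiffOn_balance {α : ℝ} (hα : 0 ≤ α) :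
    ContDiffOn ℝ (⊤ : ℕ∞) (balance n α) (Ioo (-1) 1 ×ˢ Ioo (-1) 1) :=
  contDiffOn_integral_homogeneous (c := α) (measurable_signPow α) (fun _ ha y => signPow_mul ha y)
    (integrable_signPow_height hα)

theorem contDiffOn_energy {q : ℝ} (hq : 0 ≤ q) :
    ContDiffOn ℝ (⊤ : ℕ∞) (energy n q) (Ioo (-1) 1 ×ˢ Ioo (-1) 1) := by
  have hm : Measurable fun y : ℝ => |y| ^ q := by fun_prop
  refine contDiffOn_integral_homogeneous (c := q) hm (fun a ha y => ?_)
    (integrable_comp_height hm (C := 1) fun t ht => ?_)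
  · rw [abs_mul, abs_of_pos ha, Real.mul_rpow ha.le (abs_nonneg y)]
  · rw [abs_of_nonneg (by positivity)]
    exact Real.rpow_le_one (abs_nonneg t) (abs_le.2 ht) hq

theorem strictMono_signPow {c : ℝ} (hc : 0 < c) : StrictMono (signPow c) := by
  intro x y hxy
  rcases le_or_gt 0 x with h | h
  · have hy := h.trans_lt hxy
    rcases h.eq_or_lt with rfl | h
    · rw [signPow_zero]
      exact signPow_pos hy
    · rw [signPow_of_pos h, signPow_of_pos hy]
      exact Real.rpow_lt_rpow h.le hxy hc
  · rcases lt_trichotomy y 0 with hy | rfl | hy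
    · rw [signPow_of_neg h, signPow_of_neg hy]
      exact neg_lt_neg (Real.rpow_lt_rpow (by linarith) (by linarith) hc)
    · rw [signPow_zero]
      exact signPow_neg_of_neg h
    · exact (signPow_neg_of_neg h).trans (signPow_pos hy)

theorem continuous_profile_height {r : ℝ} (hr : r ∈ Ioo (-1 : ℝ) 1) :
    Continuous fun ζ : Sph n => profile n r (height ζ) :=
  (continuousOn_profile hr).comp_continuous continuous_height height_mem

theorem balance_eq {α r s : ℝ} (hr : r ∈ Ioo (-1 : ℝ) 1) (hs : s ∈ Icc (-1 : ℝ) 1) :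
    balance n α (r, s) =
      ∫ ζ : Sph n, signPow α (profile n r (height ζ) - profile n r s) ∂(sigma n) := by
  unfold balance
  simp only
  exact integral_congr_ae (Eventually.of_forall fun ζ => by
    simp only [mul_diffQuot_eq hr hs (height_mem ζ)])

theorem integrable_of_continuous {F : Sph n → ℝ} (hF : Continuous F) : Integrable F (sigma n) :=
  hF.integrable_of_hasCompactSupport (HasCompactSupport.of_compactSpace F)

theorem integral_pos_of_continuous {F : Sph n → ℝ} (hF : Continuous F) (h0 : ∀ ζ, 0 ≤ F ζ)
    {ζ : Sph n} (hζ : 0 < F ζ) : 0 < ∫ ζ, F ζ ∂(sigma n) :=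
  hF.integral_pos_of_hasCompactSupport_nonneg_nonzero (HasCompactSupport.of_compactSpace F) h0
    hζ.ne'

theorem strictAntiOn_balance {α r : ℝ} (hα : 0 < α) (hr : r ∈ Ioo (-1 : ℝ) 1) :
    StrictAntiOn (fun s => balance n α (r, s)) (Icc (-1) 1) := by
  intro s hs s' hs' hss
  have hκ := strictMonoOn_profile (n := n) ne_zero_of_fact hr hs hs' hss
  have hc : ∀ b : ℝ, Continuous fun ζ : Sph n => signPow α (profile n r (height ζ) - b) := fun b =>
    (continuous_signPow hα).comp ((continuous_profile_height hr).sub continuous_const)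
  have hlt : ∀ ζ : Sph n, 0 < signPow α (profile n r (height ζ) - profile n r s) -
      signPow α (profile n r (height ζ) - profile n r s') := fun ζ =>
    sub_pos.2 (strictMono_signPow hα (by linarith))
  have := integral_pos_of_continuous ((hc _).fun_sub (hc _)) (fun ζ => (hlt ζ).le) (hlt (pole n))
  simp only [balance_eq hr hs, balance_eq hr hs']
  rw [integral_sub (integrable_of_continuous (hc _)) (integrable_of_continuous (hc _))] at this
  linarith

theorem exists_balance_eq_zero {α r : ℝ} (hα : 0 < α) (hr : r ∈ Ioo (-1 : ℝ) 1) :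
    ∃ s ∈ Ioo (-1 : ℝ) 1, balance n α (r, s) = 0 := by
  have hc : ∀ b : ℝ, Continuous fun ζ : Sph n => signPow α (profile n r (height ζ) - b) := fun b =>
    (continuous_signPow hα).comp ((continuous_profile_height hr).sub continuous_const)
  have hΦ : Continuous fun b : ℝ =>
      ∫ ζ : Sph n, signPow α (profile n r (height ζ) - b) ∂(sigma n) := by
    have h : Continuous (Function.uncurry fun (b : ℝ) (ζ : Sph n) =>
        signPow α (profile n r (height ζ) - b)) :=
      (continuous_signPow hα).comp
        (((continuous_profile_height hr).comp continuous_snd).sub continuous_fst)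
    simpa using continuous_parametric_integral_of_continuous (μ := sigma n) h isCompact_univ
  have hcont : ContinuousOn (fun s => balance n α (r, s)) (Icc (-1) 1) :=
    (hΦ.comp_continuousOn (continuousOn_profile hr)).congr fun s hs => balance_eq hr hs
  have hm1 : (-1 : ℝ) ∈ Icc (-1 : ℝ) 1 := by norm_num
  have h1 : (1 : ℝ) ∈ Icc (-1 : ℝ) 1 := by norm_num
  have hmono := strictMonoOn_profile (n := n) ne_zero_of_fact hr
  have hpos : 0 < balance n α (r, -1) := by
    rw [balance_eq hr hm1]
    refine integral_pos_of_continuous (hc _) (fun ζ => ?_) (ζ := pole n) ?_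
    · rw [← signPow_zero α]
      refine monotone_signPow hα.le (sub_nonneg.2 ?_)
      exact hmono.monotoneOn hm1 (height_mem ζ) (height_mem ζ).1
    · rw [height_pole]
      exact signPow_pos (sub_pos.2 (hmono hm1 h1 (by norm_num)))
  have hneg : balance n α (r, 1) < 0 := by
    rw [balance_eq hr h1, ← neg_pos, ← integral_neg]
    refine integral_pos_of_continuous (hc _).neg (fun ζ => ?_) (ζ := -pole n) ?_
    · rw [← signPow_neg, ← signPow_zero α]
      refine monotone_signPow hα.le ?_
      have := hmono.monotoneOn (height_mem ζ) h1 (height_mem ζ).2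
      linarith
    · rw [height_neg_pole, ← signPow_neg]
      have := hmono hm1 h1 (by norm_num)
      exact signPow_pos (by linarith)
  obtain ⟨s, hs, hs0⟩ := intermediate_value_Ioo' (by norm_num : (-1 : ℝ) ≤ 1) hcont ⟨hneg, hpos⟩
  exact ⟨s, hs, hs0⟩

theorem HasDerivAt.nonneg_of_right_min {F : ℝ → ℝ} {F' x b : ℝ} (h : HasDerivAt F F' x)
    (hb : x < b) (hmin : ∀ y ∈ Ioo x b, F x ≤ F y) : 0 ≤ F' := by
  have h1 := (hasDerivAt_iff_tendsto_slope.1 h).mono_left (nhdsGT_le_nhdsNE x)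
  refine ge_of_tendsto h1 ?_
  filter_upwards [Ioo_mem_nhdsGT hb] with y hy
  rw [slope_def_field]
  exact div_nonneg (sub_nonneg.2 (hmin y hy)) (sub_nonneg.2 hy.1.le)

omit hn in
theorem hasDerivAt_profile {r s : ℝ} (hr : r ∈ Ioo (-1 : ℝ) 1) (hs : s ∈ Ioo (-1 : ℝ) 1) :
    HasDerivAt (profile n r) (diffQuot n r s s) s := by
  have hs' := Ioo_subset_Icc_self hs
  have hd : DifferentiableAt ℝ (fun t => diffQuot n r s t) s :=
    (contDiffAt_diffQuot (f := fun _ : ℝ => r) (g := fun _ => s) (h := fun t => t)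
      contDiffAt_const contDiffAt_const contDiffAt_id hr hs' hs').differentiableAt (by simp)
  have h1 : HasDerivAt (fun t => (t - s) * diffQuot n r s t + profile n r s)
      (1 * diffQuot n r s s + (s - s) * deriv (fun t => diffQuot n r s t) s) s :=
    (((hasDerivAt_id s).sub_const s).fun_mul hd.hasDerivAt).add_const _
  rw [sub_self, zero_mul, add_zero, one_mul] at h1
  refine h1.congr_of_eventuallyEq ?_
  filter_upwards [Ioo_mem_nhds hs.1 hs.2] with t ht
  rw [mul_diffQuot_eq hr hs' (Ioo_subset_Icc_self ht)]
  ring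

/-- Strict decrease in `s` does not exclude a zero derivative, and for α < 1 the integrand has a
singular `s`-derivative. Instead, on a southern cap the integrand drops by at least `w`, a function
with positive derivative at `s`, and elsewhere it does not grow. -/
theorem deriv_balance_neg {α r s b : ℝ} (hα : 0 < α) (hr : r ∈ Ioo (-1 : ℝ) 1)
    (hs : s ∈ Ioo (-1 : ℝ) 1) (hb : HasDerivAt (fun s => balance n α (r, s)) b s) : b < 0 := by
  have hs' := Ioo_subset_Icc_self hs
  have hm1 : (-1 : ℝ) ∈ Icc (-1 : ℝ) 1 := by norm_num
  have hmono := strictMonoOn_profile (n := n) ne_zero_of_fact hr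
  set κ := profile n r with hκ
  -- The midpoint of −1 and `s`. Below this height the distance of the profile to its value at `s`
  -- stays between `m` and `M`, away from the singularity.
  set t₁ := (s - 1) / 2 with ht₁
  have ht1 : t₁ ∈ Ioo (-1) s := by constructor <;> linarith [hs.1]
  have ht1' : t₁ ∈ Icc (-1 : ℝ) 1 := ⟨ht1.1.le, by linarith [ht1.2, hs.2]⟩
  set m := κ s - κ t₁ with hm
  set M := κ s - κ (-1) with hM
  have hm0 : 0 < m := sub_pos.2 (hmono ht1' hs' ht1.2)
  have hM0 : 0 < M := sub_pos.2 (hmono hm1 hs' hs.1)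
  set T : Set (Sph n) := {ζ | height ζ < t₁} with hT
  have hTo : IsOpen T := isOpen_lt continuous_height continuous_const
  have hTpos : 0 < (sigma n).real T := by
    refine ENNReal.toReal_pos (hTo.measure_pos (sigma n) ⟨-pole n, ?_⟩).ne' (measure_ne_top _ _)
    simp only [hT, mem_ofPred_eq, height_neg_pole]
    exact ht1.1
  have hc : ∀ b : ℝ, Continuous fun ζ : Sph n => signPow α (κ (height ζ) - b) := fun b =>
    (continuous_signPow hα).comp ((continuous_profile_height hr).sub continuous_const)
  -- With d = κ x − κ s, this is a lower bound for y^α((1 + d/y)^α − 1) = (y + d)^α − y^α over all y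
  -- in [m, M].
  set w : ℝ → ℝ := fun x => m ^ α * ((1 + (κ x - κ s) / M) ^ α - 1) with hw
  have hκd : HasDerivAt κ (diffQuot n r s s) s := hasDerivAt_profile hr hs
  have hwd : HasDerivAt w (m ^ α * (diffQuot n r s s / M * α)) s := by
    have h1 : HasDerivAt (fun x => 1 + (κ x - κ s) / M) (diffQuot n r s s / M) s :=
      ((hκd.sub_const (κ s)).div_const M).const_add 1
    have h2 := ((h1.rpow_const (p := α) (Or.inl (by simp))).sub_const 1).const_mul (m ^ α)
    refine h2.congr_deriv ?_
    simp
  have hF := (hb.neg).sub (hwd.const_mul ((sigma n).real T))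
  have hmain : ∀ x ∈ Ioo s 1, (sigma n).real T * w x ≤ balance n α (r, s) - balance n α (r, x) := by
    intro x hx
    have hx' : x ∈ Icc (-1 : ℝ) 1 := ⟨by linarith [hs.1, hx.1], hx.2.le⟩
    have hd : 0 < κ x - κ s := sub_pos.2 (hmono hs' hx' hx.1)
    rw [balance_eq hr hs', balance_eq hr hx',
      ← integral_sub (integrable_of_continuous (hc _)) (integrable_of_continuous (hc _)),
      ← smul_eq_mul, ← setIntegral_const, ← integral_indicator hTo.measurableSet]
    refine integral_mono ((integrable_const (w x)).indicator hTo.measurableSet)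
      ((integrable_of_continuous (hc _)).sub (integrable_of_continuous (hc _))) fun ζ => ?_
    by_cases hζ : ζ ∈ T
    · have hζ' : height ζ < t₁ := hζ
      rw [indicator_of_mem hζ]
      have e1 : κ (height ζ) < κ t₁ := hmono (height_mem ζ) ht1' hζ'
      have e2 : κ (-1) ≤ κ (height ζ) := hmono.monotoneOn hm1 (height_mem ζ) (height_mem ζ).1
      set y := κ s - κ (height ζ) with hy
      have hy0 : m ≤ y := by simp only [hm, hy]; linarith
      have hyM : y ≤ M := by simp only [hM, hy]; linarith
      have hypos : 0 < y := hm0.trans_le hy0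
      have e3 : κ (height ζ) - κ s = -y := by rw [hy]; ring
      have e4 : κ (height ζ) - κ x = -(y * (1 + (κ x - κ s) / y)) := by
        field_simp
        rw [hy]; ring
      show w x ≤ signPow α (κ (height ζ) - κ s) - signPow α (κ (height ζ) - κ x)
      rw [e3, e4, signPow_neg, signPow_neg, signPow_of_pos hypos, signPow_of_pos (by positivity),
        Real.mul_rpow hypos.le (by positivity)]
      have e5 : m ^ α ≤ y ^ α := Real.rpow_le_rpow hm0.le hy0 hα.le
      have e6 : (1 + (κ x - κ s) / M) ^ α ≤ (1 + (κ x - κ s) / y) ^ α :=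
        Real.rpow_le_rpow (by positivity) (by gcongr) hα.le
      have e7 : 1 ≤ (1 + (κ x - κ s) / M) ^ α :=
        Real.one_le_rpow (by linarith [div_pos hd hM0]) hα.le
      calc w x ≤ y ^ α * ((1 + (κ x - κ s) / y) ^ α - 1) :=
            mul_le_mul e5 (by linarith) (by linarith) (by positivity)
        _ = _ := by ring
    · rw [indicator_of_notMem hζ]
      exact sub_nonneg.2 (monotone_signPow hα.le (by linarith))
  have h0 := HasDerivAt.nonneg_of_right_min hF hs.2 fun x hx => by
    have h1 := hmain x hx
    have h2 : w s = 0 := by simp [hw]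
    simp only [Pi.sub_apply, Pi.neg_apply]
    rw [h2]
    linarith
  have hdq := diffQuot_pos (n := n) ne_zero_of_fact hr hs' hs'
  have : 0 < (sigma n).real T * (m ^ α * (diffQuot n r s s / M * α)) := by positivity
  linarith

/-- The height of the balanced level of the Poisson kernel with pole at radius `r`. -/
noncomputable def balancedHeight (n : ℕ) (α r : ℝ) : ℝ :=
  Function.invFunOn (fun s => balance n α (r, s)) (Ioo (-1) 1) 0

theorem balancedHeight_spec {α r : ℝ} (hα : 0 < α) (hr : r ∈ Ioo (-1 : ℝ) 1) :
    balancedHeight n α r ∈ Ioo (-1 : ℝ) 1 ∧ balance n α (r, balancedHeight n α r) = 0 := by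
  have h := exists_balance_eq_zero (n := n) hα hr
  exact ⟨Function.invFunOn_mem h, Function.invFunOn_eq h⟩

theorem eq_balancedHeight {α r s : ℝ} (hα : 0 < α) (hr : r ∈ Ioo (-1 : ℝ) 1)
    (hs : s ∈ Ioo (-1 : ℝ) 1) (h : balance n α (r, s) = 0) : s = balancedHeight n α r := by
  obtain ⟨h1, h2⟩ := balancedHeight_spec (n := n) hα hr
  exact (strictAntiOn_balance hα hr).injOn (Ioo_subset_Icc_self hs) (Ioo_subset_Icc_self h1)
    (h.trans h2.symm)

/-- The implicit function theorem applies because the `s`-derivative is negative; uniqueness of the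
balanced height in (−1, 1) identifies it with the local solution. -/
theorem contDiffAt_balancedHeight {α r : ℝ} (hα : 0 < α) (hr : r ∈ Ioo (-1 : ℝ) 1) :
    ContDiffAt ℝ (⊤ : ℕ∞) (balancedHeight n α) r := by
  obtain ⟨h1, h2⟩ := balancedHeight_spec (n := n) hα hr
  set s := balancedHeight n α r with hs
  have hc : ContDiffAt ℝ (⊤ : ℕ∞) (balance n α) (r, s) :=
    (contDiffOn_balance hα.le).contDiffAt ((isOpen_Ioo.prod isOpen_Ioo).mem_nhds ⟨hr, h1⟩)
  have hd : HasFDerivAt (fun s => balance n α (r, s))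
      (fderiv ℝ (balance n α) (r, s) ∘L .inr ℝ ℝ ℝ) s :=
    HasFDerivAt.comp (f := fun s => (r, s)) s
      (hc.differentiableAt (by simp)).hasFDerivAt (hasFDerivAt_prodMk_right r s)
  have hneg := deriv_balance_neg hα hr h1 hd.hasDerivAt
  have hinv : (fderiv ℝ (balance n α) (r, s) ∘L .inr ℝ ℝ ℝ).IsInvertible := by
    refine ⟨ContinuousLinearEquiv.unitsEquivAut ℝ (Units.mk0 _ hneg.ne), ?_⟩
    ext
    simp
  have htop : ((⊤ : ℕ∞) : WithTop ℕ∞) ≠ 0 := by simp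
  have hsm := hc.contDiffAt_implicitFunction htop hinv
  refine hsm.congr_of_eventuallyEq ?_
  have hself := hc.implicitFunction_apply_self htop hinv
  have hev := hc.eventually_apply_implicitFunction htop hinv
  have hmem : ∀ᶠ x in 𝓝 r, hc.implicitFunction htop hinv x ∈ Ioo (-1 : ℝ) 1 := by
    refine hsm.continuousAt.eventually_mem ?_
    rw [hself]
    exact Ioo_mem_nhds h1.1 h1.2
  filter_upwards [hev, hmem, Ioo_mem_nhds hr.1 hr.2] with x hx hx' hxr
  exact (eq_balancedHeight hα hxr hx' (hx.trans h2)).symm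

theorem balancedHeight_zero {α : ℝ} (hα : 0 < α) : balancedHeight n α 0 = 0 := by
  refine (eq_balancedHeight hα (by norm_num) (by norm_num) ?_).symm
  refine integral_eq_zero_of_odd fun ζ => ?_
  simp only [diffQuot_zero, sub_zero, height_neg, neg_mul, signPow_neg]

theorem energy_pos {q r s : ℝ} (hq : 0 < q) (hr : r ∈ Ioo (-1 : ℝ) 1)
    (hs : s ∈ Ioo (-1 : ℝ) 1) : 0 < energy n q (r, s) := by
  have hs' := Ioo_subset_Icc_self hs
  have h : energy n q (r, s) =
      ∫ ζ : Sph n, |profile n r (height ζ) - profile n r s| ^ q ∂(sigma n) := by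
    unfold energy
    simp only
    exact integral_congr_ae (Eventually.of_forall fun ζ => by
      simp only [mul_diffQuot_eq hr hs' (height_mem ζ)])
  rw [h]
  have hc := continuous_profile_height (n := n) hr
  refine integral_pos_of_continuous ?_ (fun ζ => by positivity) (ζ := pole n) ?_
  · exact ((hc.sub continuous_const).abs).rpow_const fun _ => Or.inr hq.le
  · have := strictMonoOn_profile (n := n) ne_zero_of_fact hr hs' (by norm_num) hs.2
    rw [height_pole]
    have : 0 < |profile n r 1 - profile n r s| := abs_pos.2 (by linarith)
    positivity

end Balance

end HarmonicSchwarz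

namespace HarmonicSchwarz

open Filter Topology InnerProductSpace Laplacian

/-! ### Unboundedness of `g` for finite exponents -/

section Unbounded

variable {n : ℕ} [hn : Fact (2 ≤ n)]

theorem g_zero (p : ℝ≥0∞) : g n p 0 = 0 := by
  have h := g_le (n := n) (p := p) (x := 0) (by simp) (a := 1) zero_le_one
  have h1 : (fun ζ : Sph n => poissonKernel n 0 ζ - 1) = 0 := by
    ext ζ
    simp [poissonKernel]
  rw [h1, eLpNorm_zero, norm_zero] at h
  exact le_antisymm (by simpa using h) (g_nonneg _ _)

omit hn in
theorem continuousOn_radial {r : ℝ} (hr : r ∈ Ioo (-1 : ℝ) 1) :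
    ContinuousOn (radial n r) (Icc (-1) 1) := fun _ ht =>
  (contDiffAt_radial (f := fun _ : ℝ => r) (g := fun t => t) contDiffAt_const contDiffAt_id
    (distSq_pos hr ht)).continuousAt.continuousWithinAt

theorem continuous_radial_height {r : ℝ} (hr : r ∈ Ioo (-1 : ℝ) 1) :
    Continuous fun ζ : Sph n => radial n r (height ζ) :=
  (continuousOn_radial hr).comp_continuous continuous_height height_mem

theorem norm_smul_north {r : ℝ} (hr : 0 ≤ r) : ‖r • north n‖ = r := by
  rw [norm_smul, norm_north, mul_one, Real.norm_of_nonneg hr]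

theorem poissonIntegral_smul_north (φ : Sph n → ℝ) (r : ℝ) :
    poissonIntegral n φ (r • north n) = ∫ ζ, φ ζ • radial n r (height ζ) ∂(sigma n) :=
  integral_congr_ae (Eventually.of_forall fun ζ => by
    simp only [← poissonRadial_eq, poissonRadial, smul_eq_mul, mul_comm])

theorem poissonIntegral_smul_north_le {p : ℝ≥0∞} (hp : 1 ≤ p) {φ : Sph n → ℝ}
    (hφ : MemLp φ p (sigma n)) (hφ0 : ∫ ζ, φ ζ ∂(sigma n) = 0) {r : ℝ} (hr : r ∈ Ico (0 : ℝ) 1) :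
    poissonIntegral n φ (r • north n) ≤ g n p r * (eLpNorm φ p (sigma n)).toReal := by
  have h := norm_integral_poissonKernel_smul_le hp
    (smul_north_mem_ball (n := n) (r := r) ⟨by linarith [hr.1], hr.2⟩) hφ hφ0
  rw [norm_smul_north hr.1] at h
  exact (le_abs_self _).trans h

/-- The caps shrink to the level set of height 1, which is null. -/
theorem tendsto_sigma_cap :
    Tendsto (fun k : ℕ => (sigma n).real {ζ : Sph n | 1 - 1 / ((k : ℝ) + 1) < height ζ})
      atTop (𝓝 0) := by
  have h := tendsto_measure_iInter_atTop (μ := sigma n)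
    (s := fun k : ℕ => {ζ : Sph n | 1 - 1 / ((k : ℝ) + 1) < height ζ})
    (fun k => (isOpen_lt continuous_const continuous_height).measurableSet.nullMeasurableSet)
    (fun i j hij ζ hζ => lt_of_le_of_lt
      (sub_le_sub_left (Nat.one_div_le_one_div (α := ℝ) hij) 1) hζ)
    ⟨0, measure_ne_top _ _⟩
  have h0 : sigma n (⋂ k : ℕ, {ζ : Sph n | 1 - 1 / ((k : ℝ) + 1) < height ζ}) = 0 := by
    refine measure_mono_null (fun ζ hζ => ?_) (sigma_height_eq (n := n) 1)
    refine le_antisymm (height_mem ζ).2 (le_of_forall_pos_le_add fun ε hε => ?_)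
    obtain ⟨k, hk⟩ := exists_nat_one_div_lt hε
    have := mem_iInter.1 hζ k
    simp only [mem_ofPred_eq] at this
    linarith
  rw [h0] at h
  exact (ENNReal.tendsto_toReal ENNReal.zero_ne_top).comp h

/-- Test duality against the indicator of a polar cap minus its mean. Since p < ∞ its norm is small
for a small cap, while for r near 1 almost all the mass of P_r lies in the cap and the Poisson
integral stays at least 1/2. -/
theorem exists_le_g {p : ℝ≥0∞} (hp : 1 ≤ p) (hpt : p ≠ ⊤) (M : ℝ) :
    ∃ r ∈ Ico (0 : ℝ) 1, M ≤ g n p r := by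
  have hp0 : p ≠ 0 := (zero_lt_one.trans_le hp).ne'
  have hpr : 0 < p.toReal := ENNReal.toReal_pos hp0 hpt
  -- With this value, 1/2 ≤ g ε means |M| + 1 ≤ g.
  set ε : ℝ := 1 / (2 * (|M| + 1)) with hε
  have hM : 0 < |M| + 1 := by positivity
  have hε0 : 0 < ε := by positivity
  have hm := tendsto_sigma_cap (n := n)
  have hm2 : Tendsto (fun k : ℕ =>
      (sigma n).real {ζ : Sph n | 1 - 1 / ((k : ℝ) + 1) < height ζ} ^ (1 / p.toReal) +
      (sigma n).real {ζ : Sph n | 1 - 1 / ((k : ℝ) + 1) < height ζ}) atTop (𝓝 0) := by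
    have h1 : Continuous fun x : ℝ => x ^ (1 / p.toReal) + x :=
      (Real.continuous_rpow_const (by positivity)).add continuous_id
    have h2 := (h1.tendsto 0).comp hm
    rwa [Real.zero_rpow (by positivity), add_zero] at h2
  obtain ⟨k, hk1, hk2⟩ := ((hm.eventually_lt_const (show (0 : ℝ) < 1 / 4 by norm_num)).and
    (hm2.eventually_lt_const hε0)).exists
  set c : ℝ := 1 - 1 / ((k : ℝ) + 1) with hc
  have hc1 : c < 1 := by
    have : (0 : ℝ) < 1 / ((k : ℝ) + 1) := by positivity
    linarith
  have hc0 : 0 ≤ c := by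
    have : 1 / ((k : ℝ) + 1) ≤ 1 := (div_le_one (by positivity)).2 (by linarith [k.cast_nonneg (α := ℝ)])
    linarith
  set T : Set (Sph n) := {ζ | c < height ζ} with hT
  have hTm : MeasurableSet T := (isOpen_lt continuous_const continuous_height).measurableSet
  set m := (sigma n).real T with hmdef
  have hcm : c ∈ Icc (-1 : ℝ) 1 := ⟨by linarith, hc1.le⟩
  have hlim : Tendsto (fun r => radial n r c) (𝓝[<] 1) (𝓝 0) := by
    have h1 : ContinuousAt (fun r => radial n r c) 1 :=
      (contDiffAt_radial (f := fun r : ℝ => r) (g := fun _ => c) contDiffAt_id contDiffAt_const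
        (by nlinarith)).continuousAt
    have h2 : radial n 1 c = 0 := by simp [radial]
    have h3 := h1.tendsto
    simp only [h2] at h3
    exact h3.mono_left nhdsWithin_le_nhds
  obtain ⟨r, hr, hr1⟩ := ((hlim.eventually_lt_const (show (0 : ℝ) < 1 / 4 by norm_num)).and
    (Ioo_mem_nhdsLT zero_lt_one)).exists
  have hr' : r ∈ Ioo (-1 : ℝ) 1 := ⟨by linarith [hr1.1], hr1.2⟩
  set ind : Sph n → ℝ := T.indicator fun _ => 1 with hind
  have hindm : MemLp ind p (sigma n) := memLp_indicator_const p hTm 1 (Or.inr (measure_ne_top _ _))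
  have hconst : MemLp (fun _ : Sph n => m) p (sigma n) := memLp_const m
  have hm0 : 0 ≤ m := measureReal_nonneg
  set φ : Sph n → ℝ := ind - fun _ => m with hφ
  have hφm : MemLp φ p (sigma n) := hindm.sub hconst
  have hii : Integrable ind (sigma n) := hindm.integrable hp
  have hφ0 : ∫ ζ, φ ζ ∂(sigma n) = 0 := by
    rw [hφ, integral_sub' hii (integrable_const m), hind, integral_indicator_const _ hTm]
    simp [hmdef]
  have hnorm : (eLpNorm φ p (sigma n)).toReal ≤ ε := by
    have h1 : (eLpNorm φ p (sigma n)).toReal ≤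
        (eLpNorm ind p (sigma n)).toReal + (eLpNorm (fun _ : Sph n => m) p (sigma n)).toReal := by
      rw [← ENNReal.toReal_add hindm.eLpNorm_ne_top hconst.eLpNorm_ne_top]
      exact ENNReal.toReal_mono (ENNReal.add_ne_top.2 ⟨hindm.eLpNorm_ne_top, hconst.eLpNorm_ne_top⟩)
        (eLpNorm_sub_le hindm.1 hconst.1 hp)
    have h2 : (eLpNorm ind p (sigma n)).toReal = m ^ (1 / p.toReal) := by
      rw [hind, eLpNorm_indicator_const hTm hp0 hpt, enorm_one, one_mul, ← ENNReal.toReal_rpow]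
      rfl
    have h3 : (eLpNorm (fun _ : Sph n => m) p (sigma n)).toReal = m := by
      rw [eLpNorm_const m hp0 (IsProbabilityMeasure.ne_zero _), measure_univ, ENNReal.one_rpow,
        mul_one, toReal_enorm, Real.norm_of_nonneg hm0]
    rw [h2, h3] at h1
    exact h1.trans hk2.le
  have hri := integrable_of_continuous (continuous_radial_height (n := n) hr')
  have hmi : Integrable (fun ζ : Sph n => m * radial n r (height ζ)) (sigma n) := hri.const_mul m
  have hci : Integrable (fun ζ : Sph n => radial n r (height ζ) - radial n r c) (sigma n) :=
    hri.sub (integrable_const _)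
  have hlow : 1 / 2 ≤ poissonIntegral n φ (r • north n) := by
    have hφi : Integrable (fun ζ => φ ζ • radial n r (height ζ)) (sigma n) :=
      integrable_smul_comp_of_continuousOn isCompact_Icc continuous_height height_mem
        (hφm.integrable hp) (continuousOn_radial hr')
    -- Outside the cap P_r is at most its value at height c, by monotonicity; inside, that value is
    -- positive. The Poisson integral is therefore at least 1 − P_r(c) − m, with both subtracted
    -- terms below 1/4.
    have h1 : ∫ ζ : Sph n, (radial n r (height ζ) - radial n r c - m * radial n r (height ζ)) ∂(sigma n)
        ≤ ∫ ζ : Sph n, φ ζ • radial n r (height ζ) ∂(sigma n) := by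
      refine integral_mono (hci.sub hmi) hφi fun ζ => ?_
      simp only [hφ, hind, Pi.sub_apply, smul_eq_mul]
      by_cases hζ : ζ ∈ T
      · rw [indicator_of_mem hζ]
        have := radial_pos (n := n) hr' hcm
        linarith
      · rw [indicator_of_notMem hζ]
        have := (strictMonoOn_radial (n := n) ne_zero_of_fact hr1).monotoneOn (height_mem ζ) hcm
          (not_lt.1 hζ)
        linarith
    rw [integral_sub hci hmi,
      integral_sub hri (integrable_const _), integral_const_mul, integral_radial hr',
      integral_const, probReal_univ, one_smul] at h1
    rw [poissonIntegral_smul_north]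
    linarith
  have hup := poissonIntegral_smul_north_le hp hφm hφ0 ⟨hr1.1.le, hr1.2⟩
  refine ⟨r, ⟨hr1.1.le, hr1.2⟩, ?_⟩
  have h2 : 1 / 2 ≤ g n p r * ε :=
    hlow.trans (hup.trans (mul_le_mul_of_nonneg_left hnorm (g_nonneg _ _)))
  rw [hε, mul_one_div, div_le_div_iff₀ (by positivity) (by positivity)] at h2
  linarith [le_abs_self M]

theorem isIncreasingDiffeo_g {p : ℝ≥0∞} (hp : 1 ≤ p) (hpt : p ≠ ⊤) {G : ℝ → ℝ}
    (hG : ContDiffOn ℝ (⊤ : ℕ∞) G (Ioo (-1) 1)) (hpos : ∀ r ∈ Ico (0 : ℝ) 1, 0 < deriv G r)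
    (hg : EqOn (g n p) G (Ico 0 1)) : IsIncreasingDiffeo (g n p) (Ico 0 1) (Ici 0) := by
  have hd : ContinuousOn (deriv G) (Ioo (-1) 1) :=
    hG.continuousOn_deriv_of_isOpen isOpen_Ioo (by exact_mod_cast le_top)
  -- Continuity of the derivative extends positivity slightly to the left of 0, giving the open
  -- interval around [0, 1) on which the inverse function argument runs.
  have h0 : ∀ᶠ r in 𝓝 (0 : ℝ), 0 < deriv G r :=
    (hd.continuousAt (Ioo_mem_nhds (by norm_num) (by norm_num))).eventually_const_lt
      (hpos 0 ⟨le_rfl, one_pos⟩)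
  obtain ⟨δ, hδ, hδpos⟩ := Metric.eventually_nhds_iff.1 h0
  set δ' := min δ 1 with hδ'
  have hδ'0 : 0 < δ' := lt_min hδ one_pos
  have hsub : Ioo (-δ') 1 ⊆ Ioo (-1) 1 :=
    Ioo_subset_Ioo_left (by linarith [min_le_right δ 1])
  have hcont : ContinuousOn (g n p) (Ico 0 1) :=
    (hG.continuousOn.mono fun r hr => ⟨by linarith [hr.1], hr.2⟩).congr hg
  refine isIncreasingDiffeo_of_deriv_pos (hG.mono hsub) (fun r hr => ?_)
    (fun r hr => ⟨by linarith [hr.1], hr.2⟩) hg ?_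
  · rcases lt_or_ge r 0 with h | h
    · refine hδpos ?_
      rw [Real.dist_eq, sub_zero, abs_of_neg h]
      linarith [hr.1, min_le_left δ 1]
    · exact hpos r ⟨h, hr.2⟩
  · rw [← hg.image_eq]
    refine Subset.antisymm (image_subset_iff.2 fun r _ => g_nonneg p r) fun y hy => ?_
    obtain ⟨r, hr, hyr⟩ := exists_le_g (n := n) hp hpt y
    have h1 : Icc 0 r ⊆ Ico (0 : ℝ) 1 := Icc_subset_Ico_right hr.2
    obtain ⟨t, ht, hty⟩ := intermediate_value_Icc hr.1 (hcont.mono h1)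
      (show y ∈ Icc (g n p 0) (g n p r) from ⟨by rw [g_zero]; exact hy, hyr⟩)
    exact ⟨t, h1 ht, hty⟩

end Unbounded

/-! ### Extremal functions, positivity of the derivative and the gradient bound -/

section BalancedLevel

variable {n m : ℕ} [hn : Fact (2 ≤ n)]

theorem integral_comp_poissonKernel {x : EuclideanSpace ℝ (Fin n)} (F : ℝ → ℝ) :
    ∫ ζ, F (poissonKernel n x ζ) ∂(sigma n) =
      ∫ ζ : Sph n, F (radial n ‖x‖ (height ζ)) ∂(sigma n) := by
  obtain ⟨A, hA⟩ : ∃ A : EuclideanSpace ℝ (Fin n) ≃ₗᵢ[ℝ] EuclideanSpace ℝ (Fin n),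
      A x = ‖x‖ • north n := exists_isometry_of_norm_eq (by simp [norm_smul, norm_north])
  rw [← integral_rotate A fun ζ => F (radial n ‖x‖ (height ζ))]
  simp only [← poissonRadial_eq, poissonRadial, ← hA, poissonKernel_rotate]

theorem integral_abs_radial_sub_pos {q r s : ℝ} (hq : 0 < q) (hr : r ∈ Ioo (0 : ℝ) 1)
    (hs : s ∈ Ioo (-1 : ℝ) 1) :
    0 < ∫ ζ : Sph n, |radial n r (height ζ) - radial n r s| ^ q ∂(sigma n) := by
  have hr' : r ∈ Ioo (-1 : ℝ) 1 := ⟨by linarith [hr.1], hr.2⟩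
  refine integral_pos_of_continuous ?_ (fun ζ => by positivity) (ζ := pole n) ?_
  · exact (((continuous_radial_height hr').sub continuous_const).abs).rpow_const
      fun _ => Or.inr hq.le
  · have := strictMonoOn_radial (n := n) ne_zero_of_fact hr (Ioo_subset_Icc_self hs)
      (by norm_num) hs.2
    rw [height_pole]
    have : 0 < |radial n r 1 - radial n r s| := abs_pos.2 (by linarith)
    positivity

/-- The signed power of the Poisson kernel relative to its balanced level is extremal. -/
theorem balanced_spec {p : ℝ≥0∞} (hp : 1 ≤ p) (hp1 : p ≠ 1) {x : EuclideanSpace ℝ (Fin n)}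
    (hx : x ∈ Metric.ball (0 : EuclideanSpace ℝ (Fin n)) 1) (hx0 : x ≠ 0) {s : ℝ}
    (hs : s ∈ Ioo (-1 : ℝ) 1)
    (hbal : ∫ ζ : Sph n, signPow (p.conjExponent.toReal - 1)
      (radial n ‖x‖ (height ζ) - radial n ‖x‖ s) ∂(sigma n) = 0) :
    ∃ φ : Sph n → ℝ, φ = (fun ζ => signPow (p.conjExponent.toReal - 1)
        (poissonKernel n x ζ - radial n ‖x‖ s)) ∧ Measurable φ ∧ MemLp φ p (sigma n) ∧
      ∫ ζ, φ ζ ∂(sigma n) = 0 ∧ 0 < poissonIntegral n φ x ∧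
      poissonIntegral n φ x = g n p ‖x‖ * (eLpNorm φ p (sigma n)).toReal ∧
      g n p ‖x‖ = (∫ ζ : Sph n, |radial n ‖x‖ (height ζ) - radial n ‖x‖ s| ^
        p.conjExponent.toReal ∂(sigma n)) ^ (p.conjExponent.toReal)⁻¹ := by
  have hq := one_le_toReal_conjExponent hp hp1
  have hr : ‖x‖ ∈ Ioo (0 : ℝ) 1 := ⟨norm_pos_iff.2 hx0, mem_ball_zero_iff.1 hx⟩
  have hr' : ‖x‖ ∈ Ioo (-1 : ℝ) 1 := ⟨by linarith [hr.1], hr.2⟩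
  have ha := radial_pos (n := n) hr' (Ioo_subset_Icc_self hs)
  have hbal' : ∫ ζ, signPow (p.conjExponent.toReal - 1)
      (poissonKernel n x ζ - radial n ‖x‖ s) ∂(sigma n) = 0 :=
    (integral_comp_poissonKernel fun y => signPow _ (y - radial n ‖x‖ s)).trans hbal
  have hE := integral_comp_poissonKernel (x := x) fun y =>
    |y - radial n ‖x‖ s| ^ p.conjExponent.toReal
  have hpos := integral_abs_radial_sub_pos (n := n) (by linarith : 0 < p.conjExponent.toReal) hr hs
  rw [← hE] at hpos ⊢
  obtain ⟨h1, h2, h3, h4⟩ := g_eq_of_balanced hp hp1 hx ha.le hbal' hpos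
  refine ⟨_, rfl, ?_, h1, hbal', by rwa [h3], h4, h2⟩
  exact (measurable_signPow _).comp ((continuous_poissonKernel hx).measurable.sub_const _)

/-- The extremal `φ` at radius `r` is a competitor at nearby radii ρ, so G(ρ)‖φ‖_p − ∫ φ P_ρ is
nonnegative there and zero at `r`. Its derivative vanishes at `r`, which gives G′(r)‖φ‖_p = ∫ φ ∂_r
P_r, and `φ` is an increasing function of the height. -/
theorem deriv_pos_of_balanced {p : ℝ≥0∞} (hp : 1 ≤ p) (hp1 : p ≠ 1) {r s : ℝ}
    (hr : r ∈ Ioo (0 : ℝ) 1) (hs : s ∈ Ioo (-1 : ℝ) 1)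
    (hbal : ∫ ζ : Sph n, signPow (p.conjExponent.toReal - 1)
      (radial n r (height ζ) - radial n r s) ∂(sigma n) = 0) {G : ℝ → ℝ}
    (hG : DifferentiableAt ℝ G r) (hg : EqOn (g n p) G (Ico 0 1)) : 0 < deriv G r := by
  have hr' : r ∈ Ioo (-1 : ℝ) 1 := ⟨by linarith [hr.1], hr.2⟩
  have hs' := Ioo_subset_Icc_self hs
  have hnorm : ‖r • north n‖ = r := norm_smul_north hr.1.le
  have hx0 : r • north n ≠ 0 := norm_pos_iff.1 (by rw [hnorm]; exact hr.1)
  obtain ⟨φ, hφ, -, hφp, hφ0, hpos, heq, -⟩ := balanced_spec hp hp1 (smul_north_mem_ball hr') hx0 hs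
    (by rw [hnorm]; exact hbal)
  rw [hnorm] at hφ heq
  have hφi := hφp.integrable hp
  set N := (eLpNorm φ p (sigma n)).toReal with hN
  have hN0 : 0 < N := by
    refine lt_of_le_of_ne ENNReal.toReal_nonneg fun h => ?_
    rw [← h, mul_zero] at heq
    linarith
  have hq := one_le_toReal_conjExponent hp hp1
  set α := p.conjExponent.toReal - 1 with hα
  set χ : ℝ → ℝ := fun t => signPow α (radial n r t - radial n r s) with hχ
  have hφχ : φ = fun ζ => χ (height ζ) := by
    rw [hφ]
    ext ζ
    simp only [hχ, ← poissonRadial_eq, poissonRadial]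
  have hmono := strictMonoOn_radial (n := n) ne_zero_of_fact hr
  have hL : 0 < ∫ ζ : Sph n, χ (height ζ) * radialDeriv n r (height ζ) ∂(sigma n) := by
    refine integral_mono_mul_radialDeriv_pos hr hs ?_ ?_ ?_ ?_ (by rwa [hφχ] at hφi)
    · intro t ht u hu htu
      exact monotone_signPow (by linarith) (sub_le_sub_right (hmono.monotoneOn ht hu htu) _)
    · intro t ht
      exact signPow_pos (sub_pos.2 (hmono hs' ⟨by linarith [hs.1, ht.1], ht.2⟩ ht.1))
    · intro t ht
      exact signPow_neg_of_neg (sub_neg.2 (hmono ⟨ht.1, by linarith [hs.2, ht.2]⟩ hs' ht.2))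
    · simp only [hχ, sub_self, signPow_zero]
  have hLd := (hasDerivAt_integral_radial hφi hr').1
  have hmin : IsLocalMin (fun ρ => G ρ * N - ∫ ζ, φ ζ • radial n ρ (height ζ) ∂(sigma n)) r := by
    filter_upwards [Ioo_mem_nhds hr.1 hr.2] with ρ hρ
    have h1 := poissonIntegral_smul_north_le hp hφp hφ0 ⟨hρ.1.le, hρ.2⟩
    rw [poissonIntegral_smul_north, hg ⟨hρ.1.le, hρ.2⟩] at h1
    rw [poissonIntegral_smul_north, hg ⟨hr.1.le, hr.2⟩] at heq
    rw [heq, sub_self]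
    exact sub_nonneg.2 h1
  have hz := hmin.hasDerivAt_eq_zero ((hG.hasDerivAt.mul_const N).sub hLd)
  simp only [hφχ] at hz
  have : 0 < deriv G r * N := by linarith
  exact pos_of_mul_pos_left this hN0.le

omit hn in
theorem radialDeriv_zero (t : ℝ) : radialDeriv n 0 t = n * t := by
  simp [radialDeriv]

/-- Divide ‖f(tv)‖ ≤ G(t)‖f‖ by t and let t decrease to 0, for each unit vector v. -/
theorem norm_fderiv_zero_le {p : ℝ≥0∞} (hp : 1 ≤ p) {C : ℝ} {G : ℝ → ℝ} (hG : HasDerivAt G C 0)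
    (hg : EqOn (g n p) G (Ico 0 1))
    {f : EuclideanSpace ℝ (Fin n) → EuclideanSpace ℝ (Fin m)} (hf : MemHardy p f) (hf0 : f 0 = 0) :
    ‖fderiv ℝ f 0‖ ≤ C * hardyNorm p f := by
  have hG0 : G 0 = 0 := by rw [← hg ⟨le_rfl, one_pos⟩, g_zero]
  have hC : 0 ≤ C := HasDerivAt.nonneg_of_right_min hG one_pos fun r hr => by
    rw [hG0, ← hg ⟨hr.1.le, hr.2⟩]
    exact g_nonneg p r
  have hfd : HasFDerivAt f (fderiv ℝ f 0) 0 :=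
    ((hf.harmonic 0 (by simp)).1.differentiableAt (by simp)).hasFDerivAt
  have hN : 0 ≤ hardyNorm p f := ENNReal.toReal_nonneg
  refine ContinuousLinearMap.opNorm_le_of_unit_norm (by positivity) fun v hv => ?_
  have hline : HasDerivAt (fun t : ℝ => f (t • v)) (fderiv ℝ f 0 v) 0 := by
    have h1 : HasDerivAt (fun t : ℝ => t • v) v 0 := by
      simpa using (hasDerivAt_id (0 : ℝ)).smul_const v
    exact HasFDerivAt.comp_hasDerivAt (0 : ℝ) (by simpa using hfd) h1
  have h1 := ((hasDerivAt_iff_tendsto_slope.1 hline).mono_left (nhdsGT_le_nhdsNE 0)).norm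
  have h2 := ((hasDerivAt_iff_tendsto_slope.1 hG).mono_left (nhdsGT_le_nhdsNE 0)).mul_const
    (hardyNorm p f)
  refine le_of_tendsto_of_tendsto h1 h2 ?_
  filter_upwards [Ioo_mem_nhdsGT one_pos] with t ht
  have hb : ‖t • v‖ = t := by rw [norm_smul, hv, mul_one, Real.norm_of_nonneg ht.1.le]
  have h3 := norm_le_g_mul_hardyNorm hp hf hf0 (x := t • v)
    (by rw [mem_ball_zero_iff, hb]; exact ht.2)
  rw [hb, hg ⟨ht.1.le, ht.2⟩] at h3
  rw [slope_def_module, slope_def_field, sub_zero, zero_smul, hf0, hG0, sub_zero, sub_zero,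
    norm_smul, norm_inv, Real.norm_of_nonneg ht.1.le, inv_mul_eq_div, div_mul_eq_mul_div]
  exact div_le_div_of_nonneg_right h3 ht.1.le

theorem gradConst_eq {p : ℝ≥0∞} (hp1 : p ≠ 1) :
    gradConst n p = n * (∫ ζ : Sph n, |height ζ| ^ p.conjExponent.toReal ∂(sigma n)) ^
      (p.conjExponent.toReal)⁻¹ := by
  rw [gradConst, if_neg hp1, integral_abs_height_rpow ENNReal.toReal_nonneg, one_div]

theorem norm_le_norm_fderiv_zero
    {f : EuclideanSpace ℝ (Fin n) → EuclideanSpace ℝ (Fin m)}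
    (hf : HarmonicOnNhd f (Metric.ball 0 1)) {v : EuclideanSpace ℝ (Fin m)}
    (hd : HasDerivAt (fun t : ℝ => f (t • north n)) v 0) : ‖v‖ ≤ ‖fderiv ℝ f 0‖ := by
  have hfd : HasFDerivAt f (fderiv ℝ f 0) 0 :=
    ((hf 0 (by simp)).1.differentiableAt (by simp)).hasFDerivAt
  have h1 : HasDerivAt (fun t : ℝ => t • north n) (north n) 0 := by
    simpa using (hasDerivAt_id (0 : ℝ)).smul_const (north n)
  have hd2 : HasDerivAt (fun t : ℝ => f (t • north n)) (fderiv ℝ f 0 (north n)) 0 :=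
    HasFDerivAt.comp_hasDerivAt (0 : ℝ) (by simpa using hfd) h1
  have h3 := (fderiv ℝ f 0).le_opNorm (north n)
  rwa [hd2.unique hd, norm_north, mul_one] at h3

theorem integral_abs_height_rpow_pos {q : ℝ} (hq : 0 < q) :
    0 < ∫ ζ : Sph n, |height ζ| ^ q ∂(sigma n) := by
  refine integral_pos_of_continuous (continuous_height.abs.rpow_const fun _ => Or.inr hq.le)
    (fun ζ => by positivity) (ζ := pole n) ?_
  rw [height_pole]
  norm_num

theorem gradConst_pos {p : ℝ≥0∞} (hp : 1 ≤ p) : 0 < gradConst n p := by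
  have hnpos : (0 : ℝ) < n := Nat.cast_pos.2 (Nat.pos_of_ne_zero ne_zero_of_fact)
  by_cases hp1 : p = 1
  · rwa [gradConst, if_pos hp1]
  · have hq := one_le_toReal_conjExponent hp hp1
    have := integral_abs_height_rpow_pos (n := n) (zero_lt_one.trans_le hq)
    rw [gradConst_eq hp1]
    positivity

/-- To first order in r the kernel is 1 + r n ζ_n, so the natural boundary function is the odd power
of order q − 1 of the height. Its Poisson integral has derivative n ∫ |ζ_n|^q along the axis, and
the equality case of Hölder compares this with the Hardy norm. -/
theorem exists_extremal_fderiv {p : ℝ≥0∞} (hp : 1 ≤ p) (hp1 : p ≠ 1)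
    (hle : ∀ f : EuclideanSpace ℝ (Fin n) → EuclideanSpace ℝ (Fin m), MemHardy p f → f 0 = 0 →
      ‖fderiv ℝ f 0‖ ≤ gradConst n p * hardyNorm p f)
    {e : EuclideanSpace ℝ (Fin m)} (he : ‖e‖ = 1) :
    ∃ f : EuclideanSpace ℝ (Fin n) → EuclideanSpace ℝ (Fin m),
      MemHardy p f ∧ f 0 = 0 ∧ 0 < hardyNorm p f ∧
        ‖fderiv ℝ f 0‖ = gradConst n p * hardyNorm p f := by
  have hq := one_le_toReal_conjExponent hp hp1
  set q := p.conjExponent.toReal with hqdef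
  set φ : Sph n → ℝ := fun ζ => signPow (q - 1) (height ζ) with hφ
  have hφm : Measurable φ := (measurable_signPow _).comp continuous_height.measurable
  have hbd : ∀ ζ : Sph n, |height ζ| ≤ 1 := fun ζ => abs_le.2 (height_mem ζ)
  have hφp : MemLp φ p (sigma n) := MemLp.of_bound hφm.aestronglyMeasurable (1 ^ (q - 1))
    (Eventually.of_forall fun ζ => abs_signPow_le_of_abs_le (by linarith) (hbd ζ))
  have hφi := hφp.integrable hp
  have hφ0 : ∫ ζ, φ ζ ∂(sigma n) = 0 :=
    integral_eq_zero_of_odd fun ζ => by simp only [hφ, height_neg, signPow_neg]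
  set I := ∫ ζ : Sph n, |height ζ| ^ q ∂(sigma n) with hI
  have hIpos : 0 < I := integral_abs_height_rpow_pos (by linarith)
  set f : EuclideanSpace ℝ (Fin n) → EuclideanSpace ℝ (Fin m) := fun x => poissonIntegral n φ x • e
    with hf
  have hmem : MemHardy p f := memHardy_poissonIntegral_smul hφm hp hφp he
  have h0 : f 0 = 0 := by simp only [hf, poissonIntegral_zero, hφ0, zero_smul]
  have hnorm : hardyNorm p f ≤ (eLpNorm φ p (sigma n)).toReal :=
    ENNReal.toReal_mono hφp.2.ne (hardyENorm_poissonIntegral_smul_le hφm hp he)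
  have hprod := toReal_eLpNorm_signPow_mul_le (μ := sigma n) continuous_height.measurable hbd hp hp1
  rw [toReal_eLpNorm_of_bounded continuous_height.measurable hbd (one_le_conjExponent p)
    (conjExponent_ne_top hp hp1), ← hqdef, ← hI] at hprod
  have hup := hle f hmem h0
  have hlow : n * I ≤ ‖fderiv ℝ f 0‖ := by
    have hd := (hasDerivAt_integral_radial hφi (r := 0) (by norm_num)).1
    have hd1 : HasDerivAt (fun t : ℝ => f (t • north n)) ((n * I) • e) 0 := by
      have h1 := hd.smul_const e
      simp only [← poissonIntegral_smul_north] at h1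
      refine h1.congr_deriv ?_
      congr 1
      rw [hI, ← integral_const_mul]
      refine integral_congr_ae (Eventually.of_forall fun ζ => ?_)
      have := mul_signPow (c := q - 1) (by linarith) (height ζ)
      rw [sub_add_cancel] at this
      simp only [radialDeriv_zero, hφ, ← this]
      ring
    have h3 := norm_le_norm_fderiv_zero hmem.harmonic hd1
    rwa [norm_smul, he, mul_one, Real.norm_of_nonneg (by positivity)] at h3
  have hnpos : (0 : ℝ) < n := Nat.cast_pos.2 (Nat.pos_of_ne_zero ne_zero_of_fact)
  have hlow2 : gradConst n p * hardyNorm p f ≤ n * I := by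
    rw [gradConst_eq hp1, mul_assoc, ← hqdef, ← hI]
    refine mul_le_mul_of_nonneg_left ?_ hnpos.le
    rw [mul_comm]
    exact (mul_le_mul_of_nonneg_right hnorm (by positivity)).trans hprod
  refine ⟨f, hmem, h0, ?_, le_antisymm hup (hlow2.trans hlow)⟩
  refine lt_of_le_of_ne ENNReal.toReal_nonneg fun h => ?_
  rw [← h, mul_zero] at hup
  have : 0 < n * I := by positivity
  linarith

end BalancedLevel

/-! ### The smooth extension of `g` for 1 < p < ∞ -/

section FiniteExponent

variable {n : ℕ} [hn : Fact (2 ≤ n)]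

theorem balance_eq_zero_radial {α r s : ℝ} (hr : r ∈ Ioo (0 : ℝ) 1) (hs : s ∈ Ioo (-1 : ℝ) 1)
    (h : balance n α (r, s) = 0) :
    ∫ ζ : Sph n, signPow α (radial n r (height ζ) - radial n r s) ∂(sigma n) = 0 := by
  have hr' : r ∈ Ioo (-1 : ℝ) 1 := ⟨by linarith [hr.1], hr.2⟩
  have h1 : ∀ ζ : Sph n, signPow α (radial n r (height ζ) - radial n r s) =
      r ^ α * signPow α ((height ζ - s) * diffQuot n r s (height ζ)) := fun ζ => by
    rw [radial_sub_radial hr' (Ioo_subset_Icc_self hs) (height_mem ζ), signPow_mul hr.1]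
  simp only [h1]
  rw [integral_const_mul]
  exact mul_eq_zero_of_right _ h

/-- Taking the factor r out before the q-th root leaves a root of the positive function `energy`, so
the expression is smooth across r = 0. There the balanced height is 0 and the divided difference is
n, which yields the derivative. -/
theorem exists_smooth_extension_g {p : ℝ≥0∞} (hp : 1 ≤ p) (hp1 : p ≠ 1) (hpt : p ≠ ⊤) :
    ∃ G : ℝ → ℝ, ContDiffOn ℝ (⊤ : ℕ∞) G (Ioo (-1) 1) ∧ EqOn (g n p) G (Ico 0 1) ∧
      HasDerivAt G (gradConst n p) 0 := by
  have hq := one_lt_toReal_conjExponent hp hp1 hpt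
  have hcst := gradConst_eq (n := n) hp1
  set q := p.conjExponent.toReal with hqdef
  have hα : 0 < q - 1 := by linarith
  set s := balancedHeight n (q - 1) with hs
  have hsm : ContDiffOn ℝ (⊤ : ℕ∞) (fun r => energy n q (r, s r) ^ q⁻¹) (Ioo (-1) 1) := by
    intro r hr
    have h1 := (balancedHeight_spec (n := n) hα hr).1
    refine ContDiffAt.contDiffWithinAt (ContDiffAt.rpow_const_of_ne ?_
      (energy_pos (by linarith) hr h1).ne')
    exact ((contDiffOn_energy (by linarith)).contDiffAt
      ((isOpen_Ioo.prod isOpen_Ioo).mem_nhds ⟨hr, h1⟩)).comp (f := fun r => (r, s r)) r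
        (contDiffAt_id.prodMk (contDiffAt_balancedHeight hα hr))
  refine ⟨fun r => r * energy n q (r, s r) ^ q⁻¹, contDiffOn_id.mul hsm, fun r hr => ?_, ?_⟩
  · rcases hr.1.eq_or_lt with rfl | h0
    · simp [g_zero]
    · have hr0 : r ∈ Ioo (0 : ℝ) 1 := ⟨h0, hr.2⟩
      have hr' : r ∈ Ioo (-1 : ℝ) 1 := ⟨by linarith, hr.2⟩
      obtain ⟨h1, h2⟩ := balancedHeight_spec (n := n) hα hr'
      have hnorm : ‖r • north n‖ = r := norm_smul_north h0.le
      obtain ⟨-, -, -, -, -, -, -, h3⟩ := balanced_spec hp hp1 (smul_north_mem_ball hr')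
        (norm_pos_iff.1 (by rw [hnorm]; exact h0)) h1
        (by rw [hnorm]; exact balance_eq_zero_radial hr0 h1 h2)
      rw [hnorm, ← hqdef] at h3
      have h4 : ∀ ζ : Sph n, |radial n r (height ζ) - radial n r (s r)| ^ q =
          r ^ q * |(height ζ - s r) * diffQuot n r (s r) (height ζ)| ^ q := fun ζ => by
        rw [radial_sub_radial hr' (Ioo_subset_Icc_self h1) (height_mem ζ), abs_mul, abs_of_pos h0,
          Real.mul_rpow h0.le (abs_nonneg _)]
      simp only [← hs, h4] at h3
      rw [integral_const_mul, Real.mul_rpow (by positivity)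
        (integral_nonneg fun ζ => by positivity), Real.rpow_rpow_inv h0.le (by linarith)] at h3
      exact h3
  · have h0 : (0 : ℝ) ∈ Ioo (-1 : ℝ) 1 := by norm_num
    have hd := ((hsm.contDiffAt (Ioo_mem_nhds h0.1 h0.2)).differentiableAt (by simp)).hasDerivAt
    have h1 := (hasDerivAt_id (0 : ℝ)).fun_mul hd
    refine h1.congr_deriv ?_
    have h2 : energy n q (0, s 0) = n ^ q * ∫ ζ : Sph n, |height ζ| ^ q ∂(sigma n) := by
      rw [hs, balancedHeight_zero hα, ← integral_const_mul]
      refine integral_congr_ae (Eventually.of_forall fun ζ => ?_)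
      simp only [diffQuot_zero, sub_zero, abs_mul, Nat.abs_cast]
      rw [Real.mul_rpow (abs_nonneg _) (Nat.cast_nonneg n), mul_comm]
    rw [h2, Real.mul_rpow (by positivity) (integral_nonneg fun ζ => by positivity),
      Real.rpow_rpow_inv (Nat.cast_nonneg n) (by linarith), hcst]
    simp

end FiniteExponent

end HarmonicSchwarz

namespace HarmonicSchwarz

open Filter Topology InnerProductSpace Laplacian

/-! ### The case p = ∞ -/

section InfiniteExponent

variable {n : ℕ} [hn : Fact (2 ≤ n)]

theorem signPow_zero_radial_sub {r t : ℝ} (hr : r ∈ Ioo (0 : ℝ) 1) (ht : t ∈ Icc (-1 : ℝ) 1) :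
    signPow 0 (radial n r t - radial n r 0) = signPow 0 t := by
  have hr' : r ∈ Ioo (-1 : ℝ) 1 := ⟨by linarith [hr.1], hr.2⟩
  have h0 : (0 : ℝ) ∈ Icc (-1 : ℝ) 1 := by norm_num
  have hd := diffQuot_pos (n := n) ne_zero_of_fact hr' h0 ht
  rw [radial_sub_radial hr' h0 ht, sub_zero, mul_comm t, ← mul_assoc,
    signPow_mul (mul_pos hr.1 hd), Real.rpow_zero, one_mul]

theorem integral_signPow_height (c : ℝ) : ∫ ζ : Sph n, signPow c (height ζ) ∂(sigma n) = 0 :=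
  integral_eq_zero_of_odd fun ζ => by simp only [height_neg, signPow_neg]

/-- For q = 1 balance means that the sign of P_r minus the level has mean zero; the equator is
balanced for every r by the reflection ζ ↦ −ζ. -/
theorem balanced_top {r : ℝ} (hr : r ∈ Ioo (0 : ℝ) 1) :
    ∫ ζ : Sph n, signPow ((⊤ : ℝ≥0∞).conjExponent.toReal - 1)
      (radial n r (height ζ) - radial n r 0) ∂(sigma n) = 0 := by
  rw [conjExponent_top, ENNReal.toReal_one, sub_self]
  simp only [signPow_zero_radial_sub hr (height_mem _)]
  exact integral_signPow_height 0

variable (n) in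
/-- The function `r ↦ U(rN)`. -/
noncomputable def signMean (r : ℝ) : ℝ :=
  ∫ ζ : Sph n, signPow 0 (height ζ) • radial n r (height ζ) ∂(sigma n)

theorem signMean_zero : signMean n 0 = 0 := by
  have h : ∀ t, radial n 0 t = 1 := fun t => by simp [radial]
  simp only [signMean, h, smul_eq_mul, mul_one, integral_signPow_height]

theorem g_top_eq : EqOn (g n ⊤) (signMean n) (Ico 0 1) := by
  intro r hr
  rcases hr.1.eq_or_lt with rfl | h0
  · rw [g_zero, signMean_zero]
  · have hr0 : r ∈ Ioo (0 : ℝ) 1 := ⟨h0, hr.2⟩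
    have hr' : r ∈ Ioo (-1 : ℝ) 1 := ⟨by linarith, hr.2⟩
    have hnorm : ‖r • north n‖ = r := norm_smul_north h0.le
    obtain ⟨-, -, -, -, -, -, -, h3⟩ := balanced_spec (n := n) le_top ENNReal.top_ne_one
      (smul_north_mem_ball hr') (norm_pos_iff.1 (by rw [hnorm]; exact h0)) (s := 0) (by norm_num)
      (by rw [hnorm]; exact balanced_top hr0)
    have hsi := integrable_signPow_height (n := n) (c := 0) le_rfl
    have hpi : Integrable (fun ζ : Sph n => signPow 0 (height ζ) • radial n r (height ζ)) (sigma n) :=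
      integrable_smul_comp_of_continuousOn isCompact_Icc continuous_height height_mem hsi
        (continuousOn_radial hr')
    have h4 : ∀ ζ : Sph n, |radial n r (height ζ) - radial n r 0| ^ (1 : ℝ) =
        signPow 0 (height ζ) • radial n r (height ζ) - signPow 0 (height ζ) * radial n r 0 := by
      intro ζ
      have := mul_signPow (c := 0) le_rfl (radial n r (height ζ) - radial n r 0)
      rw [zero_add] at this
      rw [← this, signPow_zero_radial_sub hr0 (height_mem ζ), smul_eq_mul]
      ring
    rw [hnorm, conjExponent_top, ENNReal.toReal_one, inv_one, Real.rpow_one] at h3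
    simp only [h4] at h3
    rw [integral_sub hpi (hsi.mul_const _), integral_mul_const, integral_signPow_height, zero_mul,
      sub_zero] at h3
    exact h3

theorem U_smul_north (r : ℝ) : U n (r • north n) = signMean n r := by
  rw [U, poissonIntegral_smul_north, signMean]
  refine integral_congr_ae (Eventually.of_forall fun ζ => ?_)
  have h1 : ζ ∈ upperHalf n ↔ 0 ≤ height ζ := Iff.rfl
  have h2 : ζ ∈ lowerHalf n ↔ height ζ ≤ 0 := Iff.rfl
  simp only
  congr 1
  rcases lt_trichotomy (height ζ) 0 with h | h | h
  · rw [indicator_of_notMem (mt h1.1 (not_le.2 h)), indicator_of_mem (h2.2 h.le),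
      signPow_of_neg h, Real.rpow_zero, zero_sub]
  -- On the equator both indicators are 1 and cancel, in agreement with sign 0 = 0.
  · rw [indicator_of_mem (h1.2 h.ge), indicator_of_mem (h2.2 h.le), h, signPow_zero, sub_self]
  · rw [indicator_of_mem (h1.2 h.le), indicator_of_notMem (mt h2.1 (not_le.2 h)),
      signPow_of_pos h, Real.rpow_zero, sub_zero]

theorem contDiffOn_signMean : ContDiffOn ℝ (⊤ : ℕ∞) (signMean n) (Ioo (-1) 1) :=
  contDiffOn_integral_smul (H := fun p : ℝ × ℝ => radial n p.1 p.2) isOpen_Ioo isCompact_Icc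
    continuous_height height_mem (integrable_signPow_height le_rfl)
    fun _ hz _ hu => contDiffAt_radial contDiffAt_fst contDiffAt_snd (distSq_pos hz hu)

theorem hasDerivAt_signMean_zero : HasDerivAt (signMean n) (gradConst n ⊤) 0 := by
  have h := (hasDerivAt_integral_radial (n := n) (integrable_signPow_height (c := 0) le_rfl)
    (r := 0) (by norm_num)).1
  refine h.congr_deriv ?_
  rw [gradConst_eq ENNReal.top_ne_one, conjExponent_top, ENNReal.toReal_one, inv_one,
    Real.rpow_one, ← integral_const_mul]
  refine integral_congr_ae (Eventually.of_forall fun ζ => ?_)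
  have := mul_signPow (c := 0) le_rfl (height ζ)
  rw [zero_add] at this
  simp only [radialDeriv_zero, ← this]
  ring

variable (n) in
/-- A smooth extension of `signMean n` across `r = 1`. -/
noncomputable def signMeanExt (r : ℝ) : ℝ :=
  1 - ∫ ζ : Sph n, (1 - signPow 0 (height ζ)) • radial n r (min (height ζ) 0) ∂(sigma n)

theorem distSq_pos_of_nonpos {r t : ℝ} (hr : -1 < r) (ht : t ∈ Icc (-1 : ℝ) 0) :
    0 < 1 + r ^ 2 - 2 * r * t := by
  rcases lt_or_ge r 1 with h | h
  · exact distSq_pos ⟨hr, h⟩ ⟨ht.1, by linarith [ht.2]⟩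
  · nlinarith [mul_nonneg (by linarith : 0 ≤ r) (neg_nonneg.2 ht.2)]

theorem integrable_one_sub_signPow :
    Integrable (fun ζ : Sph n => 1 - signPow 0 (height ζ)) (sigma n) :=
  (integrable_const 1).sub (integrable_signPow_height le_rfl)

theorem min_height_mem (ζ : Sph n) : min (height ζ) 0 ∈ Icc (-1 : ℝ) 0 :=
  ⟨le_min (height_mem ζ).1 (by norm_num), min_le_right _ _⟩

/-- The weight 1 − sign vanishes on the open upper hemisphere, so truncating the height at 0 changes
nothing for r < 1. After truncation the kernel keeps away from its pole, which allows radii beyond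
1. -/
theorem signMeanExt_eq : EqOn (signMeanExt n) (signMean n) (Ioo (-1) 1) := by
  intro r hr
  have h1 : ∀ ζ : Sph n, (1 - signPow 0 (height ζ)) • radial n r (min (height ζ) 0) =
      radial n r (height ζ) - signPow 0 (height ζ) • radial n r (height ζ) := by
    intro ζ
    rcases le_or_gt (height ζ) 0 with h | h
    · rw [min_eq_left h, smul_eq_mul, smul_eq_mul]
      ring
    · simp [signPow_of_pos h]
  have hpi : Integrable (fun ζ : Sph n => signPow 0 (height ζ) • radial n r (height ζ)) (sigma n) :=
    integrable_smul_comp_of_continuousOn isCompact_Icc continuous_height height_mem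
      (integrable_signPow_height le_rfl) (continuousOn_radial hr)
  rw [signMeanExt]
  simp only [h1]
  rw [integral_sub (integrable_of_continuous (continuous_radial_height hr)) hpi, integral_radial hr,
    signMean]
  ring

omit hn in
theorem signMeanExt_one : signMeanExt n 1 = 1 := by
  simp [signMeanExt, radial]

omit hn in
theorem contDiffAt_radial_of_nonpos {z u : ℝ} (hz : z ∈ Ioo (-1 : ℝ) 2) (hu : u ∈ Icc (-1 : ℝ) 0) :
    ContDiffAt ℝ (⊤ : ℕ∞) (fun p : ℝ × ℝ => radial n p.1 p.2) (z, u) :=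
  contDiffAt_radial contDiffAt_fst contDiffAt_snd (distSq_pos_of_nonpos hz.1 hu)

theorem contDiffOn_signMeanExt : ContDiffOn ℝ (⊤ : ℕ∞) (signMeanExt n) (Ioo (-1) 2) :=
  contDiffOn_const.sub (contDiffOn_integral_smul (H := fun p : ℝ × ℝ => radial n p.1 p.2)
    isOpen_Ioo isCompact_Icc (continuous_height.min continuous_const) min_height_mem
    integrable_one_sub_signPow fun _ hz _ hu => contDiffAt_radial_of_nonpos hz hu)

/-- At r = 1 the numerator of `radialDeriv` is 4u − 4, negative for u ≤ 0, and the weight is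
positive on the lower hemisphere. -/
theorem deriv_signMeanExt_one_pos : 0 < deriv (signMeanExt n) 1 := by
  obtain ⟨h1, h2⟩ := hasDerivAt_integral_smul (H := fun p : ℝ × ℝ => radial n p.1 p.2)
    isOpen_Ioo isCompact_Icc (continuous_height.min continuous_const) min_height_mem
    (integrable_one_sub_signPow (n := n)) (fun _ hz _ hu => contDiffAt_radial_of_nonpos hz hu)
    (show (1 : ℝ) ∈ Ioo (-1 : ℝ) 2 by norm_num)
    (fun u hu => hasDerivAt_radial ne_zero_of_fact (distSq_pos_of_nonpos (by norm_num) hu))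
  have h3 := h1.const_sub 1
  have h4 : deriv (signMeanExt n) 1 = _ := h3.deriv
  rw [h4, ← integral_neg]
  have hd : ∀ u ∈ Icc (-1 : ℝ) 0, radialDeriv n 1 u < 0 := by
    intro u hu
    have hx := Real.sqrt_pos.2 (distSq_pos_of_nonpos (r := 1) (by norm_num) hu)
    refine div_neg_of_neg_of_pos ?_ (by positivity)
    linarith [hu.2]
  have hw : ∀ ζ : Sph n, 0 ≤ 1 - signPow 0 (height ζ) := fun ζ => by
    have := (le_abs_self _).trans (abs_signPow_le 0 (height ζ))
    rw [Real.rpow_zero] at this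
    linarith
  have hnn : ∀ ζ : Sph n, 0 ≤ -((1 - signPow 0 (height ζ)) * radialDeriv n 1 (min (height ζ) 0)) :=
    fun ζ => neg_nonneg.2 (mul_nonpos_of_nonneg_of_nonpos (hw ζ) (hd _ (min_height_mem ζ)).le)
  rw [integral_pos_iff_support_of_nonneg hnn h2.neg]
  have hopen : IsOpen {ζ : Sph n | height ζ < 0} := isOpen_lt continuous_height continuous_const
  refine (hopen.measure_pos (sigma n) ⟨-pole n, ?_⟩).trans_le (measure_mono fun ζ hζ => ?_)
  · simp only [mem_ofPred_eq, height_neg_pole]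
    norm_num
  · have h : height ζ < 0 := hζ
    refine neg_ne_zero.2 (mul_ne_zero ?_ (hd _ (min_height_mem ζ)).ne)
    have := signPow_neg_of_neg (c := 0) h
    linarith

theorem deriv_signMeanExt_pos {r : ℝ} (hr : r ∈ Icc (0 : ℝ) 1) : 0 < deriv (signMeanExt n) r := by
  rcases hr.2.eq_or_lt with rfl | h1
  · exact deriv_signMeanExt_one_pos
  · have hr' : r ∈ Ioo (-1 : ℝ) 1 := ⟨by linarith [hr.1], h1⟩
    have hev : signMeanExt n =ᶠ[𝓝 r] signMean n := by
      filter_upwards [Ioo_mem_nhds hr'.1 hr'.2] with x hx using signMeanExt_eq hx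
    rw [hev.deriv_eq]
    rcases hr.1.eq_or_lt with rfl | h0
    · rw [hasDerivAt_signMean_zero.deriv]
      exact gradConst_pos le_top
    · refine deriv_pos_of_balanced (s := 0) le_top ENNReal.top_ne_one ⟨h0, h1⟩ (by norm_num)
        (balanced_top ⟨h0, h1⟩) ?_ g_top_eq
      exact (contDiffOn_signMean.contDiffAt (Ioo_mem_nhds hr'.1 hr'.2)).differentiableAt (by simp)

theorem isIncreasingDiffeo_g_top :
    IsIncreasingDiffeo (Function.update (g n ⊤) 1 1) (Icc 0 1) (Icc 0 1) := by
  have hd : ContinuousOn (deriv (signMeanExt n)) (Ioo (-1) 2) :=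
    contDiffOn_signMeanExt.continuousOn_deriv_of_isOpen isOpen_Ioo (by exact_mod_cast le_top)
  have hev : ∀ x ∈ Icc (0 : ℝ) 1, ∀ᶠ r in 𝓝 x, 0 < deriv (signMeanExt n) r := fun x hx =>
    (hd.continuousAt (Ioo_mem_nhds (by linarith [hx.1]) (by linarith [hx.2]))).eventually_const_lt
      (deriv_signMeanExt_pos hx)
  obtain ⟨δ, hδ, hδpos⟩ := Metric.eventually_nhds_iff.1 (hev 0 (by norm_num))
  obtain ⟨ε, hε, hεpos⟩ := Metric.eventually_nhds_iff.1 (hev 1 (by norm_num))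
  set δ' := min δ 1
  set ε' := min ε 1
  have hδ'0 : 0 < δ' := lt_min hδ one_pos
  have hε'0 : 0 < ε' := lt_min hε one_pos
  have hsub : Ioo (-δ') (1 + ε') ⊆ Ioo (-1) 2 :=
    Ioo_subset_Ioo (by linarith [min_le_right δ 1]) (by linarith [min_le_right ε 1])
  have hIcc : Icc (0 : ℝ) 1 ⊆ Ioo (-δ') (1 + ε') := fun r hr =>
    ⟨by linarith [hr.1], by linarith [hr.2]⟩
  have hpos : ∀ r ∈ Ioo (-δ') (1 + ε'), 0 < deriv (signMeanExt n) r := by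
    intro r hr
    rcases lt_or_ge r 0 with h | h
    · refine hδpos ?_
      rw [Real.dist_eq, sub_zero, abs_of_neg h]
      linarith [hr.1, min_le_left δ 1]
    · rcases le_or_gt r 1 with h' | h'
      · exact deriv_signMeanExt_pos ⟨h, h'⟩
      · refine hεpos ?_
        rw [Real.dist_eq, abs_of_pos (by linarith)]
        linarith [hr.2, min_le_left ε 1]
  have hG := contDiffOn_signMeanExt (n := n).mono hsub
  refine isIncreasingDiffeo_of_deriv_pos hG hpos hIcc (fun r hr => ?_) ?_
  · rcases hr.2.eq_or_lt with rfl | h1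
    · rw [Function.update_self, signMeanExt_one]
    · rw [Function.update_of_ne h1.ne, signMeanExt_eq ⟨by linarith [hr.1], h1⟩,
        g_top_eq ⟨hr.1, h1⟩]
  · have hmono := strictMonoOn_of_deriv_pos (convex_Ioo _ _) hG.continuousOn
      (by simpa using hpos)
    rw [ContinuousOn.image_Icc_of_monotoneOn zero_le_one (hG.continuousOn.mono hIcc)
      (hmono.monotoneOn.mono hIcc), signMeanExt_one, signMeanExt_eq (by norm_num), signMean_zero]

end InfiniteExponent

/-! ### The case p = 1 -/

section ExponentOne

variable {n m : ℕ} [hn : Fact (2 ≤ n)]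

/-- The difference of the Poisson kernels at two antipodal points. -/
noncomputable def poleDiff (ζ : Sph n) (e : EuclideanSpace ℝ (Fin m))
    (x : EuclideanSpace ℝ (Fin n)) : EuclideanSpace ℝ (Fin m) :=
  (poissonKernel n x ζ - poissonKernel n x (-ζ)) • e

theorem lintegral_poissonKernel_smul {r : ℝ} (hr : r ∈ Ico (0 : ℝ) 1) (ζ : Sph n) :
    ∫⁻ η : Sph n, ‖poissonKernel n (r • (η : EuclideanSpace ℝ (Fin n))) ζ‖ₑ ∂(sigma n) = 1 := by
  have hx := smul_mem_ball hr ζ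
  rw [← lintegral_poissonKernel hx]
  refine lintegral_congr fun η => ?_
  rw [poissonKernel_symm, Real.enorm_of_nonneg (poissonKernel_pos hx η).le]

theorem hardyENorm_poleDiff_le (ζ : Sph n) {e : EuclideanSpace ℝ (Fin m)} (he : ‖e‖ = 1) :
    hardyENorm 1 (poleDiff ζ e) ≤ 2 := by
  refine iSup₂_le fun r hr => ?_
  rw [eLpNorm_one_eq_lintegral_enorm]
  have hx := smul_mem_ball (n := n) hr
  have hm : Measurable fun η : Sph n =>
      ‖poissonKernel n (r • (η : EuclideanSpace ℝ (Fin n))) ζ‖ₑ := by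
    simp only [poissonKernel_symm _ ζ]
    exact (continuous_poissonKernel (hx ζ)).measurable.enorm
  calc _ ≤ ∫⁻ η : Sph n, (‖poissonKernel n (r • (η : EuclideanSpace ℝ (Fin n))) ζ‖ₑ +
        ‖poissonKernel n (r • (η : EuclideanSpace ℝ (Fin n))) (-ζ)‖ₑ) ∂(sigma n) := by
        refine lintegral_mono fun η => ?_
        have he' : ‖e‖ₑ = 1 := by rw [← ofReal_norm, he, ENNReal.ofReal_one]
        rw [poleDiff, enorm_smul, he', mul_one]
        exact enorm_sub_le
    _ = 2 := by
        rw [lintegral_add_left hm, lintegral_poissonKernel_smul hr, lintegral_poissonKernel_smul hr]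
        norm_num

omit hn in
theorem poleDiff_zero (ζ : Sph n) (e : EuclideanSpace ℝ (Fin m)) : poleDiff ζ e 0 = 0 := by
  simp [poleDiff, poissonKernel]

theorem memHardy_poleDiff (ζ : Sph n) {e : EuclideanSpace ℝ (Fin m)} (he : ‖e‖ = 1) :
    MemHardy 1 (poleDiff ζ e) :=
  ⟨((harmonicOnNhd_poissonKernel ζ).sub (harmonicOnNhd_poissonKernel (-ζ))).comp_CLM
    (ContinuousLinearMap.toSpanSingleton ℝ e),
    (hardyENorm_poleDiff_le ζ he).trans_lt ENNReal.ofNat_lt_top⟩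

theorem hardyNorm_poleDiff_le (ζ : Sph n) {e : EuclideanSpace ℝ (Fin m)} (he : ‖e‖ = 1) :
    hardyNorm 1 (poleDiff ζ e) ≤ 2 :=
  ENNReal.toReal_mono ENNReal.ofNat_ne_top (hardyENorm_poleDiff_le ζ he)

theorem poleDiff_smul_north (r : ℝ) (e : EuclideanSpace ℝ (Fin m)) :
    poleDiff (pole n) e (r • north n) = (radial n r 1 - radial n r (-1)) • e := by
  have h1 := poissonRadial_eq r (pole n)
  have h2 := poissonRadial_eq r (-pole n)
  rw [height_pole] at h1
  rw [height_neg_pole] at h2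
  rw [poleDiff, ← h1, ← h2]
  rfl

theorem exists_poleDiff_eq (x : EuclideanSpace ℝ (Fin n)) :
    ∃ ζ : Sph n, ∀ e : EuclideanSpace ℝ (Fin m),
      poleDiff ζ e x = (radial n ‖x‖ 1 - radial n ‖x‖ (-1)) • e := by
  obtain ⟨A, hA⟩ : ∃ A : EuclideanSpace ℝ (Fin n) ≃ₗᵢ[ℝ] EuclideanSpace ℝ (Fin n),
      A x = ‖x‖ • north n := exists_isometry_of_norm_eq (by simp [norm_smul, norm_north])
  refine ⟨rotate A.symm (pole n), fun e => ?_⟩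
  rw [← poleDiff_smul_north, poleDiff, poleDiff, ← hA, ← poissonKernel_rotate A x,
    ← poissonKernel_rotate A x]
  have h1 : rotate A (rotate A.symm (pole n)) = pole n := Subtype.ext (by simp [coe_rotate])
  have h2 : rotate A (-rotate A.symm (pole n)) = -pole n := Subtype.ext (by simp [coe_rotate])
  rw [h1, h2]

/-- In the sup norm the best constant is the midpoint of the range, which bounds `g` from above. The
difference of the kernels with poles ±N has Hardy norm at most 2 and takes the value max P_r − min
P_r at rN, which gives the lower bound. -/
theorem g_one_eq {r : ℝ} (hr : r ∈ Ico (0 : ℝ) 1) :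
    g n 1 r = (radial n r 1 - radial n r (-1)) / 2 := by
  have hr' : r ∈ Ioo (-1 : ℝ) 1 := ⟨by linarith [hr.1], hr.2⟩
  have hmono : MonotoneOn (radial n r) (Icc (-1) 1) := by
    rcases hr.1.eq_or_lt with rfl | h0
    · intro s _ t _ _
      simp [radial]
    · exact (strictMonoOn_radial ne_zero_of_fact ⟨h0, hr.2⟩).monotoneOn
  have hm1 : (-1 : ℝ) ∈ Icc (-1 : ℝ) 1 := by norm_num
  have h1 : (1 : ℝ) ∈ Icc (-1 : ℝ) 1 := by norm_num
  have hle := hmono hm1 h1 (by norm_num)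
  have hnorm : ‖r • north n‖ = r := norm_smul_north hr.1
  have hball := smul_north_mem_ball (n := n) hr'
  refine le_antisymm ?_ ?_
  · have hpos := radial_pos (n := n) hr' h1
    have hpos' := radial_pos (n := n) hr' hm1
    have h := g_le (p := 1) hball (a := (radial n r 1 + radial n r (-1)) / 2) (by positivity)
    rw [hnorm] at h
    refine h.trans (ENNReal.toReal_le_of_le_ofReal (by linarith) ?_)
    rw [conjExponent_one, eLpNorm_exponent_top]
    refine eLpNormEssSup_le_of_ae_bound (Eventually.of_forall fun ζ => ?_)
    have h2 := poissonRadial_eq r ζ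
    rw [poissonRadial] at h2
    rw [h2, Real.norm_eq_abs, abs_le]
    have h3 := hmono hm1 (height_mem ζ) (height_mem ζ).1
    have h4 := hmono (height_mem ζ) h1 (height_mem ζ).2
    constructor <;> linarith
  -- Any target dimension serves, since `g` does not depend on it; dimension 1 is taken.
  · have he : ‖(EuclideanSpace.single 0 1 : EuclideanSpace ℝ (Fin 1))‖ = 1 := by simp
    have h := norm_le_g_mul_hardyNorm le_rfl (memHardy_poleDiff (pole n) he) (poleDiff_zero _ _) hball
    rw [poleDiff_smul_north, norm_smul, he, mul_one, hnorm, Real.norm_of_nonneg (by linarith)] at h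
    have h2 := mul_le_mul_of_nonneg_left (hardyNorm_poleDiff_le (pole n) he) (g_nonneg (n := n) 1 r)
    linarith

omit hn in
theorem contDiffOn_g_one : ContDiffOn ℝ (⊤ : ℕ∞)
    (fun r => (radial n r 1 - radial n r (-1)) / 2) (Ioo (-1) 1) := by
  have h : ∀ t ∈ Icc (-1 : ℝ) 1, ContDiffOn ℝ (⊤ : ℕ∞) (fun r => radial n r t) (Ioo (-1) 1) :=
    fun t ht r hr => (contDiffAt_radial (f := fun r : ℝ => r) (g := fun _ => t) contDiffAt_id
      contDiffAt_const (distSq_pos hr ht)).contDiffWithinAt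
  exact ((h 1 (by norm_num)).sub (h (-1) (by norm_num))).div_const 2

theorem hasDerivAt_g_one {r : ℝ} (hr : r ∈ Ioo (-1 : ℝ) 1) :
    HasDerivAt (fun r => (radial n r 1 - radial n r (-1)) / 2)
      ((radialDeriv n r 1 - radialDeriv n r (-1)) / 2) r :=
  ((hasDerivAt_radial ne_zero_of_fact (distSq_pos hr (by norm_num))).sub
    (hasDerivAt_radial ne_zero_of_fact (distSq_pos hr (by norm_num)))).div_const 2

theorem deriv_g_one_pos {r : ℝ} (hr : r ∈ Ico (0 : ℝ) 1) :
    0 < (radialDeriv n r 1 - radialDeriv n r (-1)) / 2 := by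
  have hr' : r ∈ Ioo (-1 : ℝ) 1 := ⟨by linarith [hr.1], hr.2⟩
  have hn2 : (2 : ℝ) ≤ n := by exact_mod_cast hn.out
  have h1 := one_sub_sq_pos hr'
  have h3 := hr.1
  have hpos : 0 < radialDeriv n r 1 := by
    have hx := Real.sqrt_pos.2 (distSq_pos hr' (show (1 : ℝ) ∈ Icc (-1 : ℝ) 1 by norm_num))
    refine div_pos ?_ (by positivity)
    have h2 : (4 * r ^ 2 + n * (1 - r ^ 2)) * 1 - r * (2 * (1 + r ^ 2) + n * (1 - r ^ 2)) =
        (1 - r) ^ 2 * (n * (1 + r) - 2 * r) := by ring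
    rw [h2]
    have h4 : 0 < 1 - r := by linarith [hr.2]
    have h5 : 0 < n * (1 + r) - 2 * r := by nlinarith
    positivity
  have hneg : radialDeriv n r (-1) < 0 := by
    have hx := Real.sqrt_pos.2 (distSq_pos hr' (show (-1 : ℝ) ∈ Icc (-1 : ℝ) 1 by norm_num))
    refine div_neg_of_neg_of_pos ?_ (by positivity)
    have h4 : 0 < n * (1 - r ^ 2) := by positivity
    have h5 : 0 ≤ r * (2 * (1 + r ^ 2) + n * (1 - r ^ 2)) := by positivity
    nlinarith
  linarith

omit hn in
theorem radialDeriv_zero_sub : (radialDeriv n 0 1 - radialDeriv n 0 (-1)) / 2 = gradConst n 1 := by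
  rw [radialDeriv_zero, radialDeriv_zero, gradConst, if_pos rfl]
  ring

theorem exists_extremal_one {x : EuclideanSpace ℝ (Fin n)}
    (hx : x ∈ Metric.ball (0 : EuclideanSpace ℝ (Fin n)) 1) (hx0 : x ≠ 0)
    {e : EuclideanSpace ℝ (Fin m)} (he : ‖e‖ = 1) :
    ∃ f : EuclideanSpace ℝ (Fin n) → EuclideanSpace ℝ (Fin m),
      MemHardy 1 f ∧ f 0 = 0 ∧ 0 < hardyNorm 1 f ∧ ‖f x‖ = g n 1 ‖x‖ * hardyNorm 1 f := by
  obtain ⟨ζ, hζ⟩ := exists_poleDiff_eq (m := m) x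
  have hr : ‖x‖ ∈ Ioo (0 : ℝ) 1 := ⟨norm_pos_iff.2 hx0, mem_ball_zero_iff.1 hx⟩
  have hlt := strictMonoOn_radial (n := n) ne_zero_of_fact hr (show (-1 : ℝ) ∈ Icc (-1 : ℝ) 1 by norm_num)
    (show (1 : ℝ) ∈ Icc (-1 : ℝ) 1 by norm_num) (by norm_num)
  have hg := g_one_eq (n := n) ⟨hr.1.le, hr.2⟩
  have hnorm : ‖poleDiff ζ e x‖ = g n 1 ‖x‖ * 2 := by
    rw [hζ, norm_smul, he, mul_one, Real.norm_of_nonneg (by linarith), hg]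
    ring
  have hle := norm_le_g_mul_hardyNorm le_rfl (memHardy_poleDiff ζ he) (poleDiff_zero _ _) hx
  refine ⟨poleDiff ζ e, memHardy_poleDiff ζ he, poleDiff_zero _ _, ?_, le_antisymm hle ?_⟩
  · refine lt_of_le_of_ne ENNReal.toReal_nonneg fun h => ?_
    rw [← h, mul_zero, hnorm, hg] at hle
    linarith
  · rw [hnorm]
    exact mul_le_mul_of_nonneg_left (hardyNorm_poleDiff_le ζ he) (g_nonneg _ _)

theorem exists_extremal_fderiv_one
    (hle : ∀ f : EuclideanSpace ℝ (Fin n) → EuclideanSpace ℝ (Fin m), MemHardy 1 f → f 0 = 0 →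
      ‖fderiv ℝ f 0‖ ≤ gradConst n 1 * hardyNorm 1 f)
    {e : EuclideanSpace ℝ (Fin m)} (he : ‖e‖ = 1) :
    ∃ f : EuclideanSpace ℝ (Fin n) → EuclideanSpace ℝ (Fin m),
      MemHardy 1 f ∧ f 0 = 0 ∧ 0 < hardyNorm 1 f ∧
        ‖fderiv ℝ f 0‖ = gradConst n 1 * hardyNorm 1 f := by
  have hmem := memHardy_poleDiff (pole n) he
  have hup := hle _ hmem (poleDiff_zero _ _)
  have hc := gradConst_pos (n := n) (p := 1) le_rfl
  have hlow : gradConst n 1 * 2 ≤ ‖fderiv ℝ (poleDiff (pole n) e) 0‖ := by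
    have hd := (((hasDerivAt_g_one (n := n) (r := 0) (by norm_num)).mul_const 2).smul_const e)
    simp only [div_mul_cancel₀ _ (two_ne_zero' ℝ), ← poleDiff_smul_north] at hd
    have h := norm_le_norm_fderiv_zero hmem.harmonic hd
    rw [norm_smul, he, mul_one] at h
    refine le_trans ?_ h
    rw [← radialDeriv_zero_sub, div_mul_cancel₀ _ (two_ne_zero' ℝ)]
    exact le_abs_self _
  refine ⟨_, hmem, poleDiff_zero _ _, ?_, le_antisymm hup (le_trans ?_ hlow)⟩
  · refine lt_of_le_of_ne ENNReal.toReal_nonneg fun h => ?_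
    rw [← h, mul_zero] at hup
    linarith
  · exact mul_le_mul_of_nonneg_left (hardyNorm_poleDiff_le _ he) hc.le

end ExponentOne

end HarmonicSchwarz

namespace HarmonicSchwarz

open Filter Topology InnerProductSpace Laplacian

/-! ### All exponents together -/

section AllExponents

variable {n m : ℕ} [hn : Fact (2 ≤ n)]

variable (n) in
theorem exists_smooth_extension {p : ℝ≥0∞} (hp : 1 ≤ p) :
    ∃ G : ℝ → ℝ, ContDiffOn ℝ (⊤ : ℕ∞) G (Ioo (-1) 1) ∧ EqOn (g n p) G (Ico 0 1) ∧
      HasDerivAt G (gradConst n p) 0 := by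
  by_cases hp1 : p = 1
  · subst hp1
    refine ⟨_, contDiffOn_g_one, fun r hr => g_one_eq hr, ?_⟩
    rw [← radialDeriv_zero_sub]
    exact hasDerivAt_g_one (by norm_num)
  · by_cases hpt : p = ⊤
    · subst hpt
      exact ⟨_, contDiffOn_signMean, g_top_eq, hasDerivAt_signMean_zero⟩
    · exact exists_smooth_extension_g hp hp1 hpt

theorem exists_balanced_level {p : ℝ≥0∞} (hp : 1 ≤ p) (hp1 : p ≠ 1) {r : ℝ}
    (hr : r ∈ Ioo (0 : ℝ) 1) : ∃ s ∈ Ioo (-1 : ℝ) 1,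
      ∫ ζ : Sph n, signPow (p.conjExponent.toReal - 1)
        (radial n r (height ζ) - radial n r s) ∂(sigma n) = 0 := by
  by_cases hpt : p = ⊤
  · subst hpt
    exact ⟨0, by norm_num, balanced_top hr⟩
  · have hq := one_lt_toReal_conjExponent hp hp1 hpt
    obtain ⟨s, hs, h⟩ := exists_balance_eq_zero (n := n) (sub_pos.2 hq)
      (r := r) ⟨by linarith [hr.1], hr.2⟩
    exact ⟨s, hs, balance_eq_zero_radial hr hs h⟩

theorem deriv_pos_of_eqOn_g {p : ℝ≥0∞} (hp : 1 ≤ p) {G : ℝ → ℝ}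
    (hG : ContDiffOn ℝ (⊤ : ℕ∞) G (Ioo (-1) 1)) (hg : EqOn (g n p) G (Ico 0 1)) {r : ℝ}
    (hr : r ∈ Ioo (0 : ℝ) 1) : 0 < deriv G r := by
  have hr' : r ∈ Ioo (-1 : ℝ) 1 := ⟨by linarith [hr.1], hr.2⟩
  by_cases hp1 : p = 1
  · subst hp1
    have hev : G =ᶠ[𝓝 r] fun r => (radial n r 1 - radial n r (-1)) / 2 := by
      filter_upwards [Ioo_mem_nhds hr.1 hr.2] with ρ hρ
      rw [← hg ⟨hρ.1.le, hρ.2⟩, g_one_eq ⟨hρ.1.le, hρ.2⟩]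
    rw [hev.deriv_eq, (hasDerivAt_g_one hr').deriv]
    exact deriv_g_one_pos ⟨hr.1.le, hr.2⟩
  · obtain ⟨s, hs, h⟩ := exists_balanced_level (n := n) hp hp1 hr
    exact deriv_pos_of_balanced hp hp1 hr hs h
      ((hG.contDiffAt (Ioo_mem_nhds hr'.1 hr'.2)).differentiableAt (by simp)) hg

theorem norm_fderiv_zero_le_gradConst {p : ℝ≥0∞} (hp : 1 ≤ p)
    {f : EuclideanSpace ℝ (Fin n) → EuclideanSpace ℝ (Fin m)} (hf : MemHardy p f) (hf0 : f 0 = 0) :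
    ‖fderiv ℝ f 0‖ ≤ gradConst n p * hardyNorm p f := by
  obtain ⟨G, -, hg, hd⟩ := exists_smooth_extension n hp
  exact norm_fderiv_zero_le hp hd hg hf hf0

theorem exists_extremal_gradient {p : ℝ≥0∞} (hp : 1 ≤ p) {e : EuclideanSpace ℝ (Fin m)}
    (he : ‖e‖ = 1) :
    ∃ f : EuclideanSpace ℝ (Fin n) → EuclideanSpace ℝ (Fin m),
      MemHardy p f ∧ f 0 = 0 ∧ 0 < hardyNorm p f ∧
        ‖fderiv ℝ f 0‖ = gradConst n p * hardyNorm p f := by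
  have hle := fun (f : EuclideanSpace ℝ (Fin n) → EuclideanSpace ℝ (Fin m)) (hf : MemHardy p f)
    (hf0 : f 0 = 0) => norm_fderiv_zero_le_gradConst hp hf hf0
  by_cases hp1 : p = 1
  · subst hp1
    exact exists_extremal_fderiv_one hle he
  · exact exists_extremal_fderiv hp hp1 hle he

theorem exists_extremal_point {p : ℝ≥0∞} (hp : 1 ≤ p) {x : EuclideanSpace ℝ (Fin n)}
    (hx : x ∈ Metric.ball (0 : EuclideanSpace ℝ (Fin n)) 1) {e : EuclideanSpace ℝ (Fin m)}
    (he : ‖e‖ = 1) :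
    ∃ f : EuclideanSpace ℝ (Fin n) → EuclideanSpace ℝ (Fin m),
      MemHardy p f ∧ f 0 = 0 ∧ 0 < hardyNorm p f ∧ ‖f x‖ = g n p ‖x‖ * hardyNorm p f := by
  -- At the origin both sides are 0, so any admissible mapping of positive norm will do; the
  -- gradient extremal is one.
  by_cases hx0 : x = 0
  · obtain ⟨f, h1, h2, h3, -⟩ := exists_extremal_gradient (n := n) hp he
    exact ⟨f, h1, h2, h3, by rw [hx0, h2, norm_zero, norm_zero, g_zero, zero_mul]⟩
  · by_cases hp1 : p = 1
    · subst hp1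
      exact exists_extremal_one hx hx0 he
    · obtain ⟨s, hs, h⟩ := exists_balanced_level (n := n) hp hp1
        ⟨norm_pos_iff.2 hx0, mem_ball_zero_iff.1 hx⟩
      obtain ⟨φ, -, hm, hφp, hφ0, hpos, heq, -⟩ := balanced_spec hp hp1 hx hx0 hs h
      exact exists_extremal_of_integral_eq hm hp hφp hφ0 he hx heq hpos

end AllExponents

end HarmonicSchwarz

open HarmonicSchwarz in
theorem mainTheorem1 (n m : ℕ) (hn : 2 ≤ n) (hm : 1 ≤ m) :
    -- for finite `p`, `g_p` is a smooth increasing diffeomorphism of `[0,1)` onto `[0,∞)`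
    (∀ p : ℝ≥0∞, 1 ≤ p → p ≠ ⊤ →
      IsIncreasingDiffeo (g n p) (Ico 0 1) (Ici 0) ∧ g n p 0 = 0) ∧
    -- the two inequalities
    (∀ p : ℝ≥0∞, 1 ≤ p →
      ∀ f : EuclideanSpace ℝ (Fin n) → EuclideanSpace ℝ (Fin m), MemHardy p f → f 0 = 0 →
        (∀ x ∈ Metric.ball (0 : EuclideanSpace ℝ (Fin n)) 1,
          ‖f x‖ ≤ g n p ‖x‖ * hardyNorm p f) ∧
        ‖fderiv ℝ f 0‖ ≤ gradConst n p * hardyNorm p f) ∧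
    -- sharpness of the first inequality, at every point of the ball
    (∀ p : ℝ≥0∞, 1 ≤ p → ∀ x ∈ Metric.ball (0 : EuclideanSpace ℝ (Fin n)) 1,
      ∃ f : EuclideanSpace ℝ (Fin n) → EuclideanSpace ℝ (Fin m),
        MemHardy p f ∧ f 0 = 0 ∧ 0 < hardyNorm p f ∧
          ‖f x‖ = g n p ‖x‖ * hardyNorm p f) ∧
    -- sharpness of the second inequality
    (∀ p : ℝ≥0∞, 1 ≤ p →
      ∃ f : EuclideanSpace ℝ (Fin n) → EuclideanSpace ℝ (Fin m),
        MemHardy p f ∧ f 0 = 0 ∧ 0 < hardyNorm p f ∧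
          ‖fderiv ℝ f 0‖ = gradConst n p * hardyNorm p f) ∧
    -- the case `p = ∞`; at the end point `r = 1`, `g_∞` takes its boundary value `1`
    (∀ r ∈ Ico (0 : ℝ) 1, g n ⊤ r = U n (r • north n)) ∧
    IsIncreasingDiffeo (Function.update (g n ⊤) 1 1) (Icc 0 1) (Icc 0 1) := by
  have : Fact (2 ≤ n) := ⟨hn⟩
  -- All extremal mappings are scalar functions times one fixed unit vector of the target, which
  -- exists because m ≥ 1.
  have he : ‖(EuclideanSpace.single ⟨0, hm⟩ 1 : EuclideanSpace ℝ (Fin m))‖ = 1 := by simp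
  refine ⟨fun p hp hpt => ?_, fun p hp f hf hf0 =>
    ⟨fun x hx => norm_le_g_mul_hardyNorm hp hf hf0 hx, norm_fderiv_zero_le_gradConst hp hf hf0⟩,
    fun p hp x hx => exists_extremal_point hp hx he, fun p hp => exists_extremal_gradient hp he,
    fun r hr => (g_top_eq hr).trans (U_smul_north r).symm, isIncreasingDiffeo_g_top⟩
  obtain ⟨G, hG, hg, hd⟩ := exists_smooth_extension n hp
  refine ⟨isIncreasingDiffeo_g hp hpt hG (fun r hr => ?_) hg, g_zero p⟩
  rcases hr.1.eq_or_lt with rfl | h0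
  · rw [hd.deriv]
    exact gradConst_pos hp
  · exact deriv_pos_of_eqOn_g hp hG hg ⟨h0, hr.2⟩
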